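/- **Conventions.** For an integer $q\ge 1$ let $[q]=\{1,\dots,q\}$, and let $d$ be the Hamming distance. Let $L\ge 1$ and $n\ge 1$ be integers and let $r$ be a real number. A code $C\subseteq A^n$ over a finite alphabet $A$ is *$(r,L)$ list-decodable* if for every $v\in A^n$ at most $L$ words $c\in C$ satisfy $d(c,v)\le rn$. A hypergraph is *$n$-uniform* if all its edges have exactly $n$ vertices. It is *$n$-partite* with parts $V_1,\dots,V_n$ if these partition its vertex set and every edge meets every $V_i$ in exactly one vertex. It is *$(v,e)$-sparse* if the union of any $e$ distinct edges has more than $v$ vertices. To an $n$-uniform $n$-partite hypergraph $H=(V,E)$ with parts $V_i=\{i\}\times[q]$ associate the code $C_H=\{(x_1,\dots,x_n)\in[q]^n:\{(1,x_1),\dots,(n,x_n)\}\in E\}$. **Statement.** 0. Let $n,L\ge 1$ and let $rn$ be a nonnegative integer. If $H=(V,E)$ is an $(n+(L+1)rn,\,L+1)$-sparse $n$-uniform $n$-partite hypergraph with parts $\{i\}\times[q]$, then $C_H\subseteq[q]^n$ is $(r,L)$ list-decodable, and $|C_H|=|E|$. 1. For all integers $n,L\ge 1$ there is $\mu_1>0$,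 depending only on $n$ and $L$, such that for every integer $q\ge 2$ and every real $r\in[0,\frac{L}{L+1})$ with $rn\in\mathbb{N}$ there is an $(r,L)$ list-decodable code $C\subseteq[q]^n$ with $|C|\ge \mu_1 q^{\,n-\frac{(L+1)rn}{L}}$. 2. For all integers $n\ge 1$ and $L\ge 2$ there is $\mu_2>0$, depending only on $n$ and $L$, such that for every integer $q\ge 2$ and every real $r\in[0,\frac{L}{L+1})$ with $rn\in\mathbb{N}$ and $\gcd(L,rn)=1$ there is an $(r,L)$ list-decodable code $C\subseteq[q]^n$ with $|C|\ge \mu_2 q^{\,n-\frac{(L+1)rn}{L}}(\log q)^{1/L}$. 3. For every integer $n\ge 1$ and every $\epsilon>0$ there is an integer $q(n,\epsilon)$ such that for every integer $q\ge q(n,\epsilon)$ and every real $r\in[0,\frac23)$ with $rn$ an odd positive integer there is an $(r,2)$ list-decodable code $C\subseteq[q]^n$ with $|C|>q^{\,n-\frac{3rn-1}{2}-\epsilon}$. 4. (Separation from linear codes.) For every $L\ge 2$ there are $\mu(n)>0$ and $q_0(n)\in\mathbb{N}$, depending only on $n$ and $L$, such that for every real $r\in[0,\frac{L}{L+1})$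 there is $n_0=n_0(r,L)$ such that the following two claims hold for all $n\ge n_0$ with $rn\in\mathbb{N}$. (a) For every finite field $\mathbb{F}$, every linear $(r,L)$ list-decodable code $D\subseteq\mathbb{F}^n$ has $\dim D\le n-\lceil\frac{L+1}{L}rn\rceil$. (b) If $L\nmid rn$, then for every $q\ge q_0(n)$ there is an $(r,L)$ list-decodable code $C\subseteq[q]^n$ with $|C|\ge\mu(n)\,q^{\,n-\frac{(L+1)rn}{L}}$ such that, whenever $\mathbb{F}$ is a field with $q$ elements, $|C|>|D|$ for every linear $(r,L)$ list-decodable code $D\subseteq\mathbb{F}^n$. -/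

import Mathlib

namespace ListDecoding

/-- A code `C` of length `n` over the alphabet `A` is `(r, L)` list-decodable if every closed
Hamming ball of radius `r * n`, centred at an arbitrary word, contains at most `L` codewords. -/
def IsListDecodable {A : Type*} [DecidableEq A] {n : ℕ} (r : ℝ) (L : ℕ)
    (C : Set (Fin n → A)) : Prop :=
  ∀ v : Fin n → A, {c ∈ C | (hammingDist c v : ℝ) ≤ r * n}.encard ≤ L

/-- A hypergraph is `k`-uniform if all its edges have exactly `k` vertices. -/
def IsUniform {V : Type*} (H : Hypergraph V) (k : ℕ) : Prop :=
  ∀ e ∈ H.edgeSet, e.encard = k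

/-- A hypergraph is `n`-partite with parts `P 0, …, P (n - 1)` if these form a partition of its
vertex set and every edge meets every part in exactly one vertex. -/
def IsPartite {V : Type*} {n : ℕ} (H : Hypergraph V) (P : Fin n → Set V) : Prop :=
  Pairwise (fun i j => Disjoint (P i) (P j)) ∧ (⋃ i, P i) = H.vertexSet ∧
    ∀ e ∈ H.edgeSet, ∀ i, (e ∩ P i).encard = 1

/-- A hypergraph is `(v, k)`-sparse if the union of any `k` distinct edges has more than `v`
vertices. -/
def IsSparse {V : Type*} (H : Hypergraph V) (v k : ℕ) : Prop :=
  ∀ S : Set (Set V), S ⊆ H.edgeSet → S.encard = k → (v : ℕ∞) < (⋃₀ S).encard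

/-- The `i`-th part `{(i, a) : a ∈ [q]}` of the vertex set `[n] × [q]`. -/
def part (n q : ℕ) (i : Fin n) : Set (Fin n × Fin q) := {p | p.1 = i}

/-- The edge `{(i, x i) : i ∈ [n]}` that corresponds to the word `x ∈ [q]^n`. -/
def edgeOfWord {n q : ℕ} (x : Fin n → Fin q) : Set (Fin n × Fin q) :=
  Set.range fun i => (i, x i)

/-- The code of a hypergraph on `[n] × [q]`: all words `(x_1, …, x_n)` for which
`{(1, x_1), …, (n, x_n)}` is an edge. -/
def codeOf {n q : ℕ} (H : Hypergraph (Fin n × Fin q)) : Set (Fin n → Fin q) :=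
  {x | edgeOfWord x ∈ H.edgeSet}

end ListDecoding

/-! ### Letter counts and list decoding. -/

namespace ListDecoding

/-! Balls are controlled by counting letters. At a given position the words of a ball of radius m
show the letter of the centre and at most one further letter for each word that disagrees there, so
L + 1 words in one ball span at most n + (L + 1)m letters (`coverage_le_of_ball`). Claim 0 follows,
since a union of edges has no more vertices than the words span letters. Each lower bound becomes
the search for many words, no L + 1 of which form a forbidden set, one of coverage at most n + (L +
1)m.

Claim 1 is the alteration method: there are O(q^(n + (L + 1)m)) forbidden sets
(`card_filter_coverage_le`), and at density a small constant times q^(-(L + 1)m/L) deleting one word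
from each costs at most half of the expected size (`exists_code_coverage`).

For claim 2 the density is raised by a factor q^ε, and then sets of at most 4(L + 1) words with too
small coverage and words in too many forbidden sets are removed (`exists_spread_subset`).
Submodularity of coverage together with gcd(L, m) = 1 shows that the remaining forbidden sets have
no Berge cycles of length 2, 3 or 4 (`uncrowded_of_isSpread`). A semi-random nibble finds an
independent set of proportion (log D)^(1/L)/D in such a hypergraph of maximum degree D^L
(`exists_independent_of_uncrowded`). With D of order q^ε the power of q cancels and the logarithm
remains.

For claim 3 (L = 2, m odd, 2k = 3m + 1) each word gets an extra coordinate t, and the extended words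
are taken in one fibre of a generic k-row integer matrix. A triple of coverage at most n + 3m misses
the bound given by genericity only by the contribution of the extra coordinate. For each pattern of
coincidences this forces one fixed relation a(t₁ - t₂) + b(t₁ - t₃) = 0
(`IsGeneric.exists_relation`). A Behrend set of t's has only trivial solutions, for which the extra
coordinate contributes nothing and genericity is violated. The fibre has size about q^(n + 1 - k -
ε).

For claim 4 let m ≥ 1 and a = ⌊(m - 1)/L⌋, so that the ceiling is m + a + 1. A linear code of
dimension at least n - (m + a) has L + 1 words in a ball of radius m
(`exists_finset_in_ball_of_finrank`): over a field of at most L elements by equidistributing the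
centre, otherwise as multiples of a word of weight at most m + a, or, if there is none, from the
almost-MDS structure of the code. When L does not divide m, rounding costs linear codes at least a
factor q^(1/L), and the codes of claim 1 beat them for large q. -/

/-- The number of pairs `(i, a)` such that some word of `S` has the letter `a` at position `i`. -/
def coverage {A : Type*} [DecidableEq A] {n : ℕ} (S : Finset (Fin n → A)) : ℕ :=
  ∑ i, (S.image fun c => c i).card

section coverage

variable {A : Type*} [DecidableEq A] {n : ℕ}

lemma coverage_singleton (x : Fin n → A) : coverage {x} = n := by
  simp [coverage]

/-- At each position the letters of S ∩ T lie among the letters common to S and T. This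
submodularity is what later excludes short cycles of forbidden sets. -/
lemma coverage_union_add_inter_le (S T : Finset (Fin n → A)) :
    coverage (S ∪ T) + coverage (S ∩ T) ≤ coverage S + coverage T := by
  unfold coverage
  rw [← Finset.sum_add_distrib, ← Finset.sum_add_distrib]
  refine Finset.sum_le_sum fun i _ => ?_
  have h1 := Finset.card_union_add_card_inter (S.image fun c => c i) (T.image fun c => c i)
  have h2 := Finset.card_le_card (Finset.image_inter_subset (fun c : Fin n → A => c i) S T)
  rw [Finset.image_union]
  omega

lemma coverage_le_of_ball {S : Finset (Fin n → A)} {v : Fin n → A} {m : ℕ}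
    (h : ∀ c ∈ S, hammingDist c v ≤ m) : coverage S ≤ n + S.card * m := by
  have h1 : ∀ i, (S.image fun c => c i).card ≤ 1 + ∑ c ∈ S, if c i ≠ v i then 1 else 0 := by
    intro i
    have : S.image (fun c => c i) ⊆
        insert (v i) ((S.filter fun c => c i ≠ v i).image fun c => c i) := by
      intro a ha
      obtain ⟨c, hc, rfl⟩ := Finset.mem_image.1 ha
      by_cases hcv : c i = v i
      · simp [hcv]
      · exact Finset.mem_insert_of_mem (Finset.mem_image_of_mem _ (by simp [hc, hcv]))
    calc _ ≤ _ := Finset.card_le_card this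
      _ ≤ _ := Finset.card_insert_le _ _
      _ ≤ (S.filter fun c => c i ≠ v i).card + 1 := by gcongr; exact Finset.card_image_le
      _ = _ := by rw [Finset.card_filter, add_comm]
  calc coverage S ≤ ∑ i : Fin n, (1 + ∑ c ∈ S, if c i ≠ v i then 1 else 0) :=
        Finset.sum_le_sum fun i _ => h1 i
    _ = n + ∑ c ∈ S, hammingDist c v := by
        rw [Finset.sum_add_distrib, Finset.sum_comm]
        simp [hammingDist, Finset.card_filter]
    _ ≤ n + S.card * m := by
        gcongr
        simpa using Finset.sum_le_card_nsmul S _ m h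

lemma isListDecodable_of_forall_finset {r : ℝ} {L m : ℕ} (hr : r * n = m) {C : Set (Fin n → A)}
    (h : ∀ S : Finset (Fin n → A), (S : Set (Fin n → A)) ⊆ C → S.card = L + 1 →
      ∀ v, ∃ c ∈ S, m < hammingDist c v) : IsListDecodable r L C := by
  intro v
  by_contra hlt
  push Not at hlt
  obtain ⟨T, hT, hcard⟩ := Set.exists_subset_encard_eq (Order.add_one_le_of_lt hlt)
  have hfin : T.Finite := Set.finite_of_encard_eq_coe (k := L + 1) (by simpa using hcard)
  obtain ⟨c, hc, hcv⟩ := h hfin.toFinset (fun c hc => (hT (by simpa using hc)).1) (by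
    have := hfin.encard_eq_coe_toFinset_card
    rw [hcard] at this
    exact_mod_cast this.symm) v
  have := (hT (by simpa using hc)).2
  rw [hr] at this
  exact absurd (by exact_mod_cast this) (not_le.2 hcv)

lemma isListDecodable_of_coverage {r : ℝ} {L m : ℕ} (hr : r * n = m) {C : Set (Fin n → A)}
    (h : ∀ S : Finset (Fin n → A), (S : Set (Fin n → A)) ⊆ C → S.card = L + 1 →
      n + (L + 1) * m < coverage S) : IsListDecodable r L C := by
  refine isListDecodable_of_forall_finset hr fun S hS hcard v => ?_
  by_contra! hle
  have := coverage_le_of_ball hle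
  rw [hcard] at this
  exact absurd (h S hS hcard) (not_lt.2 this)

lemma exists_mem_lt_hammingDist {r : ℝ} {L m : ℕ} (hr : r * n = m) {C : Set (Fin n → A)}
    (h : IsListDecodable r L C) (S : Finset (Fin n → A)) (hS : (S : Set (Fin n → A)) ⊆ C)
    (hcard : L < S.card) (v : Fin n → A) : ∃ c ∈ S, m < hammingDist c v := by
  by_contra! hle
  have h1 : (S : Set (Fin n → A)) ⊆ {c ∈ C | (hammingDist c v : ℝ) ≤ r * n} := fun c hc =>
    ⟨hS hc, by rw [hr]; exact_mod_cast hle c hc⟩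
  have h2 := (Set.encard_le_encard h1).trans (h v)
  rw [Set.encard_coe_eq_coe_finsetCard] at h2
  exact absurd (by exact_mod_cast h2) (not_le.2 hcard)

end coverage

/-! ### Hypergraphs and their codes. -/

section hypergraph

variable {n q : ℕ}

lemma edgeOfWord_injective : Function.Injective (edgeOfWord (n := n) (q := q)) := by
  intro x y hxy
  funext i
  have : (i, x i) ∈ edgeOfWord y := hxy ▸ ⟨i, rfl⟩
  obtain ⟨j, hj⟩ := this
  simp only [Prod.mk.injEq] at hj
  obtain ⟨rfl, hj⟩ := hj
  exact hj.symm

lemma exists_edgeOfWord_eq {H : Hypergraph (Fin n × Fin q)} (hH : IsPartite H (part n q))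
    {e : Set (Fin n × Fin q)} (he : e ∈ H.edgeSet) : ∃ x, edgeOfWord x = e := by
  have h1 : ∀ i, ∃ a, e ∩ part n q i = {(i, a)} := by
    intro i
    obtain ⟨⟨j, a⟩, hp⟩ := Set.encard_eq_one.1 (hH.2.2 e he i)
    have : (j, a) ∈ e ∩ part n q i := hp ▸ rfl
    obtain rfl : j = i := this.2
    exact ⟨a, hp⟩
  choose x hx using h1
  refine ⟨x, Set.ext fun ⟨i, a⟩ => ⟨?_, fun hp => ?_⟩⟩
  · rintro ⟨j, hj⟩
    rw [← hj]
    have : (j, x j) ∈ e ∩ part n q j := (hx j).symm ▸ rfl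
    exact this.1
  · have : (i, a) ∈ e ∩ part n q i := ⟨hp, rfl⟩
    rw [hx i] at this
    exact ⟨i, by simpa using Eq.symm this⟩

/-- Equality holds, but sparsity bounds the union from below, so this direction suffices. -/
lemma encard_sUnion_edgeOfWord_le (S : Finset (Fin n → Fin q)) :
    (⋃₀ (edgeOfWord '' (S : Set (Fin n → Fin q)))).encard ≤ coverage S := by
  have : ⋃₀ (edgeOfWord '' (S : Set (Fin n → Fin q))) ⊆
      (Finset.univ.biUnion fun i => (S.image fun c => c i).image (Prod.mk i) :
        Finset (Fin n × Fin q)) := by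
    rintro p ⟨e, ⟨c, hc, rfl⟩, ⟨i, rfl⟩⟩
    simp only [Finset.coe_biUnion, Set.mem_iUnion]
    exact ⟨i, by simp, by simpa using ⟨c, hc, rfl⟩⟩
  refine (Set.encard_le_encard this).trans ?_
  rw [Set.encard_coe_eq_coe_finsetCard]
  exact_mod_cast Finset.card_biUnion_le.trans (Finset.sum_le_sum fun i _ => Finset.card_image_le)

lemma isListDecodable_codeOf {L m : ℕ} {r : ℝ} (hr : r * n = m)
    {H : Hypergraph (Fin n × Fin q)} (hs : IsSparse H (n + (L + 1) * m) (L + 1)) :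
    IsListDecodable r L (codeOf H) := by
  refine isListDecodable_of_coverage hr fun S hS hcard => ?_
  have h1 := hs (edgeOfWord '' (S : Set (Fin n → Fin q))) (by rintro _ ⟨c, hc, rfl⟩; exact hS hc)
    (by rw [edgeOfWord_injective.encard_image, Set.encard_coe_eq_coe_finsetCard, hcard])
  exact_mod_cast h1.trans_le (encard_sUnion_edgeOfWord_le S)

lemma ncard_codeOf {H : Hypergraph (Fin n × Fin q)} (hH : IsPartite H (part n q)) :
    (codeOf H).ncard = H.edgeSet.ncard := by
  have : H.edgeSet = edgeOfWord '' codeOf H := by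
    ext e
    constructor
    · intro he
      obtain ⟨x, rfl⟩ := exists_edgeOfWord_eq hH he
      exact ⟨x, he, rfl⟩
    · rintro ⟨x, hx, rfl⟩
      exact hx
  rw [this, Set.ncard_image_of_injective _ edgeOfWord_injective]

end hypergraph

end ListDecoding

/-! ### Finite product measures and independence. -/

namespace ListDecoding

/-- The expectation of `f` when the coordinates of `ω` are chosen independently, with weights
`w v`. -/
noncomputable def prodExp {V α : Type*} [Fintype V] [DecidableEq V] [Fintype α]
    (w : V → α → ℝ) (f : (V → α) → ℝ) : ℝ :=
  ∑ ω, (∏ v, w v (ω v)) * f ω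

/-- The weights of a family of probability distributions on `α`. -/
structure IsWeight {V α : Type*} [Fintype α] (w : V → α → ℝ) : Prop where
  nonneg : ∀ v a, 0 ≤ w v a
  sum_eq_one : ∀ v, ∑ a, w v a = 1

lemma dependsOn_finset_prod {V α ι : Type*} {u : Finset ι} {h : ι → (V → α) → ℝ} {s : ι → Set V}
    (hh : ∀ i ∈ u, DependsOn (h i) (s i)) :
    DependsOn (fun ω => ∏ i ∈ u, h i ω) (⋃ i ∈ u, s i) := by
  intro x y hxy
  exact Finset.prod_congr rfl fun i hi => hh i hi fun v hv =>
    hxy v (Set.mem_biUnion hi hv)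

lemma dependsOn_eval {V α : Type*} (v : V) (g : α → ℝ) : DependsOn (fun ω : V → α => g (ω v)) {v} :=
  fun x y h => by simp [h v rfl]

section prodExp

variable {V α : Type*} [Fintype V] [DecidableEq V] [Fintype α] {w : V → α → ℝ}
  {f g : (V → α) → ℝ}

lemma prodExp_prod (g : V → α → ℝ) :
    prodExp w (fun ω => ∏ v, g v (ω v)) = ∏ v, ∑ a, w v a * g v a := by
  rw [Finset.prod_univ_sum]
  simp [prodExp, Finset.prod_mul_distrib]

lemma prodExp_const (hw : IsWeight w) (c : ℝ) : prodExp w (fun _ => c) = c := by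
  have h := prodExp_prod (w := w) (fun _ _ => 1)
  simp only [mul_one, hw.sum_eq_one, Finset.prod_const_one] at h
  have : prodExp w (fun _ => c) = c * prodExp w (fun _ => 1) := by
    simp [prodExp, Finset.mul_sum, mul_comm]
  rw [this, h, mul_one]

lemma prodExp_add : prodExp w (fun ω => f ω + g ω) = prodExp w f + prodExp w g := by
  simp [prodExp, mul_add, Finset.sum_add_distrib]

lemma prodExp_sub : prodExp w (fun ω => f ω - g ω) = prodExp w f - prodExp w g := by
  simp [prodExp, mul_sub, Finset.sum_sub_distrib]

lemma prodExp_const_mul (c : ℝ) : prodExp w (fun ω => c * f ω) = c * prodExp w f := by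
  simp [prodExp, Finset.mul_sum, mul_left_comm]

lemma prodExp_mul_const (c : ℝ) : prodExp w (fun ω => f ω * c) = prodExp w f * c := by
  simp [prodExp, Finset.sum_mul, mul_assoc]

lemma prodExp_sum {ι : Type*} (s : Finset ι) (f : ι → (V → α) → ℝ) :
    prodExp w (fun ω => ∑ i ∈ s, f i ω) = ∑ i ∈ s, prodExp w (f i) := by
  simp only [prodExp, Finset.mul_sum]
  rw [Finset.sum_comm]

lemma prodExp_mono (hw : IsWeight w) (h : ∀ ω, f ω ≤ g ω) : prodExp w f ≤ prodExp w g :=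
  Finset.sum_le_sum fun ω _ =>
    mul_le_mul_of_nonneg_left (h ω) (Finset.prod_nonneg fun v _ => hw.nonneg v _)

lemma prodExp_nonneg (hw : IsWeight w) (h : ∀ ω, 0 ≤ f ω) : 0 ≤ prodExp w f :=
  Finset.sum_nonneg fun ω _ =>
    mul_nonneg (Finset.prod_nonneg fun v _ => hw.nonneg v _) (h ω)

lemma exists_prodExp_le (hw : IsWeight w) (f : (V → α) → ℝ) : ∃ ω, prodExp w f ≤ f ω := by
  by_contra! h
  have h1 : prodExp w (fun ω => prodExp w f - f ω) = 0 := by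
    rw [prodExp_sub, prodExp_const hw, sub_self]
  have h2 := (Finset.sum_eq_zero_iff_of_nonneg fun ω _ => mul_nonneg
    (Finset.prod_nonneg fun v _ => hw.nonneg v (ω v)) (sub_nonneg.2 (h ω).le)).1 h1
  have h3 := prodExp_const hw 1
  have h4 : prodExp w (fun _ => 1) = 0 := by
    refine Finset.sum_eq_zero fun ω hω => ?_
    have := h2 ω hω
    rcases mul_eq_zero.1 this with h5 | h5
    · rw [h5, zero_mul]
    · linarith [h ω]
  linarith

/-- Take two independent copies of ω. Exchanging their coordinates outside s preserves the weight
and turns f(x)g(x) into f(x)g(y). -/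
lemma prodExp_mul (hw : IsWeight w) {s t : Set V} (hf : DependsOn f s) (hg : DependsOn g t)
    (hst : Disjoint s t) : prodExp w (fun ω => f ω * g ω) = prodExp w f * prodExp w g := by
  classical
  let mix : (V → α) × (V → α) → (V → α) × (V → α) := fun x =>
    (fun v => if v ∈ s then x.1 v else x.2 v, fun v => if v ∈ s then x.2 v else x.1 v)
  have hmix : Function.Involutive mix := by
    rintro ⟨x, y⟩
    ext v <;> simp only [mix] <;> split_ifs <;> rfl
  have h1 : prodExp w f * prodExp w g =
      ∑ x : (V → α) × (V → α), ((∏ v, w v (x.1 v)) * ∏ v, w v (x.2 v)) * (f x.1 * g x.2) := by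
    rw [prodExp, prodExp, Finset.sum_mul_sum, Fintype.sum_prod_type]
    exact Finset.sum_congr rfl fun _ _ => Finset.sum_congr rfl fun _ _ => by ring
  have h2 : prodExp w (fun ω => f ω * g ω) =
      ∑ x : (V → α) × (V → α), ((∏ v, w v (x.1 v)) * ∏ v, w v (x.2 v)) * (f x.1 * g x.1) := by
    rw [← mul_one (prodExp w _), ← prodExp_const hw 1, prodExp, prodExp, Finset.sum_mul_sum,
      Fintype.sum_prod_type]
    exact Finset.sum_congr rfl fun _ _ => Finset.sum_congr rfl fun _ _ => by ring
  rw [h1, h2, ← Equiv.sum_comp (hmix.toPerm mix)]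
  refine Finset.sum_congr rfl fun x _ => ?_
  have hW : (∏ v, w v ((mix x).1 v)) * ∏ v, w v ((mix x).2 v) =
      (∏ v, w v (x.1 v)) * ∏ v, w v (x.2 v) := by
    rw [← Finset.prod_mul_distrib, ← Finset.prod_mul_distrib]
    refine Finset.prod_congr rfl fun v _ => ?_
    simp only [mix]
    split_ifs
    · rfl
    · rw [mul_comm]
  have hF : f (mix x).1 = f x.1 := hf fun v hv => by simp [mix, hv]
  have hG : g (mix x).1 = g x.2 := hg fun v hv => by
    simp [mix, Set.disjoint_right.1 hst hv]
  change ((∏ v, w v ((mix x).1 v)) * ∏ v, w v ((mix x).2 v)) * (f (mix x).1 * g (mix x).1) = _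
  rw [hW, hF, hG]

lemma prodExp_finset_prod (hw : IsWeight w) {ι : Type*} (u : Finset ι)
    {h : ι → (V → α) → ℝ} {s : ι → Set V} (hh : ∀ i ∈ u, DependsOn (h i) (s i))
    (hs : (u : Set ι).PairwiseDisjoint s) :
    prodExp w (fun ω => ∏ i ∈ u, h i ω) = ∏ i ∈ u, prodExp w (h i) := by
  classical
  induction u using Finset.induction_on with
  | empty => simpa using prodExp_const hw 1
  | insert i u hi ih =>
    simp only [Finset.prod_insert hi]
    rw [prodExp_mul hw (hh i (by simp)) (dependsOn_finset_prod fun j hj => hh j (by simp [hj])) ?_,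
      ih (fun j hj => hh j (by simp [hj])) (hs.subset (by simp))]
    rw [Set.disjoint_iUnion₂_right]
    intro j hj
    exact hs (by simp) (by simp [hj]) (by rintro rfl; exact hi hj)

lemma prodExp_eval (hw : IsWeight w) (v : V) (g : α → ℝ) :
    prodExp w (fun ω => g (ω v)) = ∑ a, w v a * g a := by
  have h := prodExp_prod (w := w) (fun u a => if u = v then g a else 1)
  simp only [Finset.prod_ite_eq', Finset.mem_univ, if_true] at h
  rw [h, Finset.prod_eq_single v]
  · simp
  · intro u _ huv
    simp [huv, hw.sum_eq_one]
  · simp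

end prodExp

/-! ### Random subsets. -/

section sampling

variable {V : Type*} [Fintype V] [DecidableEq V]

/-- The alteration method: a random set that contains each element with probability `p`. -/
lemma exists_finset_le_card_sub_sum {p : ℝ} (hp0 : 0 ≤ p) (hp1 : p ≤ 1)
    (𝓑 : Finset (Finset V)) (c : Finset V → ℝ) :
    ∃ S : Finset V, p * Fintype.card V - ∑ B ∈ 𝓑, c B * p ^ B.card ≤
      S.card - ∑ B ∈ 𝓑 with B ⊆ S, c B := by
  let w : V → Bool → ℝ := fun _ b => if b then p else 1 - p
  have hw : IsWeight w :=
    ⟨fun v b => by cases b <;> simp [w, hp0, hp1], fun v => by simp [w]⟩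
  let ind : Bool → ℝ := fun b => if b then 1 else 0
  -- The event B ⊆ S is a product of coordinate indicators, so its probability is p^|B|. Some
  -- outcome attains the mean of F.
  let F : (V → Bool) → ℝ := fun ω => ∑ v, ind (ω v) - ∑ B ∈ 𝓑, c B * ∏ v ∈ B, ind (ω v)
  obtain ⟨ω, hω⟩ := exists_prodExp_le hw F
  refine ⟨Finset.univ.filter fun v => ω v, le_trans (le_of_eq ?_) (hω.trans (le_of_eq ?_))⟩
  · have h1 : ∀ v, prodExp w (fun ω => ind (ω v)) = p := fun v => by
      rw [prodExp_eval hw]; simp [w, ind]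
    simp only [F]
    rw [prodExp_sub, prodExp_sum, prodExp_sum]
    simp only [h1, prodExp_const_mul]
    congr 1
    · simp [mul_comm]
    · refine Finset.sum_congr rfl fun B _ => ?_
      rw [prodExp_finset_prod hw B (s := fun v => {v}) (fun v _ => dependsOn_eval v ind)]
      · simp [h1]
      · intro u _ v _ huv
        simpa using huv
  · simp only [F]
    congr 1
    · simp [ind]
    · rw [Finset.sum_filter]
      refine Finset.sum_congr rfl fun B _ => ?_
      simp only [ind, Finset.prod_ite_zero, Finset.prod_const_one, mul_ite, mul_one, mul_zero]
      refine if_congr ?_ rfl rfl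
      simp [Finset.subset_iff]

end sampling

/-! ### Counting sets of small coverage. -/

section counting

/-- A further letter is either one of at most k old letters, at no cost, or one of q letters at cost
1/q, so the sum grows by a factor of at most k + 1. -/
lemma sum_inv_pow_card_image_le (q k : ℕ) :
    ∑ a : Fin k → Fin q, ((q : ℝ)⁻¹) ^ (Finset.univ.image a).card ≤ k.factorial := by
  induction k with
  | zero => simp
  | succ k ih =>
    rw [← (Fin.consEquiv fun _ => Fin q).sum_comp, Fintype.sum_prod_type, Finset.sum_comm]
    have key : ∀ a : Fin k → Fin q, ∑ b : Fin q,
        ((q : ℝ)⁻¹) ^ (Finset.univ.image (Fin.cons b a : Fin (k + 1) → Fin q)).card ≤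
          (k + 1) * ((q : ℝ)⁻¹) ^ (Finset.univ.image a).card := by
      intro a
      have him : ∀ b, Finset.univ.image (Fin.cons b a : Fin (k + 1) → Fin q) =
          insert b (Finset.univ.image a) := by
        intro b
        ext x
        simp [Fin.exists_fin_succ, eq_comm]
      have hterm : ∀ b : Fin q,
          ((q : ℝ)⁻¹) ^ (Finset.univ.image (Fin.cons b a : Fin (k + 1) → Fin q)).card ≤
          (if b ∈ Finset.univ.image a then ((q : ℝ)⁻¹) ^ (Finset.univ.image a).card else 0) +
            (q : ℝ)⁻¹ * ((q : ℝ)⁻¹) ^ (Finset.univ.image a).card := by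
        intro b
        rw [him]
        split_ifs with hb
        · rw [Finset.insert_eq_of_mem hb]
          have : 0 ≤ (q : ℝ)⁻¹ * ((q : ℝ)⁻¹) ^ (Finset.univ.image a).card := by positivity
          linarith
        · rw [Finset.card_insert_of_notMem hb, pow_succ', zero_add]
      refine (Finset.sum_le_sum fun b _ => hterm b).trans ?_
      rw [Finset.sum_add_distrib, Finset.sum_ite_mem, Finset.sum_const, Finset.sum_const,
        Finset.univ_inter, Finset.card_univ, Fintype.card_fin, nsmul_eq_mul, nsmul_eq_mul,
        ← mul_assoc, add_mul]
      have h1 : ((Finset.univ.image a).card : ℝ) ≤ k := by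
        exact_mod_cast Finset.card_image_le.trans (by simp)
      have h2 : (q : ℝ) * (q : ℝ)⁻¹ ≤ 1 := mul_inv_le_one
      gcongr
    refine (Finset.sum_le_sum fun a _ => key a).trans ?_
    rw [← Finset.mul_sum, Nat.factorial_succ]
    push_cast
    gcongr

/-- Multiplied over the positions, `sum_inv_pow_card_image_le` is a weighted count of all n × k
arrays, in which an enumerated set of coverage at most u weighs at least q^(-u). -/
lemma card_filter_coverage_le {n q k u : ℕ} (hq : 1 ≤ q) (𝓢 : Finset (Finset (Fin n → Fin q)))
    (h𝓢 : ∀ S ∈ 𝓢, S.card = k ∧ coverage S ≤ u) :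
    (𝓢.card : ℝ) ≤ (k.factorial : ℝ) ^ n * (q : ℝ) ^ u := by
  have hq0 : (0 : ℝ) < q := by exact_mod_cast hq
  have henum : ∀ S ∈ 𝓢, ∃ x : Fin n → Fin k → Fin q,
      Finset.univ.image (fun a i => x i a) = S := by
    intro S hS
    let e := S.equivFinOfCardEq (h𝓢 S hS).1
    refine ⟨fun i a => (e.symm a : Fin n → Fin q) i, ?_⟩
    ext c
    simp only [Finset.mem_image, Finset.mem_univ, true_and]
    constructor
    · rintro ⟨a, rfl⟩
      exact (e.symm a).2
    · intro hc
      exact ⟨e ⟨c, hc⟩, by simp⟩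
  have : Nonempty (Fin q) := ⟨⟨0, hq⟩⟩
  choose! x hx using henum
  have hinj : Set.InjOn x 𝓢 := fun S hS T hT hST => by rw [← hx S hS, ← hx T hT, hST]
  have hcov : ∀ S ∈ 𝓢, ∑ i, (Finset.univ.image (x S i)).card = coverage S := by
    intro S hS
    unfold coverage
    refine Finset.sum_congr rfl fun i _ => ?_
    conv_rhs => rw [← hx S hS, Finset.image_image]
    rfl
  have h1 : ∑ y : Fin n → Fin k → Fin q, ((q : ℝ)⁻¹) ^ ∑ i, (Finset.univ.image (y i)).card ≤
      (k.factorial : ℝ) ^ n := by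
    have := Finset.prod_univ_sum (fun _ : Fin n => (Finset.univ : Finset (Fin k → Fin q)))
      (fun _ a => ((q : ℝ)⁻¹) ^ (Finset.univ.image a).card)
    simp only [Fintype.piFinset_univ, Finset.prod_const, Finset.card_univ, Fintype.card_fin] at this
    simp only [← Finset.prod_pow_eq_pow_sum, ← this]
    gcongr
    exact sum_inv_pow_card_image_le q k
  have h2 : (𝓢.card : ℝ) * ((q : ℝ)⁻¹) ^ u ≤ (k.factorial : ℝ) ^ n := by
    refine le_trans ?_ h1
    calc (𝓢.card : ℝ) * ((q : ℝ)⁻¹) ^ u = ∑ y ∈ 𝓢.image x, ((q : ℝ)⁻¹) ^ u := by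
          rw [Finset.sum_const, Finset.card_image_of_injOn hinj, nsmul_eq_mul]
      _ ≤ ∑ y ∈ 𝓢.image x, ((q : ℝ)⁻¹) ^ ∑ i, (Finset.univ.image (y i)).card := by
          refine Finset.sum_le_sum fun y hy => ?_
          obtain ⟨S, hS, rfl⟩ := Finset.mem_image.1 hy
          refine pow_le_pow_of_le_one (by positivity) (inv_le_one_of_one_le₀ (by exact_mod_cast hq)) ?_
          rw [hcov S hS]
          exact (h𝓢 S hS).2
      _ ≤ _ := Finset.sum_le_sum_of_subset_of_nonneg (Finset.subset_univ _)
          fun _ _ _ => by positivity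
  rwa [inv_pow, ← div_eq_mul_inv, div_le_iff₀ (by positivity)] at h2

end counting

lemma exists_subset_forall_not_subset {V : Type*} [DecidableEq V] (S : Finset V)
    (𝓑 : Finset (Finset V)) (h : ∀ B ∈ 𝓑, B.Nonempty) :
    ∃ T ⊆ S, S.card ≤ T.card + 𝓑.card ∧ ∀ B ∈ 𝓑, ¬ B ⊆ T := by
  classical
  let R : Finset V := 𝓑.attach.image fun B : {B // B ∈ 𝓑} => (h B.1 B.2).choose
  refine ⟨S \ R, Finset.sdiff_subset, ?_, fun B hB hBT => ?_⟩
  · have h1 : R.card ≤ 𝓑.card := Finset.card_image_le.trans (by simp)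
    have h2 := Finset.le_card_sdiff R S
    omega
  · have h1 := hBT (h B hB).choose_spec
    refine (Finset.mem_sdiff.1 h1).2 ?_
    exact Finset.mem_image.2 ⟨⟨B, hB⟩, Finset.mem_attach _ _, rfl⟩

/-- Codes from the alteration method. -/
lemma exists_code_coverage (n L : ℕ) (hL : 1 ≤ L) : ∃ μ : ℝ, 0 < μ ∧ ∀ q m : ℕ, 1 ≤ q →
    ∃ C : Finset (Fin n → Fin q),
      (∀ S : Finset (Fin n → Fin q), S ⊆ C → S.card = L + 1 → n + (L + 1) * m < coverage S) ∧
      μ * (q : ℝ) ^ ((n : ℝ) - m * (L + 1) / L) ≤ C.card := by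
  classical
  set A : ℝ := ((L + 1).factorial : ℝ) ^ n with hA
  have hA1 : 1 ≤ A := one_le_pow₀ (by exact_mod_cast Nat.one_le_iff_ne_zero.2 (Nat.factorial_ne_zero _))
  have hL0 : (0 : ℝ) < L := by exact_mod_cast hL
  refine ⟨1 / (4 * A), by positivity, fun q m hq => ?_⟩
  have hq1 : (1 : ℝ) ≤ q := by exact_mod_cast hq
  have hq0 : (0 : ℝ) < q := by linarith
  set E : Finset (Finset (Fin n → Fin q)) :=
    Finset.univ.filter fun S => S.card = L + 1 ∧ coverage S ≤ n + (L + 1) * m with hE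
  have hEcard : (E.card : ℝ) ≤ A * (q : ℝ) ^ (n + (L + 1) * m) :=
    card_filter_coverage_le hq E fun S hS => (Finset.mem_filter.1 hS).2
  -- The power of q makes p^L cancel q^((L + 1)m). The constant then keeps the expected number of
  -- forbidden sets below half of the expected size p q^n.
  set p : ℝ := 1 / (2 * A) * (q : ℝ) ^ (-((m : ℝ) * (L + 1) / L)) with hp
  have hδ1 : 1 / (2 * A) ≤ 1 := by rw [div_le_one (by positivity)]; linarith
  have hp0 : 0 < p := by positivity
  have hp1 : p ≤ 1 := by
    have : (q : ℝ) ^ (-((m : ℝ) * (L + 1) / L)) ≤ 1 :=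
      Real.rpow_le_one_of_one_le_of_nonpos hq1 (by
        have : 0 ≤ (m : ℝ) * (L + 1) / L := by positivity
        linarith)
    exact mul_le_one₀ hδ1 (by positivity) this
  have hpL : p ^ L * (q : ℝ) ^ ((L + 1) * m) ≤ 1 / (2 * A) := by
    have h1 : ((q : ℝ) ^ (-((m : ℝ) * (L + 1) / L))) ^ L * (q : ℝ) ^ ((L + 1) * m) = 1 := by
      rw [← Real.rpow_natCast, ← Real.rpow_natCast, ← Real.rpow_mul hq0.le, ← Real.rpow_add hq0]
      convert Real.rpow_zero (q : ℝ) using 2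
      push_cast
      field_simp
      ring
    rw [hp, mul_pow, mul_assoc, h1, mul_one]
    exact pow_le_of_le_one (by positivity) hδ1 (by omega)
  obtain ⟨S, hS⟩ := exists_finset_le_card_sub_sum hp0.le hp1 E fun _ => 1
  obtain ⟨T, hTS, hTcard, hT⟩ := exists_subset_forall_not_subset S (E.filter (· ⊆ S))
    fun B hB => Finset.card_pos.1 (by simp [hE] at hB; omega)
  refine ⟨T, fun B hBT hB => ?_, ?_⟩
  · by_contra! hcov
    exact hT B (by simp [hE, hB, hcov, hBT.trans hTS]) hBT
  · have h1 : ∑ B ∈ E, 1 * p ^ B.card = E.card * (p * p ^ L) := by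
      rw [Finset.sum_congr rfl fun B hB => by rw [(Finset.mem_filter.1 hB).2.1, one_mul],
        Finset.sum_const, nsmul_eq_mul, pow_succ']
    have h2 : E.card * (p * p ^ L) ≤ p * (q : ℝ) ^ n / 2 := by
      calc E.card * (p * p ^ L) ≤ A * (q : ℝ) ^ (n + (L + 1) * m) * (p * p ^ L) := by gcongr
        _ = A * p * (q : ℝ) ^ n * (p ^ L * (q : ℝ) ^ ((L + 1) * m)) := by ring
        _ ≤ A * p * (q : ℝ) ^ n * (1 / (2 * A)) := by gcongr
        _ = _ := by field_simp
    rw [h1] at hS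
    simp only [Fintype.card_fun, Fintype.card_fin, Nat.cast_pow, Finset.sum_const, nsmul_eq_mul,
      mul_one] at hS
    have h3 : (S.card : ℝ) ≤ T.card + (E.filter (· ⊆ S)).card := by exact_mod_cast hTcard
    have h4 : 1 / (4 * A) * (q : ℝ) ^ ((n : ℝ) - m * (L + 1) / L) = p * (q : ℝ) ^ n / 2 := by
      rw [sub_eq_add_neg, Real.rpow_add hq0, Real.rpow_natCast, hp]
      ring
    rw [h4]
    linarith

end ListDecoding

/-! ### Uncrowded hypergraphs and the second moment. -/

namespace ListDecoding

/-- A hypergraph is uncrowded if it has no Berge cycles of length `2`, `3` or `4`. -/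
structure Uncrowded {V : Type*} (E : Finset (Finset V)) : Prop where
  two : ∀ e ∈ E, ∀ f ∈ E, e ≠ f → ∀ x y, x ∈ e → x ∈ f → y ∈ e → y ∈ f → x = y
  three : ∀ e ∈ E, ∀ f ∈ E, ∀ g ∈ E, e ≠ f → f ≠ g → g ≠ e → ∀ x y z, x ∈ e → x ∈ f → y ∈ f →
    y ∈ g → z ∈ g → z ∈ e → x ≠ y → y ≠ z → z ≠ x → False
  four : ∀ e ∈ E, ∀ f ∈ E, ∀ g ∈ E, ∀ h ∈ E, e ≠ f → f ≠ g → g ≠ h → h ≠ e → e ≠ g → f ≠ h →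
    ∀ x y z t, x ∈ e → x ∈ f → y ∈ f → y ∈ g → z ∈ g → z ∈ h → t ∈ h → t ∈ e →
    x ≠ y → y ≠ z → z ≠ t → t ≠ x → x ≠ z → y ≠ t → False

/-- `u` together with its neighbours along edges other than `e`. -/
def outerNbhd {V : Type*} (E : Finset (Finset V)) (e : Finset V) (u : V) : Set V :=
  {x | x = u ∨ ∃ f ∈ E, f ≠ e ∧ u ∈ f ∧ x ∈ f}

namespace Uncrowded

variable {V : Type*} {E : Finset (Finset V)}

lemma mono (hE : Uncrowded E) {E' : Finset (Finset V)} (h : E' ⊆ E) : Uncrowded E' where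
  two e he f hf := hE.two e (h he) f (h hf)
  three e he f hf g hg := hE.three e (h he) f (h hf) g (h hg)
  four e he f hf g hg k hk := hE.four e (h he) f (h hf) g (h hg) k (h hk)

/-- A common point closes a Berge cycle of length 2 or 3 with e. The fates of the vertices of one
edge thus become independent. -/
lemma disjoint_outerNbhd (hE : Uncrowded E) {e : Finset V} (he : e ∈ E) {u v : V} (hu : u ∈ e)
    (hv : v ∈ e) (huv : u ≠ v) : Disjoint (outerNbhd E e u) (outerNbhd E e v) := by
  rw [Set.disjoint_left]
  rintro x (rfl | ⟨f, hf, hfe, huf, hxf⟩) (rfl | ⟨g, hg, hge, hvg, hxg⟩)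
  · exact huv rfl
  · exact huv (hE.two e he g hg hge.symm x v hu hxg hv hvg)
  · exact huv (hE.two e he f hf hfe.symm u x hu huf hv hxf)
  · by_cases hfg : f = g
    · subst hfg
      exact huv (hE.two e he f hf hfe.symm u v hu huf hv hvg)
    · have h1 : u ≠ x := by
        rintro rfl
        exact huv (hE.two e he g hg hge.symm u v hu hxg hv hvg)
      have h2 : x ≠ v := by
        rintro rfl
        exact huv (hE.two e he f hf hfe.symm u x hu huf hv hxf)
      exact hE.three e he f hf g hg hfe.symm hfg hge u x v hu huf hxf hxg hvg hv h1 h2 huv.symm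

/-- A common point closes a Berge cycle of length at most 4 with e and e'. This makes edges through
w pairwise independent, which is all that the second moment needs. -/
lemma disjoint_outerNbhd_of_ne (hE : Uncrowded E) {e e' : Finset V} (he : e ∈ E) (he' : e' ∈ E)
    (hee : e ≠ e') {w u v : V} (hw : w ∈ e) (hw' : w ∈ e') (hu : u ∈ e) (hv : v ∈ e')
    (huw : u ≠ w) (hvw : v ≠ w) : Disjoint (outerNbhd E e u) (outerNbhd E e' v) := by
  have hue' : u ∉ e' := fun h => huw (hE.two e he e' he' hee u w hu h hw hw')
  have hve : v ∉ e := fun h => hvw (hE.two e he e' he' hee v w h hv hw hw')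
  have huv : u ≠ v := by rintro rfl; exact hve hu
  have tri : ∀ f ∈ E, u ∈ f → v ∈ f → False := by
    intro f hf huf hvf
    have h1 : f ≠ e := by rintro rfl; exact hve hvf
    have h2 : f ≠ e' := by rintro rfl; exact hue' huf
    exact hE.three e he f hf e' he' h1.symm h2 hee.symm u v w hu huf hvf hv hw' hw huv hvw huw.symm
  rw [Set.disjoint_left]
  rintro x (rfl | ⟨f, hf, hfe, huf, hxf⟩) (rfl | ⟨g, hg, hge, hvg, hxg⟩)
  · exact huv rfl
  · exact tri g hg hxg hvg
  · exact tri f hf huf hxf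
  · by_cases hfg : f = g
    · subst hfg
      exact tri f hf huf hvg
    · have hfe' : f ≠ e' := by rintro rfl; exact hue' huf
      have hge' : g ≠ e := by rintro rfl; exact hve hvg
      have hxu : u ≠ x := by rintro rfl; exact tri g hg hxg hvg
      have hxv : x ≠ v := by rintro rfl; exact tri f hf huf hxf
      have hxw : x ≠ w := by
        rintro rfl
        exact huw (hE.two e he f hf hfe.symm u x hu huf hw hxf)
      exact hE.four e he f hf g hg e' he' hfe.symm hfg hge hee.symm hge'.symm hfe' u x v w hu huf
        hxf hxg hvg hv hw' hw hxu hxv hvw huw.symm huv hxw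

end Uncrowded

section chebyshev

variable {V α : Type*} [Fintype V] [DecidableEq V] [Fintype α] {w : V → α → ℝ}

/-- Pairwise independence and X² ≤ bX bound the variance of the sum by bM. -/
lemma prodExp_chebyshev (hw : IsWeight w) {ι : Type*} (s : Finset ι) {X : ι → (V → α) → ℝ}
    {b M τ : ℝ} (hX0 : ∀ i ∈ s, ∀ ω, 0 ≤ X i ω) (hXb : ∀ i ∈ s, ∀ ω, X i ω ≤ b)
    (hpair : ∀ i ∈ s, ∀ j ∈ s, i ≠ j →
      prodExp w (fun ω => X i ω * X j ω) = prodExp w (X i) * prodExp w (X j))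
    (hM : ∑ i ∈ s, prodExp w (X i) ≤ M) (hb : 0 ≤ b) (hτ : 0 < τ) :
    prodExp w (fun ω => if M + τ < ∑ i ∈ s, X i ω then 1 else 0) ≤ b * M / τ ^ 2 := by
  classical
  set μ := ∑ i ∈ s, prodExp w (X i) with hμ
  have h1 : prodExp w (fun ω => (∑ i ∈ s, X i ω) * ∑ i ∈ s, X i ω) ≤ b * μ + μ ^ 2 := by
    simp only [Finset.sum_mul_sum]
    rw [prodExp_sum, sq, hμ, Finset.sum_mul_sum, ← hμ, Finset.mul_sum, ← Finset.sum_add_distrib]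
    refine Finset.sum_le_sum fun i hi => ?_
    rw [prodExp_sum, ← Finset.add_sum_erase s _ hi,
      ← Finset.add_sum_erase s (fun j => prodExp w (X i) * prodExp w (X j)) hi]
    have h2 : prodExp w (fun ω => X i ω * X i ω) ≤ b * prodExp w (X i) := by
      rw [← prodExp_const_mul]
      exact prodExp_mono hw fun ω => mul_le_mul_of_nonneg_right (hXb i hi ω) (hX0 i hi ω)
    have h3 : ∑ j ∈ s.erase i, prodExp w (fun ω => X i ω * X j ω) =
        ∑ j ∈ s.erase i, prodExp w (X i) * prodExp w (X j) :=
      Finset.sum_congr rfl fun j hj => hpair i hi j (Finset.mem_of_mem_erase hj)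
        (Finset.ne_of_mem_erase hj).symm
    have h4 : 0 ≤ prodExp w (X i) * prodExp w (X i) := mul_self_nonneg _
    rw [h3]
    linarith
  have h5 : prodExp w (fun ω => (∑ i ∈ s, X i ω - μ) ^ 2) ≤ b * M := by
    have h6 : (fun ω => (∑ i ∈ s, X i ω - μ) ^ 2) = fun ω =>
        ((∑ i ∈ s, X i ω) * ∑ i ∈ s, X i ω) - ((2 * μ) * (∑ i ∈ s, X i ω) - μ ^ 2) := by
      funext ω; ring
    rw [h6, prodExp_sub, prodExp_sub, prodExp_const_mul, prodExp_const hw, prodExp_sum, ← hμ]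
    have : b * μ ≤ b * M := by gcongr
    nlinarith
  rw [le_div_iff₀ (by positivity), ← prodExp_mul_const]
  refine (prodExp_mono hw fun ω => ?_).trans h5
  split_ifs with h
  · rw [one_mul]
    exact pow_le_pow_left₀ hτ.le (by linarith) 2
  · rw [zero_mul]
    positivity

end chebyshev

end ListDecoding

/-! ### Random variables in a round of the nibble. -/

namespace ListDecoding

section nibble

variable {V : Type*} [DecidableEq V]

/-- The indicator of the state `0` (a vertex is selected). -/
def selInd (a : Fin 3) : ℝ := if a = 0 then 1 else 0

/-- The indicator of the state `1` (a vertex passes its coin flip). -/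
def keepInd (a : Fin 3) : ℝ := if a = 1 then 1 else 0

/-- The weights of the three states of the vertices in a step of the nibble. -/
def nibbleWeight (p : ℝ) (c : V → ℝ) (v : V) : Fin 3 → ℝ :=
  ![p, (1 - p) * c v, (1 - p) * (1 - c v)]

/-- The indicator of the event that no edge of `F` through `u` is otherwise selected. -/
noncomputable def unclosed (U : Finset V) (F : Finset (Finset V)) (u : V) (ω : V → Fin 3) : ℝ :=
  ∏ f ∈ F with u ∈ f, (1 - ∏ x ∈ (f ∩ U).erase u, selInd (ω x))

/-- The probability of the event that no edge of `F` through `u` is otherwise selected. -/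
noncomputable def unclosedProb (p : ℝ) (U : Finset V) (F : Finset (Finset V)) (u : V) : ℝ :=
  ∏ f ∈ F with u ∈ f, (1 - p ^ ((f ∩ U).card - 1))

/-- The indicator of the event that `u` is kept when the edge `e` is ignored. -/
noncomputable def keptOff (U : Finset V) (E : Finset (Finset V)) (e : Finset V) (u : V)
    (ω : V → Fin 3) : ℝ :=
  keepInd (ω u) * unclosed U (E.erase e) u ω

/-- The indicator of the event that `j` of the vertices of `e` other than `w` are kept (when `e`
is ignored) and that the remaining ones are selected. -/
noncomputable def shrinkInd (U : Finset V) (E : Finset (Finset V)) (w : V) (j : ℕ) (e : Finset V)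
    (ω : V → Fin 3) : ℝ :=
  ∑ S ∈ ((e ∩ U).erase w).powersetCard j, ∏ u ∈ (e ∩ U).erase w,
    if u ∈ S then keptOff U E e u ω else selInd (ω u)

lemma isWeight_nibbleWeight {V : Type*} {p : ℝ} {c : V → ℝ} (hp0 : 0 ≤ p) (hp1 : p ≤ 1) (hc0 : ∀ v, 0 ≤ c v)
    (hc1 : ∀ v, c v ≤ 1) : IsWeight (nibbleWeight p c) := by
  constructor
  · intro v a
    have h1 := hc0 v
    have h2 := hc1 v
    fin_cases a <;> simp [nibbleWeight] <;> nlinarith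
  · intro v
    simp [nibbleWeight, Fin.sum_univ_three]
    ring

lemma selInd_mem (a : Fin 3) : 0 ≤ selInd a ∧ selInd a ≤ 1 := by
  unfold selInd; split_ifs <;> norm_num

lemma keepInd_mem (a : Fin 3) : 0 ≤ keepInd a ∧ keepInd a ≤ 1 := by
  unfold keepInd; split_ifs <;> norm_num

lemma prod_selInd {V : Type*} (s : Finset V) (ω : V → Fin 3) :
    ∏ x ∈ s, selInd (ω x) = if ∀ x ∈ s, ω x = 0 then 1 else 0 := by
  simp [selInd, Finset.prod_ite_zero]

lemma unclosed_eq (U : Finset V) (F : Finset (Finset V)) (u : V) (ω : V → Fin 3) :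
    unclosed U F u ω =
      if ∀ f ∈ F, u ∈ f → ∃ x ∈ (f ∩ U).erase u, ω x ≠ 0 then 1 else 0 := by
  have h : ∀ f : Finset V, (1 - ∏ x ∈ (f ∩ U).erase u, selInd (ω x)) =
      if ∃ x ∈ (f ∩ U).erase u, ω x ≠ 0 then 1 else 0 := by
    intro f
    rw [prod_selInd]
    by_cases hf : ∀ x ∈ (f ∩ U).erase u, ω x = 0
    · rw [if_pos hf, if_neg (by push Not; exact hf), sub_self]
    · rw [if_neg hf, if_pos (by push Not at hf; exact hf), sub_zero]
  simp only [unclosed, h, Finset.prod_ite_zero, Finset.prod_const_one]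
  refine if_congr ?_ rfl rfl
  simp only [Finset.mem_filter, and_imp]

lemma unclosed_mem (U : Finset V) (F : Finset (Finset V)) (u : V) (ω : V → Fin 3) :
    0 ≤ unclosed U F u ω ∧ unclosed U F u ω ≤ 1 := by
  rw [unclosed_eq]; split_ifs <;> norm_num

lemma keptOff_mem (U : Finset V) (E : Finset (Finset V)) (e : Finset V) (u : V) (ω : V → Fin 3) :
    0 ≤ keptOff U E e u ω ∧ keptOff U E e u ω ≤ 1 := by
  have h1 := keepInd_mem (ω u)
  have h2 := unclosed_mem U (E.erase e) u ω
  exact ⟨mul_nonneg h1.1 h2.1, mul_le_one₀ h1.2 h2.1 h2.2⟩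

lemma shrinkInd_nonneg (U : Finset V) (E : Finset (Finset V)) (w : V) (j : ℕ) (e : Finset V)
    (ω : V → Fin 3) : 0 ≤ shrinkInd U E w j e ω := by
  refine Finset.sum_nonneg fun S _ => Finset.prod_nonneg fun u _ => ?_
  split_ifs
  · exact (keptOff_mem U E e u ω).1
  · exact (selInd_mem _).1

lemma shrinkInd_le (U : Finset V) (E : Finset (Finset V)) {w : V} (j : ℕ) {e : Finset V}
    (hw : w ∈ e ∩ U) {L : ℕ} (he : (e ∩ U).card ≤ L + 1) (ω : V → Fin 3) :
    shrinkInd U E w j e ω ≤ 2 ^ L := by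
  have h1 : shrinkInd U E w j e ω ≤ ∑ S ∈ ((e ∩ U).erase w).powersetCard j, 1 := by
    refine Finset.sum_le_sum fun S _ => Finset.prod_le_one (fun u _ => ?_) fun u _ => ?_
    · split_ifs
      · exact (keptOff_mem U E e u ω).1
      · exact (selInd_mem _).1
    · split_ifs
      · exact (keptOff_mem U E e u ω).2
      · exact (selInd_mem _).2
  refine h1.trans ?_
  rw [Finset.sum_const, nsmul_eq_mul, mul_one, Finset.card_powersetCard,
    Finset.card_erase_of_mem hw]
  have h2 := Nat.choose_le_two_pow ((e ∩ U).card - 1) j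
  have h3 : 2 ^ ((e ∩ U).card - 1) ≤ 2 ^ L := Nat.pow_le_pow_right (by norm_num) (by omega)
  exact_mod_cast h2.trans h3

lemma dependsOn_unclosed (U : Finset V) (F : Finset (Finset V)) (u : V) :
    DependsOn (unclosed U F u) {x | x ≠ u ∧ ∃ f ∈ F, u ∈ f ∧ x ∈ f} := by
  intro ω ω' h
  refine Finset.prod_congr rfl fun f hf => ?_
  rw [Finset.prod_congr rfl fun x hx => ?_]
  rw [Finset.mem_filter] at hf
  rw [Finset.mem_erase, Finset.mem_inter] at hx
  rw [h x ⟨hx.1, f, hf.1, hf.2, hx.2.1⟩]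

/-- Ignoring e is what localises the event: otherwise it would see the other vertices of e. -/
lemma dependsOn_keptOff (U : Finset V) (E : Finset (Finset V)) (e : Finset V) (u : V) :
    DependsOn (keptOff U E e u) (outerNbhd E e u) := by
  intro ω ω' h
  unfold keptOff
  rw [h u (Or.inl rfl), dependsOn_unclosed U (E.erase e) u]
  rintro x ⟨-, f, hf, huf, hxf⟩
  rw [Finset.mem_erase] at hf
  exact h x (Or.inr ⟨f, hf.2, hf.1, huf, hxf⟩)

lemma dependsOn_shrinkInd (U : Finset V) (E : Finset (Finset V)) (w : V) (j : ℕ) (e : Finset V) :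
    DependsOn (shrinkInd U E w j e) (⋃ u ∈ (e ∩ U).erase w, outerNbhd E e u) := by
  intro ω ω' h
  refine Finset.sum_congr rfl fun S _ => Finset.prod_congr rfl fun u hu => ?_
  rw [dependsOn_keptOff U E e u fun x hx => h x (Set.mem_biUnion hu hx),
    h u (Set.mem_biUnion hu (Or.inl rfl))]

lemma unclosedProb_erase {p : ℝ} {E : Finset (Finset V)} {U e : Finset V} (he : e ∈ E) {u : V} (hu : u ∈ e) :
    (1 - p ^ ((e ∩ U).card - 1)) * unclosedProb p U (E.erase e) u = unclosedProb p U E u := by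
  unfold unclosedProb
  rw [Finset.filter_erase, Finset.mul_prod_erase _ (fun f => (1 - p ^ ((f ∩ U).card - 1)))
    (Finset.mem_filter.2 ⟨he, hu⟩)]

variable [Fintype V] {p : ℝ} {c : V → ℝ} {E : Finset (Finset V)} {U : Finset V}

lemma prodExp_selInd (hw : IsWeight (nibbleWeight p c)) (v : V) :
    prodExp (nibbleWeight p c) (fun ω => selInd (ω v)) = p := by
  rw [prodExp_eval hw]; simp [nibbleWeight, selInd]

lemma prodExp_keepInd (hw : IsWeight (nibbleWeight p c)) (v : V) :
    prodExp (nibbleWeight p c) (fun ω => keepInd (ω v)) = (1 - p) * c v := by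
  rw [prodExp_eval hw]; simp [nibbleWeight, keepInd]

/-- Distinct edges through u share no other vertex, so the factors are independent. -/
lemma prodExp_unclosed (hw : IsWeight (nibbleWeight p c)) (hE : Uncrowded E) {u : V} (hu : u ∈ U) :
    prodExp (nibbleWeight p c) (unclosed U E u) = unclosedProb p U E u := by
  unfold unclosed unclosedProb
  rw [prodExp_finset_prod hw _ (s := fun f => (((f ∩ U).erase u : Finset V) : Set V))]
  · refine Finset.prod_congr rfl fun f hf => ?_
    rw [Finset.mem_filter] at hf
    rw [prodExp_sub, prodExp_const hw, prodExp_finset_prod hw _ (s := fun x => {x})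
      fun x _ => dependsOn_eval x selInd]
    · simp only [prodExp_selInd hw, Finset.prod_const]
      rw [Finset.card_erase_of_mem (Finset.mem_inter.2 ⟨hf.2, hu⟩)]
    · intro x _ y _ hxy
      simpa using hxy
  · intro f _ ω ω' h
    simp only
    rw [Finset.prod_congr rfl fun x hx => by rw [h x hx]]
  · intro f hf g hg hfg
    simp only [Finset.coe_filter, Set.mem_ofPred_eq] at hf hg
    rw [Function.onFun, Finset.disjoint_coe, Finset.disjoint_left]
    intro x hx hx'
    rw [Finset.mem_erase, Finset.mem_inter] at hx hx'
    exact hx.1 (hE.two f hf.1 g hg.1 hfg x u hx.2.1 hx'.2.1 hf.2 hg.2)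

lemma prodExp_mul_unclosed (hw : IsWeight (nibbleWeight p c)) (hE : Uncrowded E) {u : V}
    (hu : u ∈ U) (g : Fin 3 → ℝ) :
    prodExp (nibbleWeight p c) (fun ω => g (ω u) * unclosed U E u ω) =
      prodExp (nibbleWeight p c) (fun ω => g (ω u)) * unclosedProb p U E u := by
  rw [prodExp_mul hw (dependsOn_eval u g) (dependsOn_unclosed U E u), prodExp_unclosed hw hE hu]
  rw [Set.disjoint_singleton_left]
  rintro ⟨h, -⟩
  exact h rfl

end nibble

end ListDecoding

/-! ### One round of the nibble. -/

namespace ListDecoding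

lemma one_sub_sum_le_prod_one_sub {ι : Type*} (s : Finset ι) (f : ι → ℝ)
    (h : ∀ i ∈ s, 0 ≤ f i ∧ f i ≤ 1) : 1 - ∑ i ∈ s, f i ≤ ∏ i ∈ s, (1 - f i) := by
  classical
  induction s using Finset.induction_on with
  | empty => simp
  | insert i s hi ih =>
    rw [Finset.sum_insert hi, Finset.prod_insert hi]
    have h1 := ih fun j hj => h j (Finset.mem_insert_of_mem hj)
    have h2 := h i (Finset.mem_insert_self i s)
    have h3 : ∏ j ∈ s, (1 - f j) ≤ 1 := Finset.prod_le_one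
      (fun j hj => sub_nonneg.2 (h j (Finset.mem_insert_of_mem hj)).2)
      fun j hj => by linarith [(h j (Finset.mem_insert_of_mem hj)).1]
    nlinarith

section nibble

variable {V : Type*} [DecidableEq V]

/-- The number of edges through `w` with exactly `s` further vertices in `U`. -/
def residualDegree (U : Finset V) (E : Finset (Finset V)) (s : ℕ) (w : V) : ℕ :=
  (E.filter fun e => w ∈ e ∧ (e ∩ U).card = s + 1).card

lemma sum_residual_le {U : Finset V} {E : Finset (Finset V)} {L : ℕ} {B : ℕ → ℝ} {w : V}
    (hsize : ∀ e ∈ E, 2 ≤ (e ∩ U).card ∧ (e ∩ U).card ≤ L + 1)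
    (hdeg : ∀ s ∈ Finset.Icc 1 L, (residualDegree U E s w : ℝ) ≤ B s) {g : ℕ → ℝ}
    (hg : ∀ s, 0 ≤ g s) :
    ∑ e ∈ E with w ∈ e, g ((e ∩ U).card - 1) ≤ ∑ s ∈ Finset.Icc 1 L, B s * g s := by
  rw [← Finset.sum_fiberwise_of_maps_to (s := E.filter (w ∈ ·)) (t := Finset.Icc 1 L)
    (g := fun e => (e ∩ U).card - 1)]
  · refine Finset.sum_le_sum fun s hs => ?_
    have h1 : ((E.filter (w ∈ ·)).filter fun e => (e ∩ U).card - 1 = s) =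
        E.filter fun e => w ∈ e ∧ (e ∩ U).card = s + 1 := by
      ext e
      simp only [Finset.mem_filter]
      constructor
      · rintro ⟨⟨he, hw⟩, h⟩
        have := (hsize e he).1
        exact ⟨he, hw, by omega⟩
      · rintro ⟨he, hw, h⟩
        exact ⟨⟨he, hw⟩, by omega⟩
    rw [Finset.sum_congr rfl (g := fun _ => g s) fun e he => by rw [(Finset.mem_filter.1 he).2],
      h1, Finset.sum_const, nsmul_eq_mul]
    exact mul_le_mul_of_nonneg_right (hdeg s hs) (hg s)
  · intro e he
    have := hsize e (Finset.mem_filter.1 he).1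
    simp only [Finset.mem_Icc]
    omega

/-- The summand of the set of surviving vertices other than v equals 1. Summed over the edges
through v, this bounds the new residual degree by a random variable of controlled variance. -/
lemma one_le_shrinkInd {E : Finset (Finset V)} {v : V} {e U U' A : Finset V} {ω : V → Fin 3} (hsub : e ∩ U ⊆ A ∪ U')
    (hA : ∀ u ∈ A, ω u = 0) (hU' : U' ⊆ U)
    (hkept : ∀ u ∈ U', ω u = 1 ∧ ∀ f ∈ E, u ∈ f → ∃ x ∈ (f ∩ U).erase u, ω x ≠ 0)
    (hv : v ∈ e ∩ U') {j : ℕ} (hj : (e ∩ U').card = j + 1) : 1 ≤ shrinkInd U E v j e ω := by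
  have hmem : (e ∩ U').erase v ∈ ((e ∩ U).erase v).powersetCard j := by
    rw [Finset.mem_powersetCard, Finset.card_erase_of_mem hv, hj]
    exact ⟨Finset.erase_subset_erase _ (Finset.inter_subset_inter_left hU'), rfl⟩
  refine le_trans (le_of_eq ?_) (Finset.single_le_sum (f := fun S => ∏ u ∈ (e ∩ U).erase v,
    if u ∈ S then keptOff U E e u ω else selInd (ω u)) (fun S _ => Finset.prod_nonneg fun u _ => ?_)
    hmem)
  · refine (Finset.prod_eq_one fun u hu => ?_).symm
    rw [Finset.mem_erase] at hu
    split_ifs with h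
    · simp only [Finset.mem_erase, Finset.mem_inter] at h
      obtain ⟨h1, h2⟩ := hkept u h.2.2
      rw [keptOff, unclosed_eq, if_pos fun f hf => h2 f (Finset.mem_of_mem_erase hf), h1]
      simp [keepInd]
    · have h1 : u ∈ A := by
        rcases Finset.mem_union.1 (hsub hu.2) with h2 | h2
        · exact h2
        · exact absurd (Finset.mem_erase.2 ⟨hu.1, Finset.mem_inter.2
            ⟨(Finset.mem_inter.1 hu.2).1, h2⟩⟩) h
      simp [hA u h1, selInd]
  · split_ifs
    · exact (keptOff_mem U E e u ω).1
    · exact (selInd_mem _).1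

variable [Fintype V] {p : ℝ} {c : V → ℝ} {E : Finset (Finset V)} {U : Finset V}

/-- The choice of c makes the probability exactly κ when all edges count. Ignoring e divides it by a
factor of at least 1 - p, and 1/(1 - p) ≤ 1 + 2p. -/
lemma prodExp_keptOff_le (hw : IsWeight (nibbleWeight p c)) (hE : Uncrowded E) (hp0 : 0 ≤ p)
    (hp1 : p ≤ 1 / 4) {e : Finset V} (he : e ∈ E) (hsize : 2 ≤ (e ∩ U).card) {u : V}
    (hu : u ∈ e ∩ U) {κ : ℝ} (hκ : 0 ≤ κ) (hpos : 0 < unclosedProb p U E u)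
    (hc : c u = κ / ((1 - p) * unclosedProb p U E u)) :
    prodExp (nibbleWeight p c) (keptOff U E e u) ≤ κ * (1 + 2 * p) := by
  rw [Finset.mem_inter] at hu
  have h1 : prodExp (nibbleWeight p c) (keptOff U E e u) =
      (1 - p) * c u * unclosedProb p U (E.erase e) u := by
    rw [← prodExp_keepInd hw, ← prodExp_mul_unclosed hw (hE.mono (Finset.erase_subset e E)) hu.2]
    rfl
  have h2 := unclosedProb_erase (p := p) (U := U) he hu.1
  have h3 : p ^ ((e ∩ U).card - 1) ≤ p := pow_le_of_le_one hp0 (by linarith) (by omega)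
  have h4 : 0 < unclosedProb p U (E.erase e) u := by
    rw [← h2] at hpos
    exact pos_of_mul_pos_right hpos (by linarith)
  rw [h1, hc, ← h2]
  have h5 : 0 < 1 - p ^ ((e ∩ U).card - 1) := by linarith
  have h6 : (1 - p) * (κ / ((1 - p) * ((1 - p ^ ((e ∩ U).card - 1)) *
      unclosedProb p U (E.erase e) u))) * unclosedProb p U (E.erase e) u =
      κ / (1 - p ^ ((e ∩ U).card - 1)) := by
    have : (1 - p) ≠ 0 := by linarith
    field_simp
  rw [h6, div_le_iff₀ h5, mul_assoc]
  refine le_mul_of_one_le_right hκ ?_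
  nlinarith

/-- The outer neighbourhoods of the vertices of e are disjoint, so for each choice of the j
surviving vertices the probability is a product. -/
lemma prodExp_shrinkInd_le (hw : IsWeight (nibbleWeight p c)) (hE : Uncrowded E)
    {e : Finset V} (he : e ∈ E) {v : V} (hv : v ∈ e ∩ U) {κ : ℝ}
    (hkept : ∀ u ∈ e ∩ U, prodExp (nibbleWeight p c) (keptOff U E e u) ≤ κ) (j : ℕ) :
    prodExp (nibbleWeight p c) (shrinkInd U E v j e) ≤
      ((e ∩ U).card - 1).choose j * κ ^ j * p ^ ((e ∩ U).card - 1 - j) := by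
  unfold shrinkInd
  rw [prodExp_sum]
  have hcard : ((e ∩ U).erase v).card = (e ∩ U).card - 1 := Finset.card_erase_of_mem hv
  have h1 : ∀ S ∈ ((e ∩ U).erase v).powersetCard j, prodExp (nibbleWeight p c) (fun ω =>
      ∏ u ∈ (e ∩ U).erase v, if u ∈ S then keptOff U E e u ω else selInd (ω u)) ≤
      κ ^ j * p ^ ((e ∩ U).card - 1 - j) := by
    intro S hS
    rw [Finset.mem_powersetCard] at hS
    rw [prodExp_finset_prod hw _ (s := fun u => outerNbhd E e u)]
    · calc _ ≤ ∏ u ∈ (e ∩ U).erase v, (if u ∈ S then κ else p) := by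
            refine Finset.prod_le_prod (fun u _ => ?_) fun u hu => ?_
            · refine prodExp_nonneg hw fun ω => ?_
              split_ifs
              · exact (keptOff_mem U E e u ω).1
              · exact (selInd_mem _).1
            · split_ifs
              · exact hkept u (Finset.mem_of_mem_erase hu)
              · exact (prodExp_selInd hw u).le
        _ = _ := by
            rw [Finset.prod_ite, Finset.prod_const, Finset.prod_const, Finset.filter_mem_eq_inter,
              Finset.inter_eq_right.2 hS.1, hS.2, Finset.filter_notMem_eq_sdiff,
              Finset.card_sdiff_of_subset hS.1, hS.2, hcard]
    · intro u _ ω ω' h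
      simp only
      rw [dependsOn_keptOff U E e u h, h u (Or.inl rfl)]
    · intro u hu u' hu' huu
      have := Finset.mem_of_mem_erase hu
      have := Finset.mem_of_mem_erase hu'
      exact hE.disjoint_outerNbhd he (by simp_all) (by simp_all) huu
  refine (Finset.sum_le_sum h1).trans ?_
  rw [Finset.sum_const, nsmul_eq_mul, Finset.card_powersetCard, hcard, mul_assoc]

lemma prodExp_shrinkInd_mul (hw : IsWeight (nibbleWeight p c)) (hE : Uncrowded E)
    {e e' : Finset V} (he : e ∈ E) (he' : e' ∈ E) (hee : e ≠ e') {v : V} (hv : v ∈ e)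
    (hv' : v ∈ e') (j : ℕ) :
    prodExp (nibbleWeight p c) (fun ω => shrinkInd U E v j e ω * shrinkInd U E v j e' ω) =
      prodExp (nibbleWeight p c) (shrinkInd U E v j e) *
        prodExp (nibbleWeight p c) (shrinkInd U E v j e') := by
  refine prodExp_mul hw (dependsOn_shrinkInd U E v j e) (dependsOn_shrinkInd U E v j e') ?_
  simp only [Set.disjoint_iUnion_left, Set.disjoint_iUnion_right]
  intro u hu u' hu'
  rw [Finset.mem_erase, Finset.mem_inter] at hu hu'
  exact hE.disjoint_outerNbhd_of_ne he he' hee hv hv' (by tauto) (by tauto) (by tauto) (by tauto)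

/-- One round of the nibble. -/
lemma exists_nibble_step (hE : Uncrowded E) {L : ℕ} (hp0 : 0 ≤ p) (hp1 : p ≤ 1 / 4)
    (hsize : ∀ e ∈ E, 2 ≤ (e ∩ U).card ∧ (e ∩ U).card ≤ L + 1) {B M τ : ℕ → ℝ} {θ γ : ℝ}
    (hdeg : ∀ w ∈ U, ∀ s ∈ Finset.Icc 1 L, (residualDegree U E s w : ℝ) ≤ B s)
    (hB : ∑ s ∈ Finset.Icc 1 L, B s * p ^ s ≤ 1 / 4)
    (hM : ∀ j ∈ Finset.Icc 1 L, ∑ s ∈ Finset.Icc 1 L,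
      B s * (s.choose j * (1 / 2 * (1 + 2 * p)) ^ j * p ^ (s - j)) ≤ M j)
    (hτ : ∀ j ∈ Finset.Icc 1 L, 0 < τ j ∧ 2 ^ L * M j / τ j ^ 2 ≤ θ) (hγ : 0 ≤ γ) :
    ∃ A ⊆ U, ∃ U' ⊆ U, ∃ E' ⊆ E, Disjoint A U' ∧ (∀ e ∈ E', 2 ≤ (e ∩ U').card) ∧
      (∀ w ∈ U', ∀ j ∈ Finset.Icc 1 L, (residualDegree U' E' j w : ℝ) ≤ M j + τ j) ∧
      (∀ J ⊆ U', (∀ e ∈ E', ¬ e ∩ U' ⊆ J) → ∀ e ∈ E, ¬ e ∩ U ⊆ A ∪ J) ∧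
      p / 2 * U.card + γ * ((1 / 2 - L * θ) * U.card) ≤ A.card + γ * U'.card := by
  classical
  have hν : ∀ u ∈ U, 3 / 4 ≤ unclosedProb p U E u := by
    intro u hu
    refine le_trans ?_ (one_sub_sum_le_prod_one_sub _ (fun f => p ^ ((f ∩ U).card - 1))
      fun f _ => ⟨by positivity, pow_le_one₀ hp0 (by linarith)⟩)
    have := sum_residual_le hsize (hdeg u hu) (g := fun s => p ^ s) fun s => by positivity
    linarith
  -- The coin compensates for the unequal chances of being closed: every vertex is kept with
  -- probability exactly 1/2.
  set c : V → ℝ := fun u =>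
    if u ∈ U then 1 / 2 / ((1 - p) * unclosedProb p U E u) else 0 with hc
  have hcU : ∀ u ∈ U, c u = 1 / 2 / ((1 - p) * unclosedProb p U E u) := fun u hu => if_pos hu
  have hw : IsWeight (nibbleWeight p c) := by
    refine isWeight_nibbleWeight hp0 (by linarith) (fun v => ?_) fun v => ?_
    · simp only [hc]
      split_ifs with hv
      · have := hν v hv
        have h1 : 0 < 1 - p := by linarith
        positivity
      · exact le_rfl
    · simp only [hc]
      split_ifs with hv
      · have := hν v hv
        rw [div_le_one (mul_pos (by linarith) (by linarith))]
        nlinarith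
      · exact zero_le_one
  have hkept : ∀ e ∈ E, ∀ u ∈ e ∩ U,
      prodExp (nibbleWeight p c) (keptOff U E e u) ≤ 1 / 2 * (1 + 2 * p) := fun e he u hu =>
    prodExp_keptOff_le hw hE hp0 hp1 he (hsize e he).1 hu (by norm_num)
      (by have := hν u (Finset.mem_inter.1 hu).2; linarith) (hcU u (Finset.mem_inter.1 hu).2)
  let bad : V → ℕ → (V → Fin 3) → ℝ := fun v j ω =>
    if M j + τ j < ∑ e ∈ E with v ∈ e, shrinkInd U E v j e ω then 1 else 0
  have hbad : ∀ v ∈ U, ∀ j ∈ Finset.Icc 1 L, prodExp (nibbleWeight p c) (bad v j) ≤ θ := by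
    intro v hv j hj
    refine (prodExp_chebyshev hw (b := 2 ^ L) _ (fun e _ ω => shrinkInd_nonneg U E v j e ω)
      (fun e he ω => ?_) (fun e he e' he' hee => ?_) ?_ (by positivity) (hτ j hj).1).trans
      (hτ j hj).2
    · rw [Finset.mem_filter] at he
      exact shrinkInd_le U E j (Finset.mem_inter.2 ⟨he.2, hv⟩) (hsize e he.1).2 ω
    · rw [Finset.mem_filter] at he he'
      exact prodExp_shrinkInd_mul hw hE he.1 he'.1 hee he.2 he'.2 j
    · refine le_trans ?_ (hM j hj)
      refine le_trans (Finset.sum_le_sum fun e he => ?_) (sum_residual_le hsize (hdeg v hv)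
        (g := fun s => s.choose j * (1 / 2 * (1 + 2 * p)) ^ j * p ^ (s - j))
        fun s => by positivity)
      rw [Finset.mem_filter] at he
      exact prodExp_shrinkInd_le hw hE he.1 (Finset.mem_inter.2 ⟨he.2, hv⟩) (hkept e he.1) j
  -- One expectation weighs the gain |A| against the future value γ|U'|, so neither size needs a
  -- concentration bound.
  let F : (V → Fin 3) → ℝ := fun ω =>
    ∑ v ∈ U, selInd (ω v) * unclosed U E v ω + γ * ∑ v ∈ U, (keepInd (ω v) * unclosed U E v ω -
      ∑ j ∈ Finset.Icc 1 L, bad v j ω)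
  have hF : p / 2 * U.card + γ * ((1 / 2 - L * θ) * U.card) ≤ prodExp (nibbleWeight p c) F := by
    simp only [F]
    rw [prodExp_add, prodExp_const_mul, prodExp_sum, prodExp_sum]
    have h1 : p / 2 * U.card ≤ ∑ v ∈ U, prodExp (nibbleWeight p c)
        (fun ω => selInd (ω v) * unclosed U E v ω) := by
      rw [mul_comm, ← nsmul_eq_mul]
      refine Finset.card_nsmul_le_sum _ _ _ fun v hv => ?_
      rw [prodExp_mul_unclosed hw hE hv, prodExp_selInd hw]
      nlinarith [hν v hv]
    have h2 : (1 / 2 - L * θ) * U.card ≤ ∑ v ∈ U, prodExp (nibbleWeight p c)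
        (fun ω => keepInd (ω v) * unclosed U E v ω - ∑ j ∈ Finset.Icc 1 L, bad v j ω) := by
      rw [mul_comm, ← nsmul_eq_mul]
      refine Finset.card_nsmul_le_sum _ _ _ fun v hv => ?_
      rw [prodExp_sub, prodExp_mul_unclosed hw hE hv, prodExp_keepInd hw, prodExp_sum, hcU v hv]
      have h3 : ∑ j ∈ Finset.Icc 1 L, prodExp (nibbleWeight p c) (bad v j) ≤ L * θ := by
        simpa using Finset.sum_le_card_nsmul _ _ _ (hbad v hv)
      have h4 : (1 - p) * (1 / 2 / ((1 - p) * unclosedProb p U E v)) * unclosedProb p U E v =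
          1 / 2 := by
        have := hν v hv
        have h5 : 1 - p ≠ 0 := by linarith
        have h6 : unclosedProb p U E v ≠ 0 := by linarith
        field_simp
      rw [h4]
      linarith
    exact add_le_add h1 (mul_le_mul_of_nonneg_left h2 hγ)
  obtain ⟨ω, hω⟩ := exists_prodExp_le hw F
  obtain ⟨good, hgood⟩ : ∃ good : V → Prop, ∀ v, good v ↔
      ∀ j ∈ Finset.Icc 1 L, ∑ e ∈ E with v ∈ e, shrinkInd U E v j e ω ≤ M j + τ j :=
    ⟨_, fun _ => Iff.rfl⟩
  let A : Finset V := U.filter fun v => ω v = 0 ∧ unclosed U E v ω = 1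
  let U' : Finset V := U.filter fun v => ω v = 1 ∧ unclosed U E v ω = 1 ∧ good v
  let E' : Finset (Finset V) := E.filter fun e => e ∩ U ⊆ A ∪ U'
  have hopen : ∀ v, unclosed U E v ω = 1 →
      ∀ f ∈ E, v ∈ f → ∃ x ∈ (f ∩ U).erase v, ω x ≠ 0 := by
    intro v hv
    rw [unclosed_eq] at hv
    by_contra h
    rw [if_neg h] at hv
    exact zero_ne_one hv
  have hA0 : ∀ u ∈ A, ω u = 0 := fun u hu => (Finset.mem_filter.1 hu).2.1
  have hU'U : U' ⊆ U := Finset.filter_subset _ _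
  have hU'1 : ∀ u ∈ U', ω u = 1 ∧ ∀ f ∈ E, u ∈ f → ∃ x ∈ (f ∩ U).erase u, ω x ≠ 0 :=
    fun u hu => ⟨(Finset.mem_filter.1 hu).2.1, hopen u (Finset.mem_filter.1 hu).2.2.1⟩
  have hAopen : ∀ u ∈ A ∪ U', ∀ f ∈ E, u ∈ f → ∃ x ∈ (f ∩ U).erase u, ω x ≠ 0 := by
    intro u hu
    rcases Finset.mem_union.1 hu with h | h
    · exact hopen u (Finset.mem_filter.1 h).2.2
    · exact (hU'1 u h).2
  refine ⟨A, Finset.filter_subset _ _, U', hU'U, E', Finset.filter_subset _ _, ?_, ?_, ?_, ?_, ?_⟩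
  · rw [Finset.disjoint_left]
    intro u hu hu'
    exact absurd ((hA0 u hu).symm.trans (hU'1 u hu').1) (by decide)
  · intro e he
    obtain ⟨heE, hesub⟩ := Finset.mem_filter.1 he
    -- With at most one survivor in the edge, all its other vertices are selected, so the edge
    -- closes that survivor, or any of its vertices if there is none. But no vertex of A ∪ U' is
    -- closed.
    by_contra! hlt
    have hne : (e ∩ U).Nonempty := Finset.card_pos.1 (by have := (hsize e heE).1; omega)
    obtain ⟨u, hu, hu'⟩ : ∃ u ∈ e ∩ U, ∀ x ∈ e ∩ U', x = u := by
      by_cases h0 : (e ∩ U').Nonempty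
      · obtain ⟨u, hu⟩ := h0
        exact ⟨u, Finset.inter_subset_inter_left hU'U hu,
          fun x hx => Finset.card_le_one.1 (by omega) x hx u hu⟩
      · rw [Finset.not_nonempty_iff_eq_empty] at h0
        obtain ⟨u, hu⟩ := hne
        exact ⟨u, hu, by simp [h0]⟩
    obtain ⟨x, hx, hx0⟩ := hAopen u (hesub hu) e heE (Finset.mem_inter.1 hu).1
    rw [Finset.mem_erase] at hx
    rcases Finset.mem_union.1 (hesub hx.2) with h | h
    · exact hx0 (hA0 x h)
    · exact hx.1 (hu' x (Finset.mem_inter.2 ⟨(Finset.mem_inter.1 hx.2).1, h⟩))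
  · intro w hwU' j hj
    refine le_trans ?_ ((hgood w).1 (Finset.mem_filter.1 hwU').2.2.2 j hj)
    have h1 : (residualDegree U' E' j w : ℝ) =
        ∑ e ∈ E'.filter fun e => w ∈ e ∧ (e ∩ U').card = j + 1, (1 : ℝ) := by
      simp [residualDegree]
    rw [h1]
    refine le_trans (Finset.sum_le_sum (g := fun e => shrinkInd U E w j e ω) fun e he => ?_)
      (Finset.sum_le_sum_of_subset_of_nonneg ?_ fun e _ _ => shrinkInd_nonneg U E w j e ω)
    · rw [Finset.mem_filter] at he
      exact one_le_shrinkInd (Finset.mem_filter.1 he.1).2 hA0 hU'U hU'1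
        (Finset.mem_inter.2 ⟨he.2.1, hwU'⟩) he.2.2
    · intro e he
      rw [Finset.mem_filter] at he ⊢
      exact ⟨(Finset.mem_filter.1 he.1).1, he.2.1⟩
  · intro J hJ hind e he hsub
    -- An edge inside A ∪ J belongs to E', and its trace on U' avoids A, hence lies in J.
    have h1 : e ∈ E' := Finset.mem_filter.2 ⟨he, hsub.trans (Finset.union_subset_union_right hJ)⟩
    refine hind e h1 fun x hx => ?_
    rw [Finset.mem_inter] at hx
    rcases Finset.mem_union.1 (hsub (Finset.mem_inter.2 ⟨hx.1, hU'U hx.2⟩)) with h | h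
    · exact absurd ((hA0 x h).symm.trans (hU'1 x hx.2).1) (by decide)
    · exact h
  · refine hF.trans (hω.trans ?_)
    have hAcard : (A.card : ℝ) = ∑ v ∈ U, if ω v = 0 ∧ unclosed U E v ω = 1 then 1 else 0 := by
      simp [A]
    have hUcard : (U'.card : ℝ) = ∑ v ∈ U, if ω v = 1 ∧ unclosed U E v ω = 1 ∧ good v
        then 1 else 0 := by
      simp [U']
    have h01 : ∀ v, unclosed U E v ω = 0 ∨ unclosed U E v ω = 1 := by
      intro v; rw [unclosed_eq]; split_ifs <;> simp
    simp only [F]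
    rw [hAcard, hUcard]
    refine add_le_add (Finset.sum_le_sum fun v _ => ?_)
      (mul_le_mul_of_nonneg_left (Finset.sum_le_sum fun v _ => ?_) hγ)
    · rcases h01 v with h | h <;> by_cases h0 : ω v = 0 <;> simp [h, h0, selInd]
    · have hbad0 : ∀ j, 0 ≤ bad v j ω := fun j => by simp only [bad]; split_ifs <;> norm_num
      have hsum0 : 0 ≤ ∑ j ∈ Finset.Icc 1 L, bad v j ω := Finset.sum_nonneg fun j _ => hbad0 j
      have hle : keepInd (ω v) * unclosed U E v ω ≤ 1 :=
        mul_le_one₀ (keepInd_mem _).2 (unclosed_mem U E v ω).1 (unclosed_mem U E v ω).2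
      split_ifs with hcond
      · linarith
      · by_cases h1 : ω v = 1 ∧ unclosed U E v ω = 1
        · have : ∃ j ∈ Finset.Icc 1 L,
              M j + τ j < ∑ e ∈ E with v ∈ e, shrinkInd U E v j e ω := by
            by_contra! hall
            exact hcond ⟨h1.1, h1.2, (hgood v).2 hall⟩
          obtain ⟨j, hj, hjlt⟩ := this
          have h2 : bad v j ω = 1 := if_pos hjlt
          have h3 := Finset.single_le_sum (f := fun j => bad v j ω) (fun j _ => hbad0 j) hj
          simp only [h2] at h3
          linarith
        · have h2 : keepInd (ω v) * unclosed U E v ω = 0 := by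
            rcases h01 v with h | h
            · rw [h, mul_zero]
            · have : ω v ≠ 1 := fun h' => h1 ⟨h', h⟩
              simp [keepInd, this]
          linarith

end nibble

end ListDecoding

/-! ### Degree parameters and iteration of the nibble. -/

namespace ListDecoding

section nibbleParameters

/-- The bound on the residual degrees after `i` rounds of the nibble. -/
noncomputable def degreeBound (L : ℕ) (D ζ δ : ℝ) (i s : ℕ) : ℝ :=
  (1 + δ) ^ (2 * i) * (L.choose s * (i * ζ) ^ (L - s) * (D / 2 ^ i) ^ s)

lemma degreeBound_mul_pow {L : ℕ} {D ζ δ : ℝ} (hD : 0 < D) (i s : ℕ) :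
    degreeBound L D ζ δ i s * (ζ * 2 ^ i / D) ^ s =
      (1 + δ) ^ (2 * i) * (L.choose s * (i * ζ) ^ (L - s) * ζ ^ s) := by
  have h : (D / 2 ^ i) ^ s * (ζ * 2 ^ i / D) ^ s = ζ ^ s := by
    rw [← mul_pow]
    congr 1
    field_simp
  unfold degreeBound
  rw [mul_assoc, mul_assoc _ ((D / 2 ^ i) ^ s), h]

/-- The powers of D cancel and leave ζ^L i^(L - s) with s ≥ 1, so a small value of ζ^L R^(L - 1)
keeps the chance of being closed below 1/4. This fixes the size of ζ. -/
lemma sum_degreeBound_mul_pow_le {L R : ℕ} {D ζ δ : ℝ} (hD : 0 < D) (hζ : 0 ≤ ζ) (hδ : 0 ≤ δ)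
    (hδR : (1 + δ) ^ (2 * R) ≤ 2) (hζR : 2 ^ (L + 3) * (ζ ^ L * R ^ (L - 1)) ≤ 1) {i : ℕ}
    (hi : i < R) :
    ∑ s ∈ Finset.Icc 1 L, degreeBound L D ζ δ i s * (ζ * 2 ^ i / D) ^ s ≤ 1 / 4 := by
  have h1 : ∀ s ∈ Finset.Icc 1 L, degreeBound L D ζ δ i s * (ζ * 2 ^ i / D) ^ s ≤
      2 * (ζ ^ L * R ^ (L - 1)) * L.choose s := by
    intro s hs
    rw [Finset.mem_Icc] at hs
    rw [degreeBound_mul_pow hD, mul_pow]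
    have h2 : ζ ^ L = ζ ^ (L - s) * ζ ^ s := by rw [← pow_add, Nat.sub_add_cancel hs.2]
    have hiR : (i : ℝ) ≤ R := by exact_mod_cast hi.le
    have hR1 : (1 : ℝ) ≤ R := by exact_mod_cast (by omega : 1 ≤ R)
    have h3 : (i : ℝ) ^ (L - s) ≤ R ^ (L - 1) :=
      (pow_le_pow_left₀ (by positivity) hiR _).trans (pow_le_pow_right₀ hR1 (by omega))
    have h4 : (1 + δ) ^ (2 * i) ≤ 2 :=
      (pow_le_pow_right₀ (by linarith) (by omega)).trans hδR
    calc (1 + δ) ^ (2 * i) * (L.choose s * (i ^ (L - s) * ζ ^ (L - s)) * ζ ^ s)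
        ≤ 2 * (L.choose s * (R ^ (L - 1) * ζ ^ (L - s)) * ζ ^ s) := by gcongr
      _ = _ := by rw [h2]; ring
  refine (Finset.sum_le_sum h1).trans ?_
  rw [← Finset.mul_sum]
  have h5 : ∑ s ∈ Finset.Icc 1 L, (L.choose s : ℝ) ≤ 2 ^ L := by
    have := Nat.sum_range_choose L
    calc ∑ s ∈ Finset.Icc 1 L, (L.choose s : ℝ) ≤ ∑ s ∈ Finset.range (L + 1), (L.choose s : ℝ) :=
          Finset.sum_le_sum_of_subset_of_nonneg
            (fun s hs => by simp only [Finset.mem_Icc, Finset.mem_range] at *; omega)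
            fun _ _ _ => by positivity
      _ = 2 ^ L := by exact_mod_cast this
  have h6 : (0 : ℝ) ≤ 2 * (ζ ^ L * R ^ (L - 1)) := by positivity
  refine (mul_le_mul_of_nonneg_left h5 h6).trans ?_
  rw [pow_add] at hζR
  linarith

/-- The expected residual degrees after a round of the nibble. -/
noncomputable def degreeMean (L : ℕ) (D ζ δ : ℝ) (i j : ℕ) : ℝ :=
  (1 + δ) ^ (2 * i + 1) * (L.choose j * ((i + 1) * ζ) ^ (L - j) * (D / 2 ^ (i + 1)) ^ j)

lemma degreeMean_mul (L : ℕ) (D ζ δ : ℝ) (i j : ℕ) :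
    degreeMean L D ζ δ i j + δ * degreeMean L D ζ δ i j = degreeBound L D ζ δ (i + 1) j := by
  unfold degreeMean degreeBound
  rw [show 2 * (i + 1) = 2 * i + 1 + 1 by ring, pow_succ (1 + δ) (2 * i + 1)]
  push_cast
  ring

/-- The binomial theorem sums all ways of shrinking: (iζ + ζ)^(L - j) appears. One factor 1 + δ
absorbs the error (1 + 2p)^j; the second one of the round is left for the deviation. -/
lemma sum_degreeBound_le_degreeMean {L : ℕ} {D ζ δ : ℝ} (hD : 0 < D) (hζ : 0 ≤ ζ) (hδ : 0 ≤ δ)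
    {i j : ℕ} (hj : j ∈ Finset.Icc 1 L) (hp : (1 + 2 * (ζ * 2 ^ i / D)) ^ L ≤ 1 + δ) :
    ∑ s ∈ Finset.Icc 1 L, degreeBound L D ζ δ i s *
      (s.choose j * (1 / 2 * (1 + 2 * (ζ * 2 ^ i / D))) ^ j * (ζ * 2 ^ i / D) ^ (s - j)) ≤
        degreeMean L D ζ δ i j := by
  rw [Finset.mem_Icc] at hj
  set p := ζ * 2 ^ i / D with hpdef
  have hp0 : 0 ≤ p := by positivity
  have h1 : (1 + 2 * p) ^ j ≤ 1 + δ :=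
    (pow_le_pow_right₀ (by linarith) hj.2).trans hp
  set Q : ℝ := (1 + δ) ^ (2 * i) * (1 + 2 * p) ^ j * (L.choose j * (D / 2 ^ (i + 1)) ^ j) with hQ
  have h2 : ∀ s ∈ Finset.Icc 1 L, degreeBound L D ζ δ i s *
      (s.choose j * (1 / 2 * (1 + 2 * p)) ^ j * p ^ (s - j)) =
      if j ≤ s then Q * ((i * ζ) ^ (L - s) * ζ ^ (s - j) * (L - j).choose (s - j)) else 0 := by
    intro s hs
    rw [Finset.mem_Icc] at hs
    split_ifs with hjs
    · have h3 : (L.choose s : ℝ) * s.choose j = L.choose j * (L - j).choose (s - j) := by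
        exact_mod_cast Nat.choose_mul (n := L) (k := s) (s := j) hjs
      have h4 : (D / 2 ^ i) ^ s * p ^ (s - j) = (D / 2 ^ i) ^ j * ζ ^ (s - j) := by
        rw [← Nat.sub_add_cancel hjs, Nat.add_sub_cancel, pow_add,
          mul_comm ((D / 2 ^ i) ^ (s - j)), mul_assoc, ← mul_pow]
        congr 2
        rw [hpdef]
        field_simp
      have h5 : (D / 2 ^ (i + 1)) ^ j = (D / 2 ^ i) ^ j * (1 / 2) ^ j := by
        rw [← mul_pow]; congr 1; rw [pow_succ]; field_simp
      calc degreeBound L D ζ δ i s * (s.choose j * (1 / 2 * (1 + 2 * p)) ^ j * p ^ (s - j))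
          = (1 + δ) ^ (2 * i) * (i * ζ) ^ (L - s) * ((L.choose s : ℝ) * s.choose j) *
            (1 / 2 * (1 + 2 * p)) ^ j * ((D / 2 ^ i) ^ s * p ^ (s - j)) := by
            unfold degreeBound; ring
        _ = _ := by rw [h3, h4, hQ, h5, mul_pow (1 / 2 : ℝ)]; ring
    · rw [Nat.choose_eq_zero_of_lt (by omega)]
      simp
  rw [Finset.sum_congr rfl h2, ← Finset.sum_filter]
  have h6 : (Finset.Icc 1 L).filter (fun s => j ≤ s) = Finset.Icc j L := by
    ext s; simp only [Finset.mem_filter, Finset.mem_Icc]; omega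
  have h7 : ∑ s ∈ Finset.Icc j L, (i * ζ) ^ (L - s) * ζ ^ (s - j) * ((L - j).choose (s - j) : ℝ) =
      ((i + 1) * ζ) ^ (L - j) := by
    rw [show ((i : ℝ) + 1) * ζ = ζ + i * ζ by ring, add_pow, ← Finset.Ico_add_one_right_eq_Icc,
      Finset.sum_Ico_eq_sum_range, show L + 1 - j = L - j + 1 by omega]
    refine Finset.sum_congr rfl fun k _ => ?_
    rw [Nat.add_sub_cancel_left, show L - (j + k) = L - j - k by omega, mul_comm ((i * ζ) ^ _)]
  rw [h6, ← Finset.mul_sum, h7, hQ, degreeMean, pow_succ (1 + δ)]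
  have : (1 + δ) ^ (2 * i) * (1 + 2 * p) ^ j ≤ (1 + δ) ^ (2 * i) * (1 + δ) := by gcongr
  calc _ = (1 + δ) ^ (2 * i) * (1 + 2 * p) ^ j *
        (L.choose j * ((i + 1) * ζ) ^ (L - j) * (D / 2 ^ (i + 1)) ^ j) := by ring
    _ ≤ _ := by gcongr

/-- Chebyshev with relative slack δ fails with probability of order 1/(δ² mean), so the means must
stay large until the last round. -/
lemma le_degreeMean {L R : ℕ} {D ζ δ : ℝ} (hζ0 : 0 < ζ) (hζ1 : ζ ≤ 1) (hδ : 0 ≤ δ)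
    (hDR : 1 ≤ D / 2 ^ R) {i j : ℕ} (hi : i < R) (hj : j ∈ Finset.Icc 1 L) :
    D / 2 ^ R * ζ ^ L ≤ degreeMean L D ζ δ i j := by
  rw [Finset.mem_Icc] at hj
  have hD : 0 < D := by
    by_contra! h
    have : D / 2 ^ R ≤ 0 := div_nonpos_of_nonpos_of_nonneg h (by positivity)
    linarith
  have h1 : D / 2 ^ R ≤ D / 2 ^ (i + 1) :=
    div_le_div_of_nonneg_left hD.le (by positivity) (pow_le_pow_right₀ (by norm_num) hi)
  have h2 : D / 2 ^ R ≤ (D / 2 ^ (i + 1)) ^ j :=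
    h1.trans (le_self_pow₀ (hDR.trans h1) (by omega))
  have h3 : ζ ^ L ≤ ((i + 1) * ζ) ^ (L - j) := by
    calc ζ ^ L ≤ ζ ^ (L - j) := pow_le_pow_of_le_one hζ0.le hζ1 (by omega)
      _ ≤ _ := by
        gcongr
        exact le_mul_of_one_le_left hζ0.le (by linarith [(Nat.cast_nonneg i : (0 : ℝ) ≤ i)])
  have h4 : (1 : ℝ) ≤ L.choose j := by exact_mod_cast Nat.choose_pos hj.2
  have h5 : (1 : ℝ) ≤ (1 + δ) ^ (2 * i + 1) := one_le_pow₀ (by linarith)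
  calc D / 2 ^ R * ζ ^ L = 1 * (1 * ζ ^ L * (D / 2 ^ R)) := by ring
    _ ≤ degreeMean L D ζ δ i j := by unfold degreeMean; gcongr

end nibbleParameters

section nibble

variable {V : Type*} [DecidableEq V] [Fintype V]

/-- Induction on the number t of remaining rounds. The selection probability doubles in each round
while the vertex set about halves, so every round contributes about the same share ζ/(2D) of the
original vertices. -/
lemma exists_independent_of_rounds {L R : ℕ} {D ζ δ θ : ℝ} (hζ0 : 0 < ζ) (hζ1 : ζ ≤ 1)
    (hδ : 0 < δ) (hδR : (1 + δ) ^ (2 * R) ≤ 2) (hζR : 2 ^ (L + 3) * (ζ ^ L * R ^ (L - 1)) ≤ 1)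
    (hDR : 1 ≤ D / 2 ^ R) (hp : ζ * 2 ^ R / D ≤ 1 / 4) (hpδ : (1 + 2 * (ζ * 2 ^ R / D)) ^ L ≤ 1 + δ)
    (hθ : 2 ^ L / (δ ^ 2 * (D / 2 ^ R * ζ ^ L)) ≤ θ) (hθ1 : 2 * L * θ ≤ 1)
    (t : ℕ) (ht : t ≤ R) (U : Finset V) (E : Finset (Finset V)) (hE : Uncrowded E)
    (hsize : ∀ e ∈ E, 2 ≤ (e ∩ U).card ∧ (e ∩ U).card ≤ L + 1)
    (hdeg : ∀ w ∈ U, ∀ s ∈ Finset.Icc 1 L,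
      (residualDegree U E s w : ℝ) ≤ degreeBound L D ζ δ (R - t) s) :
    ∃ J ⊆ U, (∀ e ∈ E, ¬ e ∩ U ⊆ J) ∧
      t * ζ * 2 ^ (R - t) * (1 - 2 * L * θ) ^ t / (2 * D) * U.card ≤ J.card := by
  have hD : 0 < D := by
    by_contra! h
    have : D / 2 ^ R ≤ 0 := div_nonpos_of_nonpos_of_nonneg h (by positivity)
    linarith
  have hθ0 : 0 ≤ θ := le_trans (by positivity) hθ
  induction t generalizing U E with
  | zero =>
    refine ⟨∅, by simp, fun e he hsub => ?_, by simp⟩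
    have := (hsize e he).1
    rw [Finset.subset_empty.1 hsub] at this
    simp at this
  | succ t ih =>
    obtain ⟨i, rfl⟩ : ∃ i, R = i + (t + 1) := ⟨R - (t + 1), by omega⟩
    rw [Nat.add_sub_cancel] at hdeg ⊢
    have hiR : i < i + (t + 1) := by omega
    have hpi : ζ * 2 ^ i / D ≤ ζ * 2 ^ (i + (t + 1)) / D := by
      have : (2 : ℝ) ^ i ≤ 2 ^ (i + (t + 1)) := pow_le_pow_right₀ (by norm_num) (by omega)
      gcongr
    have hp0 : 0 ≤ ζ * 2 ^ i / D := by positivity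
    have hpL : (1 + 2 * (ζ * 2 ^ i / D)) ^ L ≤ 1 + δ := le_trans (by gcongr) hpδ
    -- The yield per surviving vertex that the induction hypothesis promises for the later rounds.
    set γ : ℝ := t * ζ * 2 ^ (i + 1) * (1 - 2 * L * θ) ^ t / (2 * D) with hγ
    have hη : 0 ≤ 1 - 2 * L * θ := by linarith
    have hγ0 : 0 ≤ γ := by positivity
    obtain ⟨A, hA, U', hU', E', hE', hdisj, htwo, hdeg', hind, hcard⟩ :=
      exists_nibble_step hE hp0 (hpi.trans hp) hsize hdeg
        (sum_degreeBound_mul_pow_le hD hζ0.le hδ.le hδR hζR hiR)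
        (fun j hj => sum_degreeBound_le_degreeMean hD hζ0.le hδ.le hj hpL)
        (τ := fun j => δ * degreeMean L D ζ δ i j) (θ := θ)
        (fun j hj => by
          have h1 := le_degreeMean hζ0 hζ1 hδ.le hDR hiR hj
          have h2 : 0 < D / 2 ^ (i + (t + 1)) * ζ ^ L := by positivity
          have h3 := h2.trans_le h1
          have h4 : 2 ^ L * degreeMean L D ζ δ i j / (δ * degreeMean L D ζ δ i j) ^ 2 =
              2 ^ L / (δ ^ 2 * degreeMean L D ζ δ i j) := by field_simp
          refine ⟨mul_pos hδ h3, ?_⟩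
          rw [h4]
          exact le_trans (by gcongr) hθ) hγ0
    obtain ⟨J, hJ, hJind, hJcard⟩ := ih (by omega) U' E' (hE.mono hE')
      (fun e he => ⟨htwo e he, (Finset.card_le_card (Finset.inter_subset_inter_left hU')).trans
        (hsize e (hE' he)).2⟩)
      (fun w hw s hs => by
        rw [show i + (t + 1) - t = i + 1 by omega, ← degreeMean_mul]
        exact hdeg' w hw s hs)
    rw [show i + (t + 1) - t = i + 1 by omega, ← hγ] at hJcard
    refine ⟨A ∪ J, Finset.union_subset hA (hJ.trans hU'), hind J hJ hJind, ?_⟩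
    rw [Finset.card_union_of_disjoint (hdisj.mono_right hJ)]
    push_cast
    refine le_trans ?_ (hcard.trans (add_le_add le_rfl hJcard))
    rw [← mul_assoc, ← add_mul]
    refine mul_le_mul_of_nonneg_right ?_ (by positivity)
    have h1 : (1 - 2 * L * θ) ^ (t + 1) ≤ 1 := pow_le_one₀ hη (by
      have : 0 ≤ 2 * L * θ := by positivity
      linarith)
    have h2 : γ * (1 / 2 - L * θ) = t * ζ * 2 ^ i * (1 - 2 * L * θ) ^ (t + 1) / (2 * D) := by
      rw [hγ, pow_succ, pow_succ]; ring
    have h3 : ζ * 2 ^ i / D / 2 = ζ * 2 ^ i * 1 / (2 * D) := by field_simp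
    rw [h2, h3, ← add_div]
    gcongr
    have h4 : ζ * 2 ^ i * (1 - 2 * L * θ) ^ (t + 1) ≤ ζ * 2 ^ i * 1 := by gcongr
    linarith

end nibble

end ListDecoding

/-! ### Independent sets in uncrowded hypergraphs. -/

namespace ListDecoding

open Filter in
lemma exists_forall_mul_pow_le_exp (K : ℝ) (k : ℕ) :
    ∃ x₀ : ℝ, ∀ x, x₀ ≤ x → K * x ^ k ≤ Real.exp (x / 2) := by
  have h1 : Tendsto (fun x : ℝ => Real.exp (x / 2) / (x / 2) ^ k) atTop atTop :=
    (Real.tendsto_exp_div_pow_atTop k).comp (tendsto_id.atTop_div_const (by norm_num))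
  obtain ⟨x₀, hx₀⟩ := eventually_atTop.1
    ((h1.eventually_ge_atTop (K * 2 ^ k)).and (eventually_gt_atTop 0))
  refine ⟨x₀, fun x hx => ?_⟩
  obtain ⟨h2, h3⟩ := hx₀ x hx
  rw [le_div_iff₀ (by positivity), mul_assoc, ← mul_pow, mul_div_cancel₀ x two_ne_zero] at h2
  exact h2

lemma one_add_pow_le {x : ℝ} (hx0 : 0 ≤ x) (hx1 : x ≤ 1) (L : ℕ) :
    (1 + x) ^ L ≤ 1 + 2 ^ L * x := by
  -- The sharper constant is what closes the induction.
  have key : (1 + x) ^ L ≤ 1 + (2 ^ L - 1) * x := by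
    induction L with
    | zero => simp
    | succ L ih =>
      have h1 : (1 : ℝ) ≤ 2 ^ L := one_le_pow₀ (by norm_num)
      calc (1 + x) ^ (L + 1) = (1 + x) ^ L * (1 + x) := pow_succ _ _
        _ ≤ (1 + (2 ^ L - 1) * x) * (1 + x) := by gcongr
        _ ≤ 1 + (2 ^ (L + 1) - 1) * x := by
          rw [pow_succ]
          nlinarith [mul_nonneg (mul_nonneg (sub_nonneg.2 h1) hx0) (sub_nonneg.2 hx1)]
  linarith

/-- Uncrowded uniform hypergraphs contain large independent sets
(Ajtai, Komlós, Pintz, Spencer and Szemerédi). -/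
theorem exists_independent_of_uncrowded (L : ℕ) (hL : 1 ≤ L) : ∃ c : ℝ, 0 < c ∧ ∃ D₀ : ℝ,
    ∀ D : ℝ, D₀ ≤ D → ∀ (V : Type) [DecidableEq V] [Fintype V] (U : Finset V)
      (E : Finset (Finset V)), Uncrowded E → (∀ e ∈ E, e ⊆ U ∧ e.card = L + 1) →
      (∀ w ∈ U, ((E.filter (w ∈ ·)).card : ℝ) ≤ D ^ L) →
      ∃ J ⊆ U, (∀ e ∈ E, ¬ e ⊆ J) ∧
        c * Real.log D ^ ((1 : ℝ) / L) / D * U.card ≤ J.card := by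
  have hL0 : (0 : ℝ) < L := by exact_mod_cast hL
  have hL1 : (1 : ℝ) ≤ L := by exact_mod_cast hL
  -- Chosen so that K x^(L + 2) ≤ D/2^R forces 2LθR ≤ 1/2; the losses of all rounds together then
  -- cost at most a factor 2.
  set K : ℝ := L * 2 ^ (2 * L + 9) with hK
  obtain ⟨x₀, hx₀⟩ := exists_forall_mul_pow_le_exp K (L + 2)
  refine ⟨(1 / 2 ^ (L + 6)) ^ ((1 : ℝ) / L) / 4, by positivity, Real.exp (max x₀ 8), ?_⟩
  intro D hD V _ _ U E hE hsize hdeg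
  have hD0 : 0 < D := (Real.exp_pos _).trans_le hD
  set x := Real.log D with hx
  have hDx : D = Real.exp x := (Real.exp_log hD0).symm
  have hxmax : max x₀ 8 ≤ x := (Real.le_log_iff_exp_le hD0).2 hD
  have hx8 : 8 ≤ x := (le_max_right _ _).trans hxmax
  have hKx := hx₀ x ((le_max_left _ _).trans hxmax)
  have hx1 : 1 ≤ x := by linarith
  -- About (log D)/4 rounds: the scale D/2^R of the degrees stays above D^(1/2).
  set R : ℕ := ⌊x / 4⌋₊ with hR
  have hRle : (R : ℝ) ≤ x / 4 := Nat.floor_le (by linarith)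
  have hRge : x / 8 ≤ R := by
    have := Nat.lt_floor_add_one (x / 4)
    linarith
  have hR1 : (1 : ℝ) ≤ R := by linarith
  have hR0 : (0 : ℝ) < R := by linarith
  have h2R : (2 : ℝ) ^ R ≤ Real.exp (x / 4) := by
    calc (2 : ℝ) ^ R ≤ Real.exp 1 ^ R := by
          gcongr
          linarith [Real.add_one_le_exp (1 : ℝ)]
      _ = Real.exp R := by rw [← Real.exp_nat_mul, mul_one]
      _ ≤ _ := Real.exp_le_exp.2 hRle
  have hD2R : Real.exp (x / 2) ≤ D / 2 ^ R := by
    rw [le_div_iff₀ (by positivity)]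
    calc Real.exp (x / 2) * 2 ^ R ≤ Real.exp (x / 2) * Real.exp (x / 4) := by gcongr
      _ ≤ D := by
        rw [← Real.exp_add, hDx]
        exact Real.exp_le_exp.2 (by linarith)
  have hKbig : K * x ^ (L + 2) ≤ D / 2 ^ R := hKx.trans hD2R
  -- The largest value of ζ^L that the condition on closed vertices admits.
  set y : ℝ := 1 / (2 ^ (L + 3) * R ^ (L - 1)) with hy
  have hy0 : 0 < y := by positivity
  have hy1 : y ≤ 1 := by
    rw [hy, div_le_one (by positivity)]
    exact one_le_mul_of_one_le_of_one_le (one_le_pow₀ (by norm_num)) (one_le_pow₀ hR1)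
  set ζ : ℝ := y ^ ((1 : ℝ) / L) with hζ
  have hζ0 : 0 < ζ := Real.rpow_pos_of_pos hy0 _
  have hζ1 : ζ ≤ 1 := Real.rpow_le_one hy0.le hy1 (by positivity)
  have hζL : ζ ^ L = y := by
    rw [hζ, one_div, Real.rpow_inv_natCast_pow hy0.le (by omega)]
  have hK1 : 1 ≤ K := one_le_mul_of_one_le_of_one_le hL1 (one_le_pow₀ (by norm_num))
  have hDR1 : 1 ≤ D / 2 ^ R := le_trans (one_le_mul_of_one_le_of_one_le hK1 (one_le_pow₀ hx1)) hKbig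
  have hDRpos : 0 < D / 2 ^ R := by linarith
  set p := ζ * 2 ^ R / D with hp
  have hp0 : 0 < p := by positivity
  have hpmul : p * (D / 2 ^ R) ≤ 1 := by
    have : p * (D / 2 ^ R) = ζ := by rw [hp]; field_simp
    rw [this]; exact hζ1
  have hpK : p * (K * x ^ (L + 2)) ≤ 1 := (mul_le_mul_of_nonneg_left hKbig hp0.le).trans hpmul
  have hpx : p * (2 ^ (L + 3) * x) ≤ 1 := by
    refine le_trans (mul_le_mul_of_nonneg_left ?_ hp0.le) hpK
    have h1 : x ≤ x ^ (L + 2) := le_self_pow₀ hx1 (by omega)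
    have h2 : (2 : ℝ) ^ (L + 3) ≤ K := by
      calc (2 : ℝ) ^ (L + 3) ≤ 2 ^ (2 * L + 9) := pow_le_pow_right₀ (by norm_num) (by omega)
        _ ≤ K := le_mul_of_one_le_left (by positivity) hL1
    gcongr
  have hp2 : p * 2 ^ (L + 3) ≤ 1 / x := by
    rw [le_div_iff₀ (by linarith), mul_assoc]; exact hpx
  have hp4 : p ≤ 1 / 4 := by
    have h1 : (2 : ℝ) ^ 2 ≤ 2 ^ (L + 3) := pow_le_pow_right₀ (by norm_num) (by omega)
    have h2 : 1 / x ≤ 1 := by rw [div_le_one (by linarith)]; exact hx1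
    nlinarith
  -- Two factors 1 + δ in each of R rounds amount to at most e^(1/2) < 2.
  set δ : ℝ := 1 / (4 * R) with hδ
  have hδ0 : 0 < δ := by positivity
  have hpδ : (1 + 2 * p) ^ L ≤ 1 + δ := by
    refine (one_add_pow_le (by positivity) (by linarith) L).trans ?_
    have h1 : 1 / x ≤ δ := by
      rw [hδ]
      exact one_div_le_one_div_of_le (by positivity) (by linarith)
    have h2 : 2 ^ L * (2 * p) * 4 = p * 2 ^ (L + 3) := by rw [pow_add]; ring
    have h3 : 0 < 2 ^ L * (2 * p) := by positivity
    linarith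
  have hδR : (1 + δ) ^ (2 * R) ≤ 2 := by
    have h1 : 1 + δ ≤ Real.exp δ := by linarith [Real.add_one_le_exp δ]
    calc (1 + δ) ^ (2 * R) ≤ Real.exp δ ^ (2 * R) := by gcongr
      _ = Real.exp (1 / 2) := by
        rw [← Real.exp_nat_mul, hδ]
        congr 1
        push_cast
        field_simp
        norm_num
      _ ≤ 2 := by
        rw [← Real.le_log_iff_exp_le (by norm_num)]
        linarith [Real.log_two_gt_d9]
  have hζR : 2 ^ (L + 3) * (ζ ^ L * R ^ (L - 1)) ≤ 1 := by
    rw [hζL, hy]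
    apply le_of_eq
    field_simp
  set θ : ℝ := 2 ^ L / (δ ^ 2 * (D / 2 ^ R * ζ ^ L)) with hθ
  have hθ0 : 0 < θ := by positivity
  have hθR : 2 * L * θ * R ≤ 1 / 2 := by
    have h1 : 2 * L * θ * R * (D / 2 ^ R) = L * 2 ^ (2 * L + 8) * (R ^ (L - 1) * R ^ 3) := by
      rw [hθ, hζL, hy, hδ]
      field_simp
      ring
    have h2 : (R : ℝ) ^ (L - 1) * R ^ 3 ≤ x ^ (L + 2) := by
      rw [← pow_add, show L - 1 + 3 = L + 2 by omega]
      gcongr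
      linarith
    have h3 : 2 * L * θ * R * (D / 2 ^ R) ≤ 1 / 2 * (D / 2 ^ R) := by
      rw [h1]
      calc L * 2 ^ (2 * L + 8) * ((R : ℝ) ^ (L - 1) * R ^ 3) ≤ L * 2 ^ (2 * L + 8) * x ^ (L + 2) := by
            gcongr
        _ = 1 / 2 * (K * x ^ (L + 2)) := by rw [hK]; ring
        _ ≤ _ := by gcongr
    exact le_of_mul_le_mul_right h3 hDRpos
  have hθ1 : 2 * L * θ ≤ 1 := by
    have : 2 * L * θ ≤ 2 * L * θ * R := le_mul_of_one_le_right (by positivity) hR1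
    linarith
  have hinter : ∀ e ∈ E, e ∩ U = e := fun e he => Finset.inter_eq_left.2 (hsize e he).1
  obtain ⟨J, hJ, hJind, hJcard⟩ := exists_independent_of_rounds hζ0 hζ1 hδ0 hδR hζR hDR1 hp4 hpδ
    le_rfl hθ1 R le_rfl U E hE (fun e he => by
      rw [hinter e he, (hsize e he).2]
      omega) (fun w hw s hs => by
      rw [Finset.mem_Icc] at hs
      rcases eq_or_lt_of_le hs.2 with rfl | hlt
      · have h1 : degreeBound s D ζ δ (R - R) s = D ^ s := by simp [degreeBound]
        rw [h1]
        refine le_trans ?_ (hdeg w hw)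
        unfold residualDegree
        exact_mod_cast Finset.card_le_card fun e he => by
          rw [Finset.mem_filter] at he ⊢
          exact ⟨he.1, he.2.1⟩
      · have h1 : residualDegree U E s w = 0 := by
          unfold residualDegree
          rw [Finset.card_eq_zero, Finset.filter_eq_empty_iff]
          rintro e he ⟨-, h⟩
          rw [hinter e he, (hsize e he).2] at h
          omega
        rw [h1, Nat.cast_zero]
        unfold degreeBound
        positivity)
  refine ⟨J, hJ, fun e he => by have := hJind e he; rwa [hinter e he] at this, le_trans ?_ hJcard⟩
  refine mul_le_mul_of_nonneg_right ?_ (Nat.cast_nonneg _)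
  have h1 : 1 / 2 ≤ (1 - 2 * L * θ) ^ R := by
    have := one_add_mul_le_pow (a := -(2 * L * θ)) (by linarith) R
    rw [← sub_eq_add_neg] at this
    linarith
  -- Here (Rζ)^L = R^L y = R/2^(L + 3): this is where (log D)^(1/L) arises.
  have h2 : (1 / 2 ^ (L + 6) : ℝ) ^ ((1 : ℝ) / L) * x ^ ((1 : ℝ) / L) ≤ R * ζ := by
    have h3 : R * ζ = (R ^ L * y) ^ ((1 : ℝ) / L) := by
      rw [Real.mul_rpow (by positivity) hy0.le, ← hζ, one_div,
        Real.pow_rpow_inv_natCast hR0.le (by omega)]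
    rw [h3, ← Real.mul_rpow (by positivity) (by positivity)]
    refine Real.rpow_le_rpow (by positivity) ?_ (by positivity)
    have h4 : (R : ℝ) ^ L = R ^ (L - 1) * R := by rw [← pow_succ, Nat.sub_add_cancel hL]
    have h5 : R ^ L * y = R / 2 ^ (L + 3) := by rw [h4, hy]; field_simp
    rw [h5, div_mul_eq_mul_div, one_mul, div_le_div_iff₀ (by positivity) (by positivity)]
    calc x * 2 ^ (L + 3) ≤ (8 * R) * 2 ^ (L + 3) := by gcongr; linarith
      _ = R * 2 ^ (L + 6) := by ring
  rw [Nat.sub_self, pow_zero, mul_one]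
  rw [div_le_div_iff₀ hD0 (by positivity)]
  have h6 : (1 / 2 ^ (L + 6) : ℝ) ^ ((1 : ℝ) / L) / 4 * x ^ ((1 : ℝ) / L) * 2 ≤
      R * ζ * (1 - 2 * L * θ) ^ R := by
    calc _ = (1 / 2 ^ (L + 6) : ℝ) ^ ((1 : ℝ) / L) * x ^ ((1 : ℝ) / L) * (1 / 2) := by ring
      _ ≤ _ := by gcongr
  calc _ = (1 / 2 ^ (L + 6) : ℝ) ^ ((1 : ℝ) / L) / 4 * x ^ ((1 : ℝ) / L) * 2 * D := by ring
    _ ≤ _ := by gcongr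

end ListDecoding

/-! ### Forbidden sets in a spread set of words. -/

namespace ListDecoding

section uncrowded

variable {A : Type*} [DecidableEq A] {n : ℕ}

/-- `S` spans at least as many letters as a random set of its size may. -/
def IsSpread (L m : ℕ) (S : Finset (Fin n → A)) : Prop :=
  L * n + (S.card - 1) * ((L + 1) * m) ≤ L * coverage S

/-- In case of equality L divides (|S| - 1)(L + 1)m. It is coprime to (L + 1)m, so it divides |S| -
1, which lies strictly between 0 and L. -/
lemma IsSpread.lt {L m : ℕ} (hLm : Nat.gcd L m = 1) {S : Finset (Fin n → A)}
    (h : IsSpread L m S) (h2 : 2 ≤ S.card) (hL : S.card ≤ L) :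
    L * n + (S.card - 1) * ((L + 1) * m) < L * coverage S := by
  refine lt_of_le_of_ne h fun heq => ?_
  have h1 : L ∣ (S.card - 1) * ((L + 1) * m) :=
    (Nat.dvd_add_right (Dvd.intro _ rfl)).1 (heq ▸ Dvd.intro _ rfl)
  have h3 : Nat.Coprime L ((L + 1) * m) := Nat.Coprime.mul_right (by simp) hLm
  have h4 := Nat.le_of_dvd (by omega) (h3.dvd_of_dvd_mul_right h1)
  omega

/-- Submodularity passes the slack δ of the intersection on to the union. Slack 1 contradicts
spreadness of the union; slack 0 keeps a chain of edges dense. -/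
lemma coverage_union_mul_le {L m : ℕ} {X e : Finset (Fin n → A)}
    (hX : L * coverage X ≤ L * n + (X.card - 1) * ((L + 1) * m))
    (he : e.card = L + 1 ∧ coverage e ≤ n + (L + 1) * m) (hXe : 1 ≤ (X ∩ e).card)
    {δ : ℕ} (hinter : L * n + ((X ∩ e).card - 1) * ((L + 1) * m) + δ ≤ L * coverage (X ∩ e)) :
    L * coverage (X ∪ e) + δ ≤ L * n + ((X ∪ e).card - 1) * ((L + 1) * m) := by
  have h1 := Nat.mul_le_mul_left L (coverage_union_add_inter_le X e)
  have h2 := Nat.mul_le_mul_left L he.2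
  have h3 := Finset.card_union_add_card_inter X e
  have h4 := Finset.card_le_card (Finset.inter_subset_left (s₁ := X) (s₂ := e))
  obtain ⟨x, hx⟩ := Nat.exists_eq_add_of_le (hXe.trans h4)
  obtain ⟨i, hi⟩ := Nat.exists_eq_add_of_le hXe
  have h5 : (X ∪ e).card = x + L + 1 - i := by omega
  have h6 : i ≤ x := by omega
  obtain ⟨k, rfl⟩ := Nat.exists_eq_add_of_le h6
  rw [h5, show i + k + L + 1 - i - 1 = k + L by omega]
  rw [hx, Nat.add_sub_cancel_left] at hX
  rw [hi, Nat.add_sub_cancel_left] at hinter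
  nlinarith

/-- Edges glued along single words stay as dense as spreadness allows. The last edge of a short
Berge cycle meets the union of the others in at least 2 words; if it meets it in at most L, the
union becomes too dense. -/
lemma uncrowded_of_isSpread {L m : ℕ} (hL : 2 ≤ L) (hLm : Nat.gcd L m = 1)
    {T : Finset (Fin n → A)}
    (hT : ∀ S ⊆ T, 2 ≤ S.card → S.card ≤ 4 * (L + 1) → IsSpread L m S)
    {E : Finset (Finset (Fin n → A))}
    (hE : ∀ e ∈ E, e ⊆ T ∧ e.card = L + 1 ∧ coverage e ≤ n + (L + 1) * m) : Uncrowded E := by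
  have hedge : ∀ e ∈ E, L * coverage e ≤ L * n + (e.card - 1) * ((L + 1) * m) := by
    intro e he
    obtain ⟨-, h1, h2⟩ := hE e he
    rw [h1, Nat.add_sub_cancel]
    nlinarith
  have hdense : ∀ X ⊆ T, X.card ≤ 3 * (L + 1) →
      L * coverage X ≤ L * n + (X.card - 1) * ((L + 1) * m) → ∀ e ∈ E, 2 ≤ (X ∩ e).card →
      (X ∩ e).card ≤ L → False := by
    intro X hXT hXcard hX e he h2 hle
    have h3 := hT (X ∩ e) (Finset.inter_subset_left.trans hXT) h2 (by omega)
    have h4 := coverage_union_mul_le (δ := 1) hX (hE e he).2 (by omega)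
      (Nat.succ_le_of_lt (h3.lt hLm h2 hle))
    have h5 := Finset.card_union_add_card_inter X e
    have h6 := (hE e he).2.1
    have h7 := Finset.card_le_card (Finset.inter_subset_left (s₁ := X) (s₂ := e))
    have h8 := hT (X ∪ e) (Finset.union_subset hXT (hE e he).1) (by omega) (by omega)
    unfold IsSpread at h8
    omega
  have hglue : ∀ X, L * coverage X ≤ L * n + (X.card - 1) * ((L + 1) * m) → ∀ e ∈ E,
      (X ∩ e).card = 1 →
      L * coverage (X ∪ e) ≤ L * n + ((X ∪ e).card - 1) * ((L + 1) * m) := by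
    intro X hX e he h1
    refine coverage_union_mul_le (δ := 0) hX (hE e he).2 h1.ge ?_
    obtain ⟨x, hx⟩ := Finset.card_eq_one.1 h1
    rw [hx, coverage_singleton]
    simp
  have htwo : ∀ e ∈ E, ∀ f ∈ E, e ≠ f → (e ∩ f).card ≤ 1 := by
    intro e he f hf hef
    by_contra! h
    refine hdense e (hE e he).1 (by rw [(hE e he).2.1]; omega) (hedge e he) f hf h ?_
    by_contra! hlt
    have h1 : e ∩ f = e := Finset.eq_of_subset_of_card_le Finset.inter_subset_left
      (by rw [(hE e he).2.1]; omega)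
    have h2 : e ∩ f = f := Finset.eq_of_subset_of_card_le Finset.inter_subset_right
      (by rw [(hE f hf).2.1]; omega)
    exact hef (h1.symm.trans h2)
  have hone : ∀ e ∈ E, ∀ f ∈ E, e ≠ f → ∀ x, x ∈ e → x ∈ f → (e ∩ f).card = 1 :=
    fun e he f hf hef x hxe hxf => le_antisymm (htwo e he f hf hef)
      (Finset.card_pos.2 ⟨x, Finset.mem_inter.2 ⟨hxe, hxf⟩⟩)
  have htwo' : ∀ e ∈ E, ∀ f ∈ E, e ≠ f → ∀ x y, x ∈ e → x ∈ f → y ∈ e → y ∈ f → x = y :=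
    fun e he f hf hef x y h1 h2 h3 h4 => Finset.card_le_one.1 (htwo e he f hf hef) x
      (Finset.mem_inter.2 ⟨h1, h2⟩) y (Finset.mem_inter.2 ⟨h3, h4⟩)
  have hpair : ∀ X : Finset (Fin n → A), ∀ x y, x ≠ y → x ∈ X → y ∈ X → 2 ≤ X.card :=
    fun X x y hxy hx hy => Finset.one_lt_card.2 ⟨x, hx, y, hy, hxy⟩
  have hunion : ∀ X Y Z : Finset (Fin n → A),
      ((X ∪ Y) ∩ Z).card ≤ (X ∩ Z).card + (Y ∩ Z).card := fun X Y Z => by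
    rw [Finset.union_inter_distrib_right]
    exact Finset.card_union_le _ _
  have hpath : ∀ e ∈ E, ∀ f ∈ E, e ≠ f → ∀ x, x ∈ e → x ∈ f → ∀ g ∈ E, g ≠ e → g ≠ f →
      ((e ∪ f) ∩ g).card ≤ 1 := by
    intro e he f hf hef x hxe hxf g hg hge hgf
    by_contra! h
    have h1 := htwo e he g hg hge.symm
    have h2 := htwo f hf g hg hgf.symm
    have h3 := hunion e f g
    have h4 := Finset.card_union_le e f
    exact hdense (e ∪ f) (Finset.union_subset (hE e he).1 (hE f hf).1)
      (by rw [(hE e he).2.1, (hE f hf).2.1] at h4; omega)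
      (hglue e (hedge e he) f hf (hone e he f hf hef x hxe hxf)) g hg h (by omega)
  have hthree : ∀ e ∈ E, ∀ f ∈ E, ∀ g ∈ E, e ≠ f → f ≠ g → g ≠ e → ∀ x y z, x ∈ e → x ∈ f →
      y ∈ f → y ∈ g → z ∈ g → z ∈ e → x ≠ y → y ≠ z → z ≠ x → False := by
    intro e he f hf g hg hef hfg hge x y z hxe hxf hyf hyg hzg hze hxy hyz hzx
    have h1 := hpath e he f hf hef x hxe hxf g hg hge hfg.symm
    have h2 := hpair ((e ∪ f) ∩ g) y z hyz (by simp [hyf, hyg]) (by simp [hzg, hze])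
    omega
  refine ⟨htwo', hthree, ?_⟩
  intro e he f hf g hg h hh hef hfg hgh hhe heg hfh x y z t hxe hxf hyf hyg hzg hzh hth hte hxy hyz
    hzt htx hxz hyt
  have hdis : f ∩ h = ∅ := by
    by_contra hne
    obtain ⟨s, hs⟩ := Finset.nonempty_iff_ne_empty.2 hne
    rw [Finset.mem_inter] at hs
    have hst : s ≠ t := by
      rintro rfl
      exact htx (htwo' e he f hf hef s x hte hs.1 hxe hxf)
    have hxs : x ≠ s := by
      rintro rfl
      exact htx (htwo' h hh e he hhe t x hth hte hs.2 hxe)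
    exact hthree e he f hf h hh hef hfh hhe x s t hxe hxf hs.1 hs.2 hth hte hxs hst htx
  have h1 : ((e ∪ f) ∩ g).card = 1 := le_antisymm
    (hpath e he f hf hef x hxe hxf g hg heg.symm hfg.symm)
    (Finset.card_pos.2 ⟨y, by simp [hyf, hyg]⟩)
  have h2 := hglue (e ∪ f) (hglue e (hedge e he) f hf (hone e he f hf hef x hxe hxf)) g hg h1
  have h3 := Finset.card_union_le e f
  have h4 := Finset.card_union_le (e ∪ f) g
  have h5 := hunion (e ∪ f) g h
  have h6 := hunion e f h
  have h7 := htwo e he h hh hhe.symm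
  have h8 := htwo g hg h hh hgh
  rw [hdis, Finset.card_empty] at h6
  rw [(hE e he).2.1, (hE f hf).2.1] at h3
  rw [(hE g hg).2.1] at h4
  exact hdense (e ∪ f ∪ g)
    (Finset.union_subset (Finset.union_subset (hE e he).1 (hE f hf).1) (hE g hg).1) (by omega) h2 h hh
    (hpair _ z t hzt (by simp [hzg, hzh]) (by simp [hte, hth])) (by omega)

end uncrowded

section degrees

lemma card_filter_lt_degree_mul_le {V : Type*} [DecidableEq V] (T : Finset V)
    (E : Finset (Finset V)) {k : ℕ} (hE : ∀ e ∈ E, e.card = k) {d : ℝ} :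
    ((T.filter fun v => d < ((E.filter (v ∈ ·)).card : ℝ)).card : ℝ) * d ≤ k * E.card := by
  set H := T.filter fun v => d < ((E.filter (v ∈ ·)).card : ℝ)
  calc (H.card : ℝ) * d = ∑ v ∈ H, d := by simp
    _ ≤ ∑ v ∈ H, ((E.filter (v ∈ ·)).card : ℝ) :=
        Finset.sum_le_sum fun v hv => (Finset.mem_filter.1 hv).2.le
    _ = ∑ v ∈ H, ∑ e ∈ E, if v ∈ e then (1 : ℝ) else 0 := by simp
    _ = ∑ e ∈ E, ∑ v ∈ H, if v ∈ e then (1 : ℝ) else 0 := Finset.sum_comm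
    _ ≤ ∑ e ∈ E, (k : ℝ) := by
        refine Finset.sum_le_sum fun e he => ?_
        simp only [Finset.sum_boole]
        rw [← hE e he]
        exact_mod_cast Finset.card_le_card fun v hv => (Finset.mem_filter.1 hv).2
    _ = k * E.card := by simp [mul_comm]

end degrees

end ListDecoding

/-! ### Random spread sets and the logarithmic gain. -/

namespace ListDecoding

section sparseSampling

variable {n q L m : ℕ}

/-- Coverage is an integer, so a non-spread set falls short by at least 1/L and gains q^(-1/L). The
increased density costs at most q^(1/(2L)) of it. -/
lemma sum_not_isSpread_le (hL : 1 ≤ L) (hq : 1 ≤ q) {K₀ : ℕ} {ε p : ℝ} (hε : 0 ≤ ε)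
    (hεK : ε * K₀ ≤ 1 / (2 * L)) (hp : p = (q : ℝ) ^ (-((m : ℝ) * (L + 1) / L) + ε))
    {𝓑 : Finset (Finset (Fin n → Fin q))}
    (h𝓑 : ∀ S ∈ 𝓑, 2 ≤ S.card ∧ S.card ≤ K₀ ∧ ¬ IsSpread L m S) :
    ∑ S ∈ 𝓑, p ^ S.card ≤
      (K₀ + 1) * (K₀.factorial : ℝ) ^ n * (q : ℝ) ^ (-(1 : ℝ) / (2 * L)) * (p * (q : ℝ) ^ n) := by
  classical
  have hL0 : (0 : ℝ) < L := by exact_mod_cast hL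
  have hq0 : (0 : ℝ) < q := by exact_mod_cast hq
  have hq1 : (1 : ℝ) ≤ q := by exact_mod_cast hq
  have hp0 : 0 < p := by rw [hp]; positivity
  rw [← Finset.sum_fiberwise_of_maps_to (s := 𝓑) (t := Finset.range (K₀ + 1)) (g := Finset.card)
    (fun S hS => Finset.mem_range.2 (by have := (h𝓑 S hS).2.1; omega))]
  have hterm : ∀ k ∈ Finset.range (K₀ + 1), ∑ S ∈ 𝓑 with S.card = k, p ^ S.card ≤
      (K₀.factorial : ℝ) ^ n * (q : ℝ) ^ (-(1 : ℝ) / (2 * L)) * (p * (q : ℝ) ^ n) := by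
    intro k hk
    rw [Finset.mem_range] at hk
    by_cases hk2 : 2 ≤ k
    swap
    · rw [Finset.filter_false_of_mem fun S hS => by have := (h𝓑 S hS).1; omega,
        Finset.sum_empty]
      positivity
    set u := (L * n + (k - 1) * ((L + 1) * m) - 1) / L with hu
    have hcov : ∀ S ∈ 𝓑.filter fun S => S.card = k, S.card = k ∧ coverage S ≤ u := by
      intro S hS
      rw [Finset.mem_filter] at hS
      refine ⟨hS.2, (Nat.le_div_iff_mul_le (by omega)).2 ?_⟩
      have h1 := (h𝓑 S hS.1).2.2
      unfold IsSpread at h1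
      rw [hS.2] at h1
      rw [mul_comm]
      omega
    have hcount := card_filter_coverage_le hq _ hcov
    rw [Finset.sum_congr rfl fun S hS => by rw [(Finset.mem_filter.1 hS).2], Finset.sum_const,
      nsmul_eq_mul]
    by_cases hemp : (𝓑.filter fun S => S.card = k) = ∅
    · rw [hemp, Finset.card_empty, Nat.cast_zero, zero_mul]
      positivity
    obtain ⟨S, hS⟩ := Finset.nonempty_iff_ne_empty.2 hemp
    have hpos : 1 ≤ L * n + (k - 1) * ((L + 1) * m) := by
      have h1 := (h𝓑 S (Finset.mem_filter.1 hS).1).2.2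
      unfold IsSpread at h1
      rw [(Finset.mem_filter.1 hS).2] at h1
      omega
    have hu1 : (u : ℝ) ≤ n + (k - 1) * (m * (L + 1) / L) - 1 / L := by
      have h1 : u * L ≤ L * n + (k - 1) * ((L + 1) * m) - 1 := Nat.div_mul_le_self _ _
      have h2 : u * L + 1 ≤ L * n + (k - 1) * ((L + 1) * m) := by omega
      have h3 : (u : ℝ) * L + 1 ≤ L * n + (k - 1) * ((L + 1) * m) := by
        have : (((u * L + 1 : ℕ)) : ℝ) ≤ ((L * n + (k - 1) * ((L + 1) * m) : ℕ) : ℝ) := by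
          exact_mod_cast h2
        push_cast [Nat.cast_sub (by omega : 1 ≤ k)] at this
        exact this
      have h4 : (n : ℝ) + (k - 1) * (m * (L + 1) / L) - 1 / L =
          (L * n + (k - 1) * ((L + 1) * m) - 1) / L := by field_simp
      rw [h4, le_div_iff₀ hL0]
      linarith
    have hk1 : ((k - 1 : ℕ) : ℝ) = k - 1 := by push_cast [Nat.cast_sub (by omega : 1 ≤ k)]; ring
    have hfact : (k.factorial : ℝ) ≤ K₀.factorial := by
      exact_mod_cast Nat.factorial_le (by omega)
    have hpk : (q : ℝ) ^ u * p ^ (k - 1) ≤ (q : ℝ) ^ (-(1 : ℝ) / (2 * L)) * (q : ℝ) ^ n := by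
      rw [hp, ← Real.rpow_natCast, ← Real.rpow_natCast, ← Real.rpow_natCast, ← Real.rpow_mul hq0.le,
        ← Real.rpow_add hq0, ← Real.rpow_add hq0]
      refine Real.rpow_le_rpow_of_exponent_le hq1 ?_
      rw [hk1]
      have h1 : (k - 1 : ℝ) * ε ≤ 1 / (2 * L) := by
        refine le_trans ?_ hεK
        rw [mul_comm]
        refine mul_le_mul_of_nonneg_left ?_ hε
        have : (k : ℝ) ≤ K₀ := by exact_mod_cast (by omega : k ≤ K₀)
        linarith
      have h2 : (1 : ℝ) / L = 1 / (2 * L) + 1 / (2 * L) := by field_simp; norm_num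
      have h3 : -(1 : ℝ) / (2 * L) = -(1 / (2 * L)) := by ring
      rw [h3]
      nlinarith
    calc ((𝓑.filter fun S => S.card = k).card : ℝ) * p ^ k
        ≤ ((k.factorial : ℝ) ^ n * (q : ℝ) ^ u) * p ^ k := by gcongr
      _ = (k.factorial : ℝ) ^ n * ((q : ℝ) ^ u * p ^ (k - 1)) * p := by
          conv_lhs => rw [← Nat.sub_add_cancel (by omega : 1 ≤ k), pow_succ]
          rw [Nat.sub_add_cancel (by omega : 1 ≤ k)]
          ring
      _ ≤ (K₀.factorial : ℝ) ^ n * ((q : ℝ) ^ (-(1 : ℝ) / (2 * L)) * (q : ℝ) ^ n) * p := by gcongr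
      _ = _ := by ring
  refine (Finset.sum_le_sum hterm).trans (le_of_eq ?_)
  rw [Finset.sum_const, Finset.card_range, nsmul_eq_mul]
  push_cast
  ring

/-- A random set of words, cleaned of its dense subsets and its vertices of large degree. -/
lemma exists_spread_subset (hL : 1 ≤ L) (hq : 1 ≤ q) (hm : 1 ≤ m) {K₀ : ℕ} {ε G : ℝ} (hε : 0 ≤ ε)
    (hε1 : ε ≤ 1) (hεK : ε * K₀ ≤ 1 / (2 * L))
    (hbig : 8 * ((K₀ + 1) * (K₀.factorial : ℝ) ^ n) ≤ (q : ℝ) ^ ((1 : ℝ) / (2 * L)))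
    (hG : 8 * ((L + 1).factorial : ℝ) ^ n * (L + 1) ≤ G) :
    ∃ U : Finset (Fin n → Fin q), (∀ S ⊆ U, 2 ≤ S.card → S.card ≤ K₀ → IsSpread L m S) ∧
      (∀ E : Finset (Finset (Fin n → Fin q)),
        (∀ e ∈ E, e ⊆ U ∧ e.card = L + 1 ∧ coverage e ≤ n + (L + 1) * m) →
        ∀ w ∈ U, ((E.filter (w ∈ ·)).card : ℝ) ≤ G * ((q : ℝ) ^ ε) ^ L) ∧
      1 / 2 * (q : ℝ) ^ ((n : ℝ) - m * (L + 1) / L + ε) ≤ U.card := by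
  classical
  have hL0 : (0 : ℝ) < L := by exact_mod_cast hL
  have hq0 : (0 : ℝ) < q := by exact_mod_cast hq
  have hq1 : (1 : ℝ) ≤ q := by exact_mod_cast hq
  have hm1 : (1 : ℝ) ≤ m := by exact_mod_cast hm
  set p : ℝ := (q : ℝ) ^ (-((m : ℝ) * (L + 1) / L) + ε) with hp
  have hp0 : 0 < p := by positivity
  have hβ : 1 ≤ (m : ℝ) * (L + 1) / L := by
    rw [le_div_iff₀ hL0]
    nlinarith
  have hp1 : p ≤ 1 := Real.rpow_le_one_of_one_le_of_nonpos hq1 (by linarith)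
  set A : ℝ := ((L + 1).factorial : ℝ) ^ n with hA
  have hA0 : 0 < A := by positivity
  set 𝓑 : Finset (Finset (Fin n → Fin q)) :=
    Finset.univ.filter fun S => 2 ≤ S.card ∧ S.card ≤ K₀ ∧ ¬ IsSpread L m S with h𝓑
  set 𝓔 : Finset (Finset (Fin n → Fin q)) :=
    Finset.univ.filter fun S => S.card = L + 1 ∧ coverage S ≤ n + (L + 1) * m with h𝓔
  have hEcard : (𝓔.card : ℝ) ≤ A * (q : ℝ) ^ (n + (L + 1) * m) :=
    card_filter_coverage_le hq 𝓔 fun S hS => (Finset.mem_filter.1 hS).2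
  -- The price of a forbidden set. Non-spread sets cost 1 and forbidden sets w, and either kind
  -- costs at most p q^n/8 in expectation.
  set w : ℝ := 1 / (8 * A * ((q : ℝ) ^ ε) ^ L) with hw
  have hw0 : 0 < w := by positivity
  have hBsum : ∑ S ∈ 𝓑, p ^ S.card ≤ p * (q : ℝ) ^ n / 8 := by
    refine (sum_not_isSpread_le hL hq hε hεK hp fun S hS => (Finset.mem_filter.1 hS).2).trans ?_
    have h1 : (K₀ + 1) * (K₀.factorial : ℝ) ^ n * (q : ℝ) ^ (-(1 : ℝ) / (2 * L)) ≤ 1 / 8 := by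
      rw [neg_div, Real.rpow_neg hq0.le, ← div_eq_mul_inv, div_le_iff₀ (by positivity)]
      linarith
    have h2 : 0 ≤ p * (q : ℝ) ^ n := by positivity
    nlinarith
  have hEsum : ∑ S ∈ 𝓔, w * p ^ S.card ≤ p * (q : ℝ) ^ n / 8 := by
    rw [Finset.sum_congr rfl fun S hS => by rw [(Finset.mem_filter.1 hS).2.1], Finset.sum_const,
      nsmul_eq_mul]
    have h1 : p ^ L * (q : ℝ) ^ ((L + 1) * m) = ((q : ℝ) ^ ε) ^ L := by
      rw [hp, ← Real.rpow_natCast, ← Real.rpow_natCast, ← Real.rpow_natCast, ← Real.rpow_mul hq0.le,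
        ← Real.rpow_mul hq0.le, ← Real.rpow_add hq0]
      congr 1
      push_cast
      field_simp
      ring
    calc (𝓔.card : ℝ) * (w * p ^ (L + 1)) ≤ A * (q : ℝ) ^ (n + (L + 1) * m) * (w * p ^ (L + 1)) := by
          gcongr
      _ = A * w * p * (q : ℝ) ^ n * (p ^ L * (q : ℝ) ^ ((L + 1) * m)) := by ring
      _ = p * (q : ℝ) ^ n / 8 := by rw [h1, hw]; field_simp
  obtain ⟨S, hS⟩ := exists_finset_le_card_sub_sum hp0.le hp1 Finset.univ fun B =>
    (if B ∈ 𝓑 then 1 else 0) + (if B ∈ 𝓔 then w else 0)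
  set ES := 𝓔.filter (· ⊆ S) with hES
  have hS' : 3 / 4 * (p * (q : ℝ) ^ n) ≤ S.card - (𝓑.filter (· ⊆ S)).card - w * ES.card := by
    have h1 : ∑ B : Finset (Fin n → Fin q), ((if B ∈ 𝓑 then (1 : ℝ) else 0) +
        (if B ∈ 𝓔 then w else 0)) * p ^ B.card = ∑ B ∈ 𝓑, p ^ B.card + ∑ B ∈ 𝓔, w * p ^ B.card := by
      simp only [add_mul, ite_mul, one_mul, zero_mul, Finset.sum_add_distrib, Finset.sum_ite_mem,
        Finset.univ_inter]
    have h2 : ∑ B : Finset (Fin n → Fin q) with B ⊆ S, ((if B ∈ 𝓑 then (1 : ℝ) else 0) +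
        (if B ∈ 𝓔 then w else 0)) = (𝓑.filter (· ⊆ S)).card + w * ES.card := by
      rw [Finset.sum_add_distrib, Finset.sum_ite_mem, Finset.sum_ite_mem, Finset.sum_const,
        Finset.sum_const, nsmul_eq_mul, nsmul_eq_mul, mul_one, mul_comm w]
      have h3 : ∀ 𝓕 : Finset (Finset (Fin n → Fin q)),
          Finset.univ.filter (· ⊆ S) ∩ 𝓕 = 𝓕.filter (· ⊆ S) := by
        intro 𝓕; ext B; simp [and_comm]
      rw [h3, h3]
    rw [h1, h2] at hS
    simp only [Fintype.card_fun, Fintype.card_fin, Nat.cast_pow] at hS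
    linarith
  obtain ⟨T, hTS, hTcard, hT⟩ := exists_subset_forall_not_subset S (𝓑.filter (· ⊆ S))
    fun B hB => Finset.card_pos.1 (by simp [h𝓑] at hB; omega)
  -- By double counting at most w|ES| words exceed this degree, which is the price already paid for
  -- `ES`.
  set d : ℝ := (L + 1) / w with hd
  have hd0 : 0 < d := by positivity
  set H := T.filter fun v => d < ((ES.filter (v ∈ ·)).card : ℝ) with hH
  have hHcard : (H.card : ℝ) ≤ w * ES.card := by
    have h1 := card_filter_lt_degree_mul_le T ES (k := L + 1) (d := d)
      fun e he => (Finset.mem_filter.1 (Finset.mem_filter.1 he).1).2.1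
    rw [← hH, hd, mul_div_assoc', div_le_iff₀ hw0] at h1
    push_cast at h1
    have h2 : (0 : ℝ) < L + 1 := by positivity
    nlinarith
  refine ⟨T \ H, fun B hB h2 hK => ?_, fun E hE v hv => ?_, ?_⟩
  · by_contra hsp
    have hBT : B ⊆ T := hB.trans Finset.sdiff_subset
    exact hT B (by simp [h𝓑, h2, hK, hsp, hBT.trans hTS]) hBT
  · rw [Finset.mem_sdiff] at hv
    have h1 : ¬ d < ((ES.filter (v ∈ ·)).card : ℝ) := fun h =>
      hv.2 (Finset.mem_filter.2 ⟨hv.1, h⟩)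
    have h2 : E ⊆ ES := by
      intro e he
      obtain ⟨h3, h4, h5⟩ := hE e he
      simp [hES, h𝓔, h4, h5, (h3.trans Finset.sdiff_subset).trans hTS]
    have h3 : ((E.filter (v ∈ ·)).card : ℝ) ≤ (ES.filter (v ∈ ·)).card := by
      exact_mod_cast Finset.card_le_card (Finset.filter_subset_filter _ h2)
    refine h3.trans ((not_lt.1 h1).trans ?_)
    have h4 : d = 8 * A * (L + 1) * ((q : ℝ) ^ ε) ^ L := by rw [hd, hw]; field_simp
    rw [h4]
    gcongr
  · have h1 : (T.card : ℝ) ≤ (T \ H).card + H.card := by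
      have := Finset.le_card_sdiff H T
      exact_mod_cast (by omega : T.card ≤ (T \ H).card + H.card)
    have h2 : (S.card : ℝ) ≤ T.card + (𝓑.filter (· ⊆ S)).card := by exact_mod_cast hTcard
    have h3 : (q : ℝ) ^ ((n : ℝ) - m * (L + 1) / L + ε) = p * (q : ℝ) ^ n := by
      rw [hp, ← Real.rpow_natCast, ← Real.rpow_add hq0]
      congr 1
      ring
    have h4 : 0 < p * (q : ℝ) ^ n := by positivity
    rw [h3]
    linarith

end sparseSampling

/-- Codes from independent sets in uncrowded hypergraphs. -/
theorem exists_code_coverage_log (n L : ℕ) (hL : 2 ≤ L) : ∃ μ : ℝ, 0 < μ ∧ ∀ q m : ℕ, 2 ≤ q →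
    Nat.gcd L m = 1 → ∃ C : Finset (Fin n → Fin q),
      (∀ S : Finset (Fin n → Fin q), S ⊆ C → S.card = L + 1 → n + (L + 1) * m < coverage S) ∧
      μ * (q : ℝ) ^ ((n : ℝ) - m * (L + 1) / L) * Real.log q ^ ((1 : ℝ) / L) ≤ C.card := by
  classical
  have hL0 : (0 : ℝ) < L := by exact_mod_cast (by omega : 0 < L)
  obtain ⟨μ, hμ, hsmall⟩ := exists_code_coverage n L (by omega)
  obtain ⟨c, hc, D₀, hnibble⟩ := exists_independent_of_uncrowded L (by omega)
  -- Four edges together have at most this many words.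
  set K₀ : ℕ := 4 * (L + 1) with hK₀
  have hK0 : (0 : ℝ) < K₀ := by rw [hK₀]; positivity
  set ε : ℝ := 1 / (2 * L * K₀) with hε
  have hε0 : 0 < ε := by positivity
  have hεK : ε * K₀ ≤ 1 / (2 * L) := by
    apply le_of_eq; rw [hε]; field_simp
  have hε1 : ε ≤ 1 := by
    rw [hε, div_le_one (by positivity)]
    have : (1 : ℝ) ≤ L := by exact_mod_cast (by omega : 1 ≤ L)
    have : (1 : ℝ) ≤ K₀ := by exact_mod_cast (by omega : 1 ≤ K₀)
    nlinarith
  set G : ℝ := 8 * ((L + 1).factorial : ℝ) ^ n * (L + 1) with hG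
  have hG0 : 0 < G := by positivity
  have hG1 : 1 ≤ G := by
    have h1 : (1 : ℝ) ≤ ((L + 1).factorial : ℝ) ^ n :=
      one_le_pow₀ (by exact_mod_cast Nat.one_le_iff_ne_zero.2 (Nat.factorial_ne_zero _))
    rw [hG]
    nlinarith
  obtain ⟨q₁, hq₁⟩ : ∃ q₁ : ℕ, ∀ q : ℕ, q₁ ≤ q →
      8 * ((K₀ + 1) * (K₀.factorial : ℝ) ^ n) ≤ (q : ℝ) ^ ((1 : ℝ) / (2 * L)) ∧
      D₀ ≤ (q : ℝ) ^ ε := by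
    have h1 := ((tendsto_rpow_atTop (by positivity : (0 : ℝ) < 1 / (2 * L))).comp
      tendsto_natCast_atTop_atTop).eventually_ge_atTop (8 * ((K₀ + 1) * (K₀.factorial : ℝ) ^ n))
    have h2 := ((tendsto_rpow_atTop hε0).comp
      tendsto_natCast_atTop_atTop).eventually_ge_atTop D₀
    exact Filter.eventually_atTop.1 (h1.and h2)
  set g : ℝ := G ^ ((1 : ℝ) / L) with hg
  have hg1 : 1 ≤ g := Real.one_le_rpow hG1 (by positivity)
  have hgL : g ^ L = G := by rw [hg, one_div, Real.rpow_inv_natCast_pow hG0.le (by omega)]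
  set ℓ : ℝ := Real.log (q₁ + 2) ^ ((1 : ℝ) / L) with hℓ
  have hℓ0 : 0 < ℓ := Real.rpow_pos_of_pos (Real.log_pos (by
    have : (0 : ℝ) ≤ q₁ := by positivity
    linarith)) _
  set ν : ℝ := c * ε ^ ((1 : ℝ) / L) / (2 * g) with hν
  have hν0 : 0 < ν := by positivity
  refine ⟨min (μ / ℓ) ν, by positivity, fun q m hq hgcd => ?_⟩
  have hq0 : (0 : ℝ) < q := by exact_mod_cast (by omega : 0 < q)
  have hlog0 : 0 ≤ Real.log q := Real.log_natCast_nonneg q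
  -- For the finitely many small q the logarithm is bounded, so the alteration code suffices with a
  -- smaller constant.
  by_cases hqq : q < q₁
  · obtain ⟨C, hC, hCcard⟩ := hsmall q m (by omega)
    refine ⟨C, hC, le_trans ?_ hCcard⟩
    have h1 : Real.log q ^ ((1 : ℝ) / L) ≤ ℓ := by
      refine Real.rpow_le_rpow hlog0 (Real.log_le_log hq0 ?_) (by positivity)
      have : (q : ℝ) ≤ q₁ := by exact_mod_cast hqq.le
      linarith
    calc _ ≤ μ / ℓ * (q : ℝ) ^ ((n : ℝ) - m * (L + 1) / L) * ℓ := by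
          gcongr
          exact min_le_left _ _
      _ = _ := by field_simp
  · obtain ⟨hbig, hDq⟩ := hq₁ q (not_lt.1 hqq)
    have hm : 1 ≤ m := by
      by_contra! h
      obtain rfl : m = 0 := by omega
      rw [Nat.gcd_zero_right] at hgcd
      omega
    obtain ⟨U, hUspread, hUdeg, hUcard⟩ :=
      exists_spread_subset (n := n) (by omega : 1 ≤ L) (by omega : 1 ≤ q) hm hε0.le hε1 hεK hbig hG.ge
    set E : Finset (Finset (Fin n → Fin q)) :=
      Finset.univ.filter fun e => e ⊆ U ∧ e.card = L + 1 ∧ coverage e ≤ n + (L + 1) * m with hE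
    have hEmem : ∀ e ∈ E, e ⊆ U ∧ e.card = L + 1 ∧ coverage e ≤ n + (L + 1) * m :=
      fun e he => (Finset.mem_filter.1 he).2
    set D : ℝ := g * (q : ℝ) ^ ε with hD
    have hqD : (q : ℝ) ^ ε ≤ D := le_mul_of_one_le_left (by positivity) hg1
    obtain ⟨J, hJU, hJ, hJcard⟩ := hnibble D (hDq.trans hqD) (Fin n → Fin q) U E
      (uncrowded_of_isSpread hL hgcd hUspread hEmem) (fun e he => ⟨(hEmem e he).1, (hEmem e he).2.1⟩)
      (fun w hw => by
        rw [hD, mul_pow, hgL]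
        exact hUdeg E hEmem w hw)
    refine ⟨J, fun S hSJ hS => ?_, le_trans ?_ hJcard⟩
    · by_contra! hcov
      exact hJ S (Finset.mem_filter.2 ⟨Finset.mem_univ _, hSJ.trans hJU, hS, hcov⟩) hSJ
    · have hlogD : ε * Real.log q ≤ Real.log D := by
        rw [← Real.log_rpow hq0]
        exact Real.log_le_log (by positivity) hqD
      have h1 : ε ^ ((1 : ℝ) / L) * Real.log q ^ ((1 : ℝ) / L) ≤ Real.log D ^ ((1 : ℝ) / L) := by
        rw [← Real.mul_rpow hε0.le hlog0]
        exact Real.rpow_le_rpow (by positivity) hlogD (by positivity)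
      have hD0 : 0 < D := by positivity
      have h2 : 0 ≤ Real.log D ^ ((1 : ℝ) / L) :=
        le_trans (mul_nonneg (by positivity) (Real.rpow_nonneg hlog0 _)) h1
      have h3 : 0 ≤ c * Real.log D ^ ((1 : ℝ) / L) / D :=
        div_nonneg (mul_nonneg hc.le h2) hD0.le
      calc min (μ / ℓ) ν * (q : ℝ) ^ ((n : ℝ) - m * (L + 1) / L) * Real.log q ^ ((1 : ℝ) / L)
          ≤ ν * (q : ℝ) ^ ((n : ℝ) - m * (L + 1) / L) * Real.log q ^ ((1 : ℝ) / L) := by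
            gcongr
            exact min_le_right _ _
        _ = c * (ε ^ ((1 : ℝ) / L) * Real.log q ^ ((1 : ℝ) / L)) / D *
            (1 / 2 * (q : ℝ) ^ ((n : ℝ) - m * (L + 1) / L + ε)) := by
            rw [hν, hD, Real.rpow_add hq0]
            field_simp
        _ ≤ c * Real.log D ^ ((1 : ℝ) / L) / D * U.card := by gcongr

end ListDecoding

/-! ### Generic parity checks over finite fields. -/

namespace ListDecoding

open Matrix

/-- One less than the number of elements of `{0, x, y}`. -/
def pairWeight {R : Type*} [Zero R] [DecidableEq R] (x y : R) : ℕ :=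
  if x = 0 ∧ y = 0 then 0 else if x = 0 ∨ y = 0 ∨ x = y then 1 else 2

section weightCount

variable {ι X : Type*} [Fintype ι] [DecidableEq ι] [Fintype X]

/-- The generating function factorises over coordinates, and each counted f contributes at least
Q^(-u). -/
lemma card_filter_sum_weight_le (wt : X → ℕ) {Q c : ℝ} (hQ : 1 ≤ Q)
    (hc : ∑ x, (Q⁻¹) ^ wt x ≤ c) (u : ℕ) :
    ((Finset.univ.filter fun f : ι → X => ∑ i, wt (f i) ≤ u).card : ℝ) ≤
      c ^ Fintype.card ι * Q ^ u := by
  have hQ0 : 0 < Q := by linarith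
  have h1 : ∑ f : ι → X, (Q⁻¹) ^ ∑ i, wt (f i) ≤ c ^ Fintype.card ι := by
    have := Finset.prod_univ_sum (fun _ : ι => (Finset.univ : Finset X)) (fun _ x => (Q⁻¹) ^ wt x)
    simp only [Fintype.piFinset_univ, Finset.prod_const, Finset.card_univ] at this
    simp only [← Finset.prod_pow_eq_pow_sum, ← this]
    gcongr
  have h2 : ((Finset.univ.filter fun f : ι → X => ∑ i, wt (f i) ≤ u).card : ℝ) * (Q⁻¹) ^ u ≤
      c ^ Fintype.card ι := by
    refine le_trans ?_ h1
    rw [← nsmul_eq_mul, ← Finset.sum_const]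
    calc _ ≤ ∑ f ∈ Finset.univ.filter fun f : ι → X => ∑ i, wt (f i) ≤ u,
          (Q⁻¹) ^ ∑ i, wt (f i) :=
          Finset.sum_le_sum fun f hf => pow_le_pow_of_le_one (by positivity)
            (inv_le_one_of_one_le₀ hQ) (Finset.mem_filter.1 hf).2
      _ ≤ _ := Finset.sum_le_sum_of_subset_of_nonneg (Finset.filter_subset _ _)
          fun _ _ _ => by positivity
  rwa [inv_pow, ← div_eq_mul_inv, div_le_iff₀ (by positivity)] at h2

end weightCount

section generic

variable {F ι : Type*} [Field F] [Fintype F] [DecidableEq F] [Fintype ι] [DecidableEq ι]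

lemma sum_singleWeight_le :
    ∑ x : F, ((Fintype.card F : ℝ)⁻¹) ^ (if x = 0 then 0 else 1) ≤ 2 := by
  have hF : (0 : ℝ) < Fintype.card F := by exact_mod_cast Fintype.card_pos
  calc ∑ x : F, ((Fintype.card F : ℝ)⁻¹) ^ (if x = 0 then 0 else 1)
      ≤ ∑ x : F, ((if x = 0 then 1 else 0) + (Fintype.card F : ℝ)⁻¹) := by
        refine Finset.sum_le_sum fun x _ => ?_
        split_ifs
        · rw [pow_zero]; linarith [inv_pos.2 hF]
        · rw [pow_one, zero_add]
    _ = 2 := by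
        rw [Finset.sum_add_distrib]
        simp
        norm_num

/-- The bound is 1 + 3 + 1: the zero pair, the lines x = 0, y = 0 and x = y at total weight 1 each,
and all pairs at weight Q⁻². -/
lemma sum_pairWeight_le :
    ∑ x : F × F, ((Fintype.card F : ℝ)⁻¹) ^ pairWeight x.1 x.2 ≤ 5 := by
  have hF : (0 : ℝ) < Fintype.card F := by exact_mod_cast Fintype.card_pos
  set Q : ℝ := (Fintype.card F : ℝ) with hQ
  have hQi : 0 < Q⁻¹ := inv_pos.2 hF
  have key : ∀ x y : F, (Q⁻¹) ^ pairWeight x y ≤ (if x = 0 then if y = 0 then 1 else 0 else 0) +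
      Q⁻¹ * ((if x = 0 then 1 else 0) + (if y = 0 then 1 else 0) + (if x = y then 1 else 0)) +
        (Q⁻¹) ^ 2 := by
    intro x y
    unfold pairWeight
    have h2 : 0 < (Q ^ 2)⁻¹ := by positivity
    by_cases hx : x = 0 <;> by_cases hy : y = 0 <;> by_cases hxy : x = y <;>
      simp [hx, hy, hxy] <;> (try split_ifs) <;> nlinarith
  rw [Fintype.sum_prod_type]
  refine (Finset.sum_le_sum fun x _ => Finset.sum_le_sum fun y _ => key x y).trans (le_of_eq ?_)
  simp only [Finset.sum_add_distrib, ← Finset.mul_sum, Finset.sum_const, Finset.card_univ,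
    nsmul_eq_mul, ← hQ, Finset.sum_ite_eq', Finset.sum_ite_eq, Finset.mem_univ, if_true, mul_one]
  have h0 : ∑ x : F, ∑ y : F, (if x = 0 then if y = 0 then (1 : ℝ) else 0 else 0) = 1 := by
    simp [Finset.sum_ite_eq']
  rw [h0]
  field_simp
  norm_num

lemma card_ker_mul_pow {a : ℕ} {M : Matrix (Fin a) ι F} (hM : LinearIndependent F M.row) :
    (Finset.univ.filter fun r : ι → F => M *ᵥ r = 0).card * Fintype.card F ^ a =
      Fintype.card F ^ Fintype.card ι := by
  have h1 := LinearMap.finrank_range_add_finrank_ker M.mulVecLin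
  have h2 : Module.finrank F (LinearMap.range M.mulVecLin) = a := by
    have := hM.rank_matrix
    rw [Fintype.card_fin] at this
    exact this
  rw [h2, Module.finrank_fintype_fun_eq_card] at h1
  have h3 : (Finset.univ.filter fun r : ι → F => M *ᵥ r = 0).card =
      Fintype.card F ^ Module.finrank F (LinearMap.ker M.mulVecLin) := by
    rw [← Nat.card_eq_fintype_card (α := F),
      ← Module.natCard_eq_pow_finrank (K := F) (V := LinearMap.ker M.mulVecLin),
      ← Fintype.card_subtype, ← Nat.card_eq_fintype_card]
    exact Nat.card_congr (Equiv.subtypeEquivRight fun r => by simp)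
  rw [h3, ← pow_add, add_comm, h1]

lemma card_kills_mul_pow {a k : ℕ} {M : Matrix (Fin a) ι F} (hM : LinearIndependent F M.row) :
    (Finset.univ.filter fun H : Fin k → ι → F => ∀ l, M *ᵥ H l = 0).card *
      Fintype.card F ^ (a * k) = Fintype.card F ^ (k * Fintype.card ι) := by
  have h1 : (Finset.univ.filter fun H : Fin k → ι → F => ∀ l, M *ᵥ H l = 0) =
      Fintype.piFinset fun _ : Fin k => Finset.univ.filter fun r : ι → F => M *ᵥ r = 0 := by
    ext H; simp [Fintype.mem_piFinset]
  rw [h1, Fintype.card_piFinset_const, pow_mul, ← mul_pow, card_ker_mul_pow hM, ← pow_mul, mul_comm]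

/-- A fixed M is killed with probability Q^(-ak). As 𝓩 is closed under scaling, an H that kills one
member kills Q - 1 of them, and the union bound improves by that factor. -/
lemma card_exists_kills_le {a k : ℕ} (ha : 1 ≤ a) (𝓩 : Finset (Matrix (Fin a) ι F))
    (hli : ∀ M ∈ 𝓩, LinearIndependent F M.row) (hsmul : ∀ M ∈ 𝓩, ∀ c : F, c ≠ 0 → c • M ∈ 𝓩)
    {C : ℝ} (hC : (𝓩.card : ℝ) ≤ C * (Fintype.card F : ℝ) ^ (a * k)) :
    ((Finset.univ.filter fun H : Fin k → ι → F => ∃ M ∈ 𝓩, ∀ l, M *ᵥ H l = 0).card : ℝ) *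
      (Fintype.card F - 1) ≤ C * (Fintype.card F : ℝ) ^ (k * Fintype.card ι) := by
  set Q := Fintype.card F with hQ
  have hQ0 : (0 : ℝ) < Q := by exact_mod_cast Fintype.card_pos
  set bad := Finset.univ.filter fun H : Fin k → ι → F => ∃ M ∈ 𝓩, ∀ l, M *ᵥ H l = 0 with hbad
  have h1 : ∀ H ∈ bad, Q - 1 ≤ (𝓩.filter fun M => ∀ l, M *ᵥ H l = 0).card := by
    intro H hH
    obtain ⟨M, hM, hMH⟩ := (Finset.mem_filter.1 hH).2
    have hM0 : M ≠ 0 := by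
      rintro rfl
      exact (hli 0 hM).ne_zero ⟨0, ha⟩ rfl
    have h2 : ((Finset.univ.erase (0 : F)).image fun c => c • M) ⊆
        𝓩.filter fun M => ∀ l, M *ᵥ H l = 0 := by
      intro N hN
      obtain ⟨c, hc, rfl⟩ := Finset.mem_image.1 hN
      exact Finset.mem_filter.2 ⟨hsmul M hM c (Finset.ne_of_mem_erase hc),
        fun l => by rw [Matrix.smul_mulVec, hMH l, smul_zero]⟩
    have h3 := Finset.card_le_card h2
    rwa [Finset.card_image_of_injective _ (smul_left_injective F hM0),
      Finset.card_erase_of_mem (Finset.mem_univ _), Finset.card_univ] at h3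
  have h4 : bad.card * (Q - 1) ≤
      ∑ M ∈ 𝓩, (Finset.univ.filter fun H : Fin k → ι → F => ∀ l, M *ᵥ H l = 0).card := by
    calc bad.card * (Q - 1) ≤ ∑ H ∈ bad, (𝓩.filter fun M => ∀ l, M *ᵥ H l = 0).card := by
          rw [← smul_eq_mul]
          exact Finset.card_nsmul_le_sum _ _ _ h1
      _ ≤ ∑ H : Fin k → ι → F, (𝓩.filter fun M => ∀ l, M *ᵥ H l = 0).card :=
          Finset.sum_le_sum_of_subset (Finset.subset_univ _)
      _ = _ := by
          simp only [Finset.card_filter]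
          exact Finset.sum_comm
  have h5 : (∑ M ∈ 𝓩, (Finset.univ.filter fun H : Fin k → ι → F => ∀ l, M *ᵥ H l = 0).card) *
      Q ^ (a * k) = 𝓩.card * Q ^ (k * Fintype.card ι) := by
    rw [Finset.sum_mul, Finset.sum_congr rfl fun M hM => card_kills_mul_pow (hli M hM),
      Finset.sum_const, smul_eq_mul]
  have h6 : bad.card * (Q - 1) * Q ^ (a * k) ≤ 𝓩.card * Q ^ (k * Fintype.card ι) := by
    rw [← h5]; exact Nat.mul_le_mul_right _ h4
  have h7 : (bad.card : ℝ) * (Q - 1) * Q ^ (a * k) ≤ 𝓩.card * Q ^ (k * Fintype.card ι) := by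
    have hQ1 : 1 ≤ Q := Fintype.card_pos
    exact_mod_cast h6
  have h8 : (bad.card : ℝ) * (Q - 1) * Q ^ (a * k) ≤
      C * (Q : ℝ) ^ (k * Fintype.card ι) * Q ^ (a * k) := by
    refine h7.trans ?_
    calc (𝓩.card : ℝ) * Q ^ (k * Fintype.card ι) ≤ C * (Q : ℝ) ^ (a * k) * Q ^ (k * Fintype.card ι) := by
          gcongr
      _ = _ := by ring
  exact le_of_mul_le_mul_right h8 (by positivity)

/-- A parity check matrix over a large field that is generic for words and for pairs of words. -/
lemma exists_generic_matrix (k : ℕ)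
    (hF : (2 : ℝ) ^ Fintype.card ι + 5 ^ Fintype.card ι < Fintype.card F - 1) :
    ∃ H : Fin k → ι → F,
      (∀ z : ι → F, z ≠ 0 → (∀ l, z ⬝ᵥ H l = 0) →
        k < (Finset.univ.filter fun i => z i ≠ 0).card) ∧
      (∀ z z' : ι → F, LinearIndependent F ![z, z'] → (∀ l, z ⬝ᵥ H l = 0) →
        (∀ l, z' ⬝ᵥ H l = 0) → 2 * k < ∑ i, pairWeight (z i) (z' i)) := by
  classical
  set Q : ℝ := (Fintype.card F : ℝ) with hQ
  have hQ1 : 1 ≤ Q := by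
    rw [hQ]; exact_mod_cast Fintype.card_pos (α := F)
  let 𝓩₁ : Finset (Matrix (Fin 1) ι F) := Finset.univ.filter fun M =>
    LinearIndependent F M.row ∧ ∑ i, (if M 0 i = 0 then 0 else 1) ≤ k
  let 𝓩₂ : Finset (Matrix (Fin 2) ι F) := Finset.univ.filter fun M =>
    LinearIndependent F M.row ∧ ∑ i, pairWeight (M 0 i) (M 1 i) ≤ 2 * k
  have hli : ∀ {a : ℕ} {M : Matrix (Fin a) ι F} {c : F}, c ≠ 0 → LinearIndependent F M.row →
      LinearIndependent F (c • M).row := fun {a M c} hc hM => hM.units_smul fun _ => Units.mk0 c hc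
  have h1 := card_exists_kills_le (k := k) le_rfl 𝓩₁ (fun M hM => (Finset.mem_filter.1 hM).2.1)
    (fun M hM c hc => by
      obtain ⟨-, h1, h2⟩ := Finset.mem_filter.1 hM
      refine Finset.mem_filter.2 ⟨Finset.mem_univ _, hli hc h1, ?_⟩
      simpa [hc] using h2)
    (C := 2 ^ Fintype.card ι) (by
      rw [one_mul, ← hQ]
      refine le_trans ?_ (card_filter_sum_weight_le (ι := ι) (fun x : F => if x = 0 then 0 else 1)
        hQ1 sum_singleWeight_le k)
      exact_mod_cast Finset.card_le_card_of_injOn (fun (M : Matrix (Fin 1) ι F) i => M 0 i)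
        (fun M hM => by
          have := (Finset.mem_filter.1 hM).2.2
          simpa using this)
        (fun M _ N _ h => by
          ext a i
          rw [Subsingleton.elim a 0]
          exact congrFun h i))
  have h2 := card_exists_kills_le (k := k) (by norm_num) 𝓩₂
    (fun M hM => (Finset.mem_filter.1 hM).2.1)
    (fun M hM c hc => by
      obtain ⟨-, h1, h2⟩ := Finset.mem_filter.1 hM
      refine Finset.mem_filter.2 ⟨Finset.mem_univ _, hli hc h1, ?_⟩
      simpa [hc, pairWeight] using h2)
    (C := 5 ^ Fintype.card ι) (by
      rw [← hQ]
      refine le_trans ?_ (card_filter_sum_weight_le (ι := ι) (fun x : F × F => pairWeight x.1 x.2)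
        hQ1 sum_pairWeight_le (2 * k))
      exact_mod_cast Finset.card_le_card_of_injOn (fun (M : Matrix (Fin 2) ι F) i => (M 0 i, M 1 i))
        (fun M hM => by
          have := (Finset.mem_filter.1 hM).2.2
          simpa using this)
        (fun M _ N _ h => by
          ext a i
          have := congrFun h i
          simp only [Prod.mk.injEq] at this
          fin_cases a
          · exact this.1
          · exact this.2))
  rw [← hQ] at h1 h2
  set bad₁ := Finset.univ.filter fun H : Fin k → ι → F => ∃ M ∈ 𝓩₁, ∀ l, M *ᵥ H l = 0
  set bad₂ := Finset.univ.filter fun H : Fin k → ι → F => ∃ M ∈ 𝓩₂, ∀ l, M *ᵥ H l = 0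
  obtain ⟨H, hH⟩ : ∃ H, H ∉ bad₁ ∪ bad₂ := by
    by_contra! hall
    have h3 : bad₁ ∪ bad₂ = Finset.univ := Finset.eq_univ_iff_forall.2 hall
    have h4 := Finset.card_union_le bad₁ bad₂
    rw [h3, Finset.card_univ] at h4
    simp only [Fintype.card_fun, Fintype.card_fin, ← pow_mul] at h4
    have h5 : Q ^ (k * Fintype.card ι) ≤ bad₁.card + bad₂.card := by
      rw [hQ, mul_comm k]
      exact_mod_cast h4
    have h6 : 0 < Q ^ (k * Fintype.card ι) := by positivity
    have h7 : 0 < Q - 1 := lt_trans (by positivity) hF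
    have h8 := mul_le_mul_of_nonneg_right h5 h7.le
    have h9 := mul_lt_mul_of_pos_left hF h6
    linarith
  rw [Finset.mem_union, not_or] at hH
  refine ⟨H, fun z hz hker => ?_, fun z z' hzz hker hker' => ?_⟩
  · by_contra! hle
    refine hH.1 (Finset.mem_filter.2 ⟨Finset.mem_univ _, Matrix.of ![z], ?_, fun l => ?_⟩)
    · refine Finset.mem_filter.2 ⟨Finset.mem_univ _, ?_, ?_⟩
      · rw [show (Matrix.of ![z]).row = ![z] from rfl, linearIndependent_unique_iff]
        simpa using hz
      · rw [Finset.card_filter] at hle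
        simpa [ite_not] using hle
    · ext a
      simpa [Matrix.mulVec] using hker l
  · by_contra! hle
    refine hH.2 (Finset.mem_filter.2 ⟨Finset.mem_univ _, Matrix.of ![z, z'], ?_, fun l => ?_⟩)
    · exact Finset.mem_filter.2 ⟨Finset.mem_univ _, hzz, by simpa using hle⟩
    · ext a
      fin_cases a
      · simpa [Matrix.mulVec] using hker l
      · simpa [Matrix.mulVec] using hker' l

end generic

end ListDecoding

/-! ### Generic integer matrices and forced relations. -/

namespace ListDecoding

open Matrix

section pairWeight

variable {R : Type*} [Zero R] [DecidableEq R]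

lemma pairWeight_le_of_imp {S : Type*} [Zero S] [DecidableEq S] {x y : R} {x' y' : S}
    (h1 : x = 0 → x' = 0) (h2 : y = 0 → y' = 0) (h3 : x = y → x' = y') :
    pairWeight x' y' ≤ pairWeight x y := by
  unfold pairWeight
  split_ifs <;> first | omega | (exfalso; tauto)

variable {ι : Type*} [Fintype ι] (z z' : ι → R)

lemma card_add_card_eq_sum_pairWeight_left :
    (Finset.univ.filter fun i => z i ≠ 0 ∧ z i ≠ z' i).card +
      (Finset.univ.filter fun i => z' i ≠ 0).card = ∑ i, pairWeight (z i) (z' i) := by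
  rw [Finset.card_filter, Finset.card_filter, ← Finset.sum_add_distrib]
  refine Finset.sum_congr rfl fun i _ => ?_
  unfold pairWeight
  split_ifs <;> first | rfl | (exfalso; simp_all)

lemma card_add_card_eq_sum_pairWeight_right :
    (Finset.univ.filter fun i => z' i ≠ 0 ∧ z i ≠ z' i).card +
      (Finset.univ.filter fun i => z i ≠ 0).card = ∑ i, pairWeight (z i) (z' i) := by
  rw [Finset.card_filter, Finset.card_filter, ← Finset.sum_add_distrib]
  refine Finset.sum_congr rfl fun i _ => ?_
  unfold pairWeight
  split_ifs <;> first | rfl | (exfalso; simp_all)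

lemma card_add_card_eq_sum_pairWeight_diag :
    (Finset.univ.filter fun i => z i ≠ 0 ∧ z' i ≠ 0).card +
      (Finset.univ.filter fun i => z i ≠ z' i).card = ∑ i, pairWeight (z i) (z' i) := by
  rw [Finset.card_filter, Finset.card_filter, ← Finset.sum_add_distrib]
  refine Finset.sum_congr rfl fun i _ => ?_
  unfold pairWeight
  split_ifs <;> first | rfl | (exfalso; simp_all)

end pairWeight

/-- The integer matrix `H` is generic for words and for pairs of words. -/
structure IsGeneric {ι : Type*} [Fintype ι] {k : ℕ} (H : Fin k → ι → ℤ) : Prop where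
  single : ∀ z : ι → ℤ, z ≠ 0 → (∀ l, z ⬝ᵥ H l = 0) →
    k < (Finset.univ.filter fun i => z i ≠ 0).card
  pair : ∀ z z' : ι → ℤ, (∀ l, z ⬝ᵥ H l = 0) → (∀ l, z' ⬝ᵥ H l = 0) →
    ∑ i, pairWeight (z i) (z' i) ≤ 2 * k → z = 0 ∨ z' = 0 ∨ z = z'

/-- Dividing by the content keeps kernel relations and coincidences but prevents the vector from
vanishing mod p. -/
lemma exists_smul_not_forall_dvd {κ : Type*} [Fintype κ] {v : κ → ℤ} (hv : v ≠ 0) {p : ℕ}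
    (hp : p.Prime) : ∃ (g : ℤ) (y : κ → ℤ), g ≠ 0 ∧ v = g • y ∧ ∃ i, ¬ (p : ℤ) ∣ y i := by
  obtain ⟨i, hi⟩ := Function.ne_iff.1 hv
  obtain ⟨y, hy, hgcd⟩ := Finset.extract_gcd v (s := Finset.univ) ⟨i, Finset.mem_univ i⟩
  refine ⟨Finset.univ.gcd v, y, fun h0 => hi ?_, funext fun j => hy j (Finset.mem_univ j), ?_⟩
  · rw [hy i (Finset.mem_univ i), h0, zero_mul]; rfl
  · by_contra! hall
    have h1 : (p : ℤ) ∣ Finset.univ.gcd y := Finset.dvd_gcd fun j _ => hall j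
    rw [hgcd] at h1
    exact (Nat.prime_iff_prime_int.1 hp).not_isUnit (isUnit_of_dvd_one h1)

section generic

variable {ι : Type*} [Fintype ι]

lemma dotProduct_cast_eq_zero {p : ℕ} {y h : ι → ℤ} {h' : ι → ZMod p}
    (hh : ∀ i, (h i : ZMod p) = h' i) (hy : y ⬝ᵥ h = 0) : (fun i => (y i : ZMod p)) ⬝ᵥ h' = 0 := by
  have := congrArg (Int.cast : ℤ → ZMod p) hy
  simp only [dotProduct, Int.cast_sum, Int.cast_mul, Int.cast_zero, hh] at this
  exact this

lemma dotProduct_eq_zero_of_smul {g : ℤ} (hg : g ≠ 0) {y h : ι → ℤ} (hy : (g • y) ⬝ᵥ h = 0) :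
    y ⬝ᵥ h = 0 := by
  rw [smul_dotProduct, smul_eq_mul] at hy
  exact (mul_eq_zero.1 hy).resolve_left hg

/-- Lift a generic matrix modulo a large prime. Reduction creates zeros and equalities but never
destroys them, so weights do not grow. An integral lift makes the relations found later independent
of q. -/
lemma exists_isGeneric [DecidableEq ι] (k : ℕ) : ∃ H : Fin k → ι → ℤ, IsGeneric H := by
  obtain ⟨p, hpge, hp⟩ := Nat.exists_infinite_primes (2 ^ Fintype.card ι + 5 ^ Fintype.card ι + 2)
  have : Fact p.Prime := ⟨hp⟩
  obtain ⟨H', hH1, hH2⟩ := exists_generic_matrix (F := ZMod p) (ι := ι) k (by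
    rw [ZMod.card]
    have : ((2 ^ Fintype.card ι + 5 ^ Fintype.card ι + 2 : ℕ) : ℝ) ≤ p := by exact_mod_cast hpge
    push_cast at this
    linarith)
  have hcast : ∀ l i, (((H' l i).val : ℤ) : ZMod p) = H' l i := fun l i => by simp
  have single : ∀ z : ι → ℤ, z ≠ 0 → (∀ l, z ⬝ᵥ (fun i => ((H' l i).val : ℤ)) = 0) →
      k < (Finset.univ.filter fun i => z i ≠ 0).card := by
    intro z hz hker
    obtain ⟨g, y, hg, rfl, i, hi⟩ := exists_smul_not_forall_dvd hz hp
    refine (hH1 (fun i => (y i : ZMod p)) (fun h0 => hi ?_) fun l =>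
      dotProduct_cast_eq_zero (hcast l) (dotProduct_eq_zero_of_smul hg (hker l))).trans_le
      (Finset.card_le_card fun j hj => ?_)
    · rw [← ZMod.intCast_zmod_eq_zero_iff_dvd]
      exact congrFun h0 i
    · simp only [Finset.mem_filter, Finset.mem_univ, true_and, Pi.smul_apply, smul_eq_mul] at hj ⊢
      refine mul_ne_zero hg fun h0 => hj ?_
      rw [h0, Int.cast_zero]
  refine ⟨fun l i => ((H' l i).val : ℤ), single, fun z z' hker hker' hwt => ?_⟩
  by_contra! hne
  obtain ⟨hz, hz', hzz⟩ := hne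
  -- The three bounds subtract a kernel word, of weight above k, from a total of at most 2k. They
  -- handle the ways in which the reduced pair may be dependent: one member zero, or the two
  -- proportional.
  have hA : (Finset.univ.filter fun i => z i ≠ 0 ∧ z i ≠ z' i).card ≤ k := by
    have h1 := card_add_card_eq_sum_pairWeight_left z z'
    have h2 := single z' hz' hker'
    omega
  have hB : (Finset.univ.filter fun i => z' i ≠ 0 ∧ z i ≠ z' i).card ≤ k := by
    have h1 := card_add_card_eq_sum_pairWeight_right z z'
    have h2 := single z hz hker
    omega
  have hC : (Finset.univ.filter fun i => z i ≠ 0 ∧ z' i ≠ 0).card ≤ k := by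
    have h1 := card_add_card_eq_sum_pairWeight_diag z z'
    have h2 := single (z - z') (sub_ne_zero.2 hzz) fun l => by
      rw [sub_dotProduct, hker l, hker' l, sub_zero]
    simp only [Pi.sub_apply, sub_ne_zero] at h2
    omega
  obtain ⟨g, v, hg, hv, i₀, hi₀⟩ := exists_smul_not_forall_dvd (v := Sum.elim z z')
    (fun h0 => hz (funext fun i => congrFun h0 (Sum.inl i))) hp
  set y : ι → ℤ := fun i => v (Sum.inl i) with hy
  set y' : ι → ℤ := fun i => v (Sum.inr i) with hy'
  obtain rfl : z = g • y := funext fun i => congrFun hv (Sum.inl i)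
  obtain rfl : z' = g • y' := funext fun i => congrFun hv (Sum.inr i)
  simp only [Pi.smul_apply, smul_eq_mul, ne_eq, mul_eq_zero, hg, false_or,
    mul_right_inj' hg] at hA hB hC
  have hwt' : ∑ i, pairWeight (y i : ZMod p) (y' i : ZMod p) ≤ 2 * k := by
    refine le_trans (Finset.sum_le_sum fun i _ => ?_) hwt
    simp only [Pi.smul_apply, smul_eq_mul]
    refine pairWeight_le_of_imp (fun h => ?_) (fun h => ?_) fun h => ?_
    · rw [(mul_eq_zero.1 h).resolve_left hg, Int.cast_zero]
    · rw [(mul_eq_zero.1 h).resolve_left hg, Int.cast_zero]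
    · rw [mul_left_cancel₀ hg h]
  have hky : ∀ l, (fun i => (y i : ZMod p)) ⬝ᵥ H' l = 0 := fun l =>
    dotProduct_cast_eq_zero (hcast l) (dotProduct_eq_zero_of_smul hg (hker l))
  have hky' : ∀ l, (fun i => (y' i : ZMod p)) ⬝ᵥ H' l = 0 := fun l =>
    dotProduct_cast_eq_zero (hcast l) (dotProduct_eq_zero_of_smul hg (hker' l))
  have hsmall : ∀ (u : ι → ZMod p) (P : ι → Prop) [DecidablePred P], (∀ l, u ⬝ᵥ H' l = 0) →
      (Finset.univ.filter P).card ≤ k → (∀ i, u i ≠ 0 → P i) → u = 0 := by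
    intro u P _ hu hP huP
    by_contra hu0
    have h1 := hH1 u hu0 hu
    have h2 := Finset.card_le_card (Finset.monotone_filter_right Finset.univ
      (fun i _ hi => huP i hi : ∀ i ∈ Finset.univ, u i ≠ 0 → P i))
    omega
  have hnot : ∀ {a : ℤ}, (a : ZMod p) ≠ 0 → a ≠ 0 := by
    rintro a ha rfl
    exact ha Int.cast_zero
  by_cases h0 : (fun i => (y i : ZMod p)) = 0
  · have h1 := hsmall _ (fun i => ¬ y' i = 0 ∧ ¬ y i = y' i) hky' hB fun i hi => ⟨hnot hi, fun h => by
      have := congrFun h0 i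
      simp only [h] at this
      exact hi this⟩
    apply hi₀
    rw [← ZMod.intCast_zmod_eq_zero_iff_dvd]
    rcases i₀ with i | i
    · exact congrFun h0 i
    · exact congrFun h1 i
  by_cases h0' : (fun i => (y' i : ZMod p)) = 0
  · exact h0 (hsmall _ (fun i => ¬ y i = 0 ∧ ¬ y i = y' i) hky hA fun i hi => ⟨hnot hi, fun h => by
      have := congrFun h0' i
      simp only [← h] at this
      exact hi this⟩)
  by_cases hind : LinearIndependent (ZMod p) ![fun i => (y i : ZMod p), fun i => (y' i : ZMod p)]
  · exact absurd (hH2 _ _ hind hky hky') (not_lt.2 hwt')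
  rw [LinearIndependent.pair_iff] at hind
  push Not at hind
  obtain ⟨s, t, hst, hne⟩ := hind
  have hpt : ∀ i, s * (y i : ZMod p) + t * (y' i : ZMod p) = 0 := fun i => congrFun hst i
  have hs : s ≠ 0 := by
    rintro rfl
    refine h0' (funext fun i => ?_)
    have := hpt i
    rw [zero_mul, zero_add] at this
    exact (mul_eq_zero.1 this).resolve_left (hne rfl)
  have ht : t ≠ 0 := by
    rintro rfl
    refine h0 (funext fun i => ?_)
    have := hpt i
    rw [zero_mul, add_zero] at this
    exact (mul_eq_zero.1 this).resolve_left hs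
  refine h0 (hsmall _ (fun i => ¬ y i = 0 ∧ ¬ y' i = 0) hky hC fun i hi => ⟨hnot hi, fun h => ?_⟩)
  have := hpt i
  rw [h, Int.cast_zero, mul_zero, add_zero] at this
  exact (mul_eq_zero.1 this).elim hs hi

/-- The relation between the two extra coordinates of pairs of kernel vectors that have a given
pattern and the least weight that is not excluded by genericity. -/
lemma IsGeneric.exists_relation {k : ℕ} {H : Fin k → Option ι → ℤ} (hH : IsGeneric H)
    (τ : ι → Prop × Prop × Prop) : ∃ α β : ℤ, α ≠ 0 ∧ β ≠ 0 ∧ α + β ≠ 0 ∧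
      ∀ z z' : Option ι → ℤ, (∀ l, z ⬝ᵥ H l = 0) → (∀ l, z' ⬝ᵥ H l = 0) → z ≠ 0 → z' ≠ 0 → z ≠ z' →
        ∑ i, pairWeight (z (some i)) (z' (some i)) + 1 ≤ 2 * k →
        (∀ i, τ i = (z (some i) = 0, z' (some i) = 0, z (some i) = z' (some i))) →
        α * z none + β * z' none = 0 := by
  classical
  by_cases hex : ∃ z z' : Option ι → ℤ, (∀ l, z ⬝ᵥ H l = 0) ∧ (∀ l, z' ⬝ᵥ H l = 0) ∧ z ≠ 0 ∧
      z' ≠ 0 ∧ z ≠ z' ∧ ∑ i, pairWeight (z (some i)) (z' (some i)) + 1 ≤ 2 * k ∧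
      (∀ i, τ i = (z (some i) = 0, z' (some i) = 0, z (some i) = z' (some i))) ∧
      (z none ≠ 0 ∨ z' none ≠ 0)
  swap
  -- Every admissible pair then vanishes at the extra coordinate, so any coefficients do.
  · refine ⟨1, 1, one_ne_zero, one_ne_zero, by norm_num, fun z z' h1 h2 h3 h4 h5 h6 h7 => ?_⟩
    by_contra hne
    refine hex ⟨z, z', h1, h2, h3, h4, h5, h6, h7, ?_⟩
    by_contra! h0
    rw [h0.1, h0.2] at hne
    exact hne rfl
  obtain ⟨z, z', hker, hker', hz, hz', hzz, hwt, hτ, -⟩ := hex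
  have hbig : 2 ≤ pairWeight (z none) (z' none) := by
    by_contra! hlt
    have h1 := hH.pair z z' hker hker' (by rw [Fintype.sum_option]; omega)
    tauto
  obtain ⟨hz0, hz0', hzz0⟩ : z none ≠ 0 ∧ z' none ≠ 0 ∧ z none ≠ z' none := by
    unfold pairWeight at hbig
    split_ifs at hbig <;> omega
  -- One pair dictates the relation; all other pairs of the same pattern must have proportional
  -- extra coordinates.
  refine ⟨z' none, -z none, hz0', neg_ne_zero.2 hz0, fun h => hzz0 (by linarith), ?_⟩
  intro y y' hky hky' hy hy' hyy hywt hyτ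
  by_contra hρ
  have himp : ∀ i, (z (some i) = 0 → y (some i) = 0) ∧ (z' (some i) = 0 → y' (some i) = 0) ∧
      (z (some i) = z' (some i) → y (some i) = y' (some i)) := by
    intro i
    have h1 := (hτ i).symm.trans (hyτ i)
    simp only [Prod.mk.injEq, eq_iff_iff] at h1
    exact ⟨h1.1.1, h1.2.1.1, h1.2.2.1⟩
  -- This combination keeps the zeros and equalities of the pattern and kills the extra coordinate
  -- of x'.
  set x : Option ι → ℤ := z' none • y - y' none • z with hx
  set x' : Option ι → ℤ := z' none • y' - y' none • z' with hx'
  have hximp : ∀ i, (z (some i) = 0 → x (some i) = 0) ∧ (z' (some i) = 0 → x' (some i) = 0) ∧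
      (z (some i) = z' (some i) → x (some i) = x' (some i)) := by
    intro i
    obtain ⟨h1, h2, h3⟩ := himp i
    refine ⟨fun h => ?_, fun h => ?_, fun h => ?_⟩
    · simp [hx, h, h1 h]
    · simp [hx', h, h2 h]
    · simp [hx, hx', h, h3 h]
  have hx0 : x none ≠ 0 := by
    simp only [hx, Pi.sub_apply, Pi.smul_apply, smul_eq_mul]
    intro h
    exact hρ (by linarith)
  have hx0' : x' none = 0 := by
    simp only [hx', Pi.sub_apply, Pi.smul_apply, smul_eq_mul]
    ring
  have hkx : ∀ l, x ⬝ᵥ H l = 0 := fun l => by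
    rw [hx, sub_dotProduct, smul_dotProduct, smul_dotProduct, hky l, hker l, smul_zero, smul_zero,
      sub_zero]
  have hkx' : ∀ l, x' ⬝ᵥ H l = 0 := fun l => by
    rw [hx', sub_dotProduct, smul_dotProduct, smul_dotProduct, hky' l, hker' l, smul_zero,
      smul_zero, sub_zero]
  have hxwt : ∑ i, pairWeight (x (some i)) (x' (some i)) ≤
      ∑ i, pairWeight (z (some i)) (z' (some i)) := Finset.sum_le_sum fun i _ =>
    pairWeight_le_of_imp (hximp i).1 (hximp i).2.1 (hximp i).2.2
  have hx'0 : x' = 0 := by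
    have h1 : pairWeight (x none) (x' none) ≤ 1 := by simp [pairWeight, hx0']; split_ifs <;> simp
    rcases hH.pair x x' hkx hkx' (by rw [Fintype.sum_option]; omega) with h | h | h
    · exact absurd (congrFun h none) hx0
    · exact h
    · exact absurd ((congrFun h none).trans hx0') hx0
  -- As x' = 0, x lives on ordinary positions with z ≠ 0 and z ≠ z', and on the extra one. Both x
  -- and z' have at least k ordinary nonzero positions, against a total weight of at most 2k - 1.
  have hcount := card_add_card_eq_sum_pairWeight_left (fun i => z (some i)) (fun i => z' (some i))
  have h1 := hH.single x (fun h => hx0 (congrFun h none)) hkx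
  have h2 := hH.single z' hz' hker'
  rw [Finset.card_filter, Fintype.sum_option, ← Finset.card_filter] at h1 h2
  have h3 : (Finset.univ.filter fun i => x (some i) ≠ 0).card ≤
      (Finset.univ.filter fun i => z (some i) ≠ 0 ∧ z (some i) ≠ z' (some i)).card := by
    refine Finset.card_le_card fun i hi => ?_
    simp only [Finset.mem_filter, Finset.mem_univ, true_and] at hi ⊢
    refine ⟨fun h => hi ((hximp i).1 h), fun h => hi ?_⟩
    rw [(hximp i).2.2 h, hx'0]
    rfl
  split_ifs at h1 h2
  omega

end generic

end ListDecoding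

/-! ### Behrend sets for bounded three-term relations. -/

namespace ListDecoding

section digits

variable {d : ℕ}

lemma eq_zero_of_sum_mul_pow_eq_zero {B : ℕ} {y : Fin d → ℤ} (hy : ∀ j, |y j| < B)
    (h : ∑ j, y j * (B : ℤ) ^ (j : ℕ) = 0) : y = 0 := by
  induction d with
  | zero => exact Subsingleton.elim _ _
  | succ d ih =>
    have hsum : ∑ j, y j * (B : ℤ) ^ (j : ℕ) =
        y 0 + B * ∑ j : Fin d, y j.succ * (B : ℤ) ^ (j : ℕ) := by
      rw [Fin.sum_univ_succ, Finset.mul_sum]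
      simp only [Fin.val_zero, pow_zero, mul_one, Fin.val_succ, pow_succ]
      congr 1
      exact Finset.sum_congr rfl fun j _ => by ring
    rw [hsum] at h
    have h0 : y 0 = 0 :=
      Int.eq_zero_of_abs_lt_dvd ⟨-∑ j : Fin d, y j.succ * (B : ℤ) ^ (j : ℕ), by linarith⟩ (hy 0)
    have hB : (B : ℤ) ≠ 0 := ((abs_nonneg _).trans_lt (hy 0)).ne'
    rw [h0, zero_add, mul_eq_zero, or_iff_right hB] at h
    funext j
    exact Fin.cases h0 (fun j => congrFun (ih (fun j => hy j.succ) h) j) j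

lemma behrendMap_lt_pow {B : ℕ} {x : Fin d → ℕ} (hx : ∀ j, x j < B) : Behrend.map B x < B ^ d := by
  induction d with
  | zero => simp
  | succ d ih =>
    rw [Behrend.map_succ']
    have h1 := ih (x := x ∘ Fin.succ) fun j => hx j.succ
    have h2 := hx 0
    calc _ < B + Behrend.map B (x ∘ Fin.succ) * B := by omega
      _ = (Behrend.map B (x ∘ Fin.succ) + 1) * B := by ring
      _ ≤ B ^ d * B := Nat.mul_le_mul_right _ h1
      _ = _ := (pow_succ _ _).symm

/-- Points of a sphere satisfy no nontrivial affine relation between three points. -/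
lemma eq_of_mem_sphere_of_relation {s R : ℕ} {x₁ x₂ x₃ : Fin d → ℕ}
    (h₁ : x₁ ∈ Behrend.sphere d s R) (h₂ : x₂ ∈ Behrend.sphere d s R)
    (h₃ : x₃ ∈ Behrend.sphere d s R) {a b : ℤ} (ha : a ≠ 0) (hb : b ≠ 0) (hab : a + b ≠ 0)
    (h : ∀ j, a * ((x₁ j : ℤ) - x₂ j) + b * ((x₁ j : ℤ) - x₃ j) = 0) : x₁ = x₂ ∧ x₁ = x₃ := by
  have hnorm : ∀ {x : Fin d → ℕ}, x ∈ Behrend.sphere d s R → ∑ j, (x j : ℤ) ^ 2 = R := by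
    intro x hx
    exact_mod_cast (Finset.mem_filter.1 hx).2
  -- With x₁ an affine combination of x₂ and x₃ and all norms equal, ab|x₂ - x₃|² vanishes: a line
  -- meets a sphere at most twice.
  have key : a * b * ∑ j, ((x₂ j : ℤ) - x₃ j) ^ 2 = 0 := by
    have h4 : ∀ j, a * b * ((x₂ j : ℤ) - x₃ j) ^ 2 =
        (a + b) * (a * (x₂ j : ℤ) ^ 2 + b * (x₃ j : ℤ) ^ 2 - (a + b) * (x₁ j : ℤ) ^ 2) := by
      intro j
      have h5 : (a + b) * (x₁ j : ℤ) = a * x₂ j + b * x₃ j := by linarith [h j]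
      have h6 : (a + b) * ((a + b) * (x₁ j : ℤ) ^ 2) = (a * x₂ j + b * x₃ j) ^ 2 := by
        rw [← h5]; ring
      rw [mul_sub, h6]
      ring
    rw [Finset.mul_sum, Finset.sum_congr rfl fun j _ => h4 j, ← Finset.mul_sum,
      Finset.sum_sub_distrib, Finset.sum_add_distrib, ← Finset.mul_sum, ← Finset.mul_sum,
      ← Finset.mul_sum, hnorm h₁, hnorm h₂, hnorm h₃]
    ring
  have h23 : ∀ j, (x₂ j : ℤ) = x₃ j := by
    have h4 := (mul_eq_zero.1 key).resolve_left (mul_ne_zero ha hb)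
    rw [Finset.sum_eq_zero_iff_of_nonneg fun j _ => sq_nonneg _] at h4
    exact fun j => sub_eq_zero.1 (pow_eq_zero_iff two_ne_zero |>.1 (h4 j (Finset.mem_univ j)))
  have h12 : ∀ j, (x₁ j : ℤ) = x₂ j := by
    intro j
    have h4 := h j
    rw [← h23 j, ← add_mul] at h4
    exact sub_eq_zero.1 ((mul_eq_zero.1 h4).resolve_left hab)
  exact ⟨funext fun j => by exact_mod_cast h12 j,
    funext fun j => by exact_mod_cast (h12 j).trans (h23 j)⟩

/-- Points of a sphere are read as digits to base (4M + 1)s. The digits of a relation are at most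
2Ms in absolute value, so nothing carries and the relation holds digit by digit. -/
lemma exists_large_set_without_relations (d s M : ℕ) (hs : 1 ≤ s) :
    ∃ T : Finset ℕ, (∀ t ∈ T, t < ((4 * M + 1) * s) ^ d) ∧
      ((s : ℝ) ^ d / (d * (s : ℝ) ^ 2)) ≤ T.card ∧
      ∀ a b : ℤ, a ≠ 0 → b ≠ 0 → a + b ≠ 0 → |a| ≤ M → |b| ≤ M → ∀ t₁ ∈ T, ∀ t₂ ∈ T, ∀ t₃ ∈ T,
        a * ((t₁ : ℤ) - t₂) + b * ((t₁ : ℤ) - t₃) = 0 → t₁ = t₂ ∧ t₁ = t₃ := by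
  obtain ⟨R, hR⟩ := Behrend.exists_large_sphere d s
  set B := (4 * M + 1) * s with hB
  have hlt : ∀ x ∈ Behrend.sphere d s R, ∀ j, x j < s := fun x hx =>
    Behrend.mem_box.1 (Behrend.sphere_subset_box hx)
  have hsB : s ≤ B := Nat.le_mul_of_pos_left _ (by omega)
  refine ⟨(Behrend.sphere d s R).image (Behrend.map B), ?_, ?_, ?_⟩
  · intro t ht
    obtain ⟨x, hx, rfl⟩ := Finset.mem_image.1 ht
    exact behrendMap_lt_pow fun j => (hlt x hx j).trans_le hsB
  · rw [Finset.card_image_of_injOn]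
    · exact_mod_cast hR
    · exact Behrend.map_injOn.mono fun x hx j => (hlt x hx j).trans_le hsB
  · intro a b ha hb hab haM hbM t₁ ht₁ t₂ ht₂ t₃ ht₃ h
    obtain ⟨x₁, hx₁, rfl⟩ := Finset.mem_image.1 ht₁
    obtain ⟨x₂, hx₂, rfl⟩ := Finset.mem_image.1 ht₂
    obtain ⟨x₃, hx₃, rfl⟩ := Finset.mem_image.1 ht₃
    have hy := eq_zero_of_sum_mul_pow_eq_zero (B := B)
      (y := fun j => a * ((x₁ j : ℤ) - x₂ j) + b * ((x₁ j : ℤ) - x₃ j)) (fun j => ?_) (by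
        rw [← h]
        simp only [Behrend.map_apply, Nat.cast_sum, Nat.cast_mul, Nat.cast_pow,
          ← Finset.sum_sub_distrib, Finset.mul_sum, ← Finset.sum_add_distrib]
        exact Finset.sum_congr rfl fun j _ => by ring)
    · obtain ⟨rfl, rfl⟩ := eq_of_mem_sphere_of_relation hx₁ hx₂ hx₃ ha hb hab (congrFun hy)
      exact ⟨rfl, rfl⟩
    · have hd : ∀ x ∈ Behrend.sphere d s R, ∀ x' ∈ Behrend.sphere d s R,
          |(x j : ℤ) - x' j| ≤ s := fun x hx x' hx' => by
        have := hlt x hx j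
        have := hlt x' hx' j
        rw [abs_le]
        omega
      calc _ ≤ |a| * |(x₁ j : ℤ) - x₂ j| + |b| * |(x₁ j : ℤ) - x₃ j| := by
            rw [← abs_mul, ← abs_mul]
            exact abs_add_le _ _
        _ ≤ M * s + M * s := by
            gcongr
            · exact hd _ hx₁ _ hx₂
            · exact hd _ hx₁ _ hx₃
        _ < B := by
            rw [hB]
            push_cast
            have : (1 : ℤ) ≤ s := by exact_mod_cast hs
            nlinarith [show (0 : ℤ) ≤ M * s by positivity]

end digits

open Filter in
/-- Dense sets of integers without nontrivial solutions of translation invariant equations in three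
variables whose coefficients are bounded by `M`. -/
lemma eventually_exists_set_without_relations (M : ℕ) {ε : ℝ} (hε : 0 < ε) :
    ∀ᶠ q : ℕ in atTop, ∃ T : Finset ℕ, (∀ t ∈ T, t < q) ∧ (q : ℝ) ^ (1 - ε) ≤ T.card ∧
      ∀ a b : ℤ, a ≠ 0 → b ≠ 0 → a + b ≠ 0 → |a| ≤ M → |b| ≤ M → ∀ t₁ ∈ T, ∀ t₂ ∈ T, ∀ t₃ ∈ T,
        a * ((t₁ : ℤ) - t₂) + b * ((t₁ : ℤ) - t₃) = 0 → t₁ = t₂ ∧ t₁ = t₃ := by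
  obtain ⟨e, he⟩ := exists_nat_gt (2 / ε)
  -- The sphere loses a factor s², that is q^(2/d) up to constants, so 2/d < ε is needed.
  set d := e + 2 with hd
  have hd0 : (0 : ℝ) < d := by positivity
  have h2d : 2 / (d : ℝ) < ε := by
    rw [div_lt_iff₀ hd0]
    rw [div_lt_iff₀ hε] at he
    rw [hd]
    push_cast
    nlinarith
  set Q : ℝ := 4 * M + 1 with hQ
  have hQ1 : 1 ≤ Q := by rw [hQ]; linarith [(Nat.cast_nonneg M : (0 : ℝ) ≤ M)]
  have hu : Tendsto (fun q : ℕ => (q : ℝ) ^ (1 / (d : ℝ))) atTop atTop :=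
    (tendsto_rpow_atTop (by positivity)).comp tendsto_natCast_atTop_atTop
  have hv : Tendsto (fun q : ℕ => (q : ℝ) ^ (ε - 2 / d)) atTop atTop :=
    (tendsto_rpow_atTop (by linarith)).comp tendsto_natCast_atTop_atTop
  filter_upwards [hu.eventually_ge_atTop (2 * Q), hv.eventually_ge_atTop ((2 * Q) ^ e * d),
    eventually_gt_atTop 0] with q hq1 hq2 hq0
  have hqR : (0 : ℝ) < q := by exact_mod_cast hq0
  set u : ℝ := (q : ℝ) ^ (1 / (d : ℝ)) with hu_def
  have hud : u ^ d = q := by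
    rw [hu_def, ← Real.rpow_natCast, ← Real.rpow_mul hqR.le, one_div,
      inv_mul_cancel₀ hd0.ne', Real.rpow_one]
  set s := ⌊u / Q⌋₊ with hs_def
  have hs_le : (s : ℝ) ≤ u / Q := Nat.floor_le (by positivity)
  have h2 : 2 ≤ u / Q := by rw [le_div_iff₀ (by positivity)]; exact hq1
  have hs_ge : u / (2 * Q) ≤ s := by
    have h1 := Nat.lt_floor_add_one (u / Q)
    have h3 : u / (2 * Q) = u / Q / 2 := by rw [div_div, mul_comm]
    rw [h3]
    rw [← hs_def] at h1
    linarith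
  have hs1 : 1 ≤ s := Nat.le_floor (by push_cast; linarith)
  obtain ⟨T, hT1, hT2, hT3⟩ := exists_large_set_without_relations d s M hs1
  refine ⟨T, fun t ht => (hT1 t ht).trans_le ?_, le_trans ?_ hT2, hT3⟩
  · have : (((4 * M + 1) * s : ℕ) : ℝ) ^ d ≤ q := by
      rw [← hud]
      gcongr
      push_cast
      rw [← hQ, mul_comm]
      exact (le_div_iff₀ (by positivity)).1 hs_le
    exact_mod_cast this
  · have hsR : (0 : ℝ) < s := by exact_mod_cast hs1
    have h3 : (s : ℝ) ^ d / (d * (s : ℝ) ^ 2) = (s : ℝ) ^ e / d := by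
      rw [hd, pow_add]
      field_simp
    rw [h3, le_div_iff₀ hd0]
    have h4 : (q : ℝ) ^ (1 - ε) * (q : ℝ) ^ (ε - 2 / d) = u ^ e := by
      rw [← Real.rpow_add hqR, hu_def, ← Real.rpow_natCast _ e, ← Real.rpow_mul hqR.le]
      congr 1
      have : (e : ℝ) = d - 2 := by rw [hd]; push_cast; ring
      rw [this]
      field_simp
      ring
    have h5 : (u / (2 * Q)) ^ e ≤ (s : ℝ) ^ e := by gcongr
    refine le_trans ?_ h5
    rw [div_pow, le_div_iff₀ (by positivity), ← h4, mul_assoc, mul_comm (d : ℝ)]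
    gcongr

end ListDecoding

/-! ### Codes of list size two and odd radius. -/

namespace ListDecoding

open Matrix Filter

section extension

variable {n q : ℕ}

/-- The integer vector with coordinates `x i`, extended by the coordinate `t`. -/
def extendWord (x : Fin n → Fin q) (t : ℕ) : Option (Fin n) → ℤ :=
  fun o => o.elim (t : ℤ) fun i => ((x i : ℕ) : ℤ)

@[simp] lemma extendWord_none (x : Fin n → Fin q) (t : ℕ) : extendWord x t none = t := rfl

@[simp] lemma extendWord_some (x : Fin n → Fin q) (t : ℕ) (i : Fin n) :
    extendWord x t (some i) = ((x i : ℕ) : ℤ) := rfl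

lemma coverage_triple (x₁ x₂ x₃ : Fin n → Fin q) (t₁ t₂ t₃ : ℕ) :
    coverage {x₁, x₂, x₃} = n + ∑ i : Fin n,
      pairWeight ((extendWord x₁ t₁ - extendWord x₂ t₂) (some i))
        ((extendWord x₁ t₁ - extendWord x₃ t₃) (some i)) := by
  have h : ∀ i, (({x₁, x₂, x₃} : Finset (Fin n → Fin q)).image fun c => c i).card =
      1 + pairWeight ((extendWord x₁ t₁ - extendWord x₂ t₂) (some i))
        ((extendWord x₁ t₁ - extendWord x₃ t₃) (some i)) := by
    intro i
    simp only [Finset.image_insert, Finset.image_singleton, pairWeight, Pi.sub_apply,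
      extendWord_some, sub_eq_zero, sub_right_inj, Nat.cast_inj, Fin.val_inj]
    by_cases h12 : x₁ i = x₂ i <;> by_cases h13 : x₁ i = x₃ i <;> by_cases h23 : x₂ i = x₃ i <;>
      simp_all
  unfold coverage
  rw [Finset.sum_congr rfl fun i _ => h i, Finset.sum_add_distrib]
  simp

/-- The differences within a triple of small coverage have ordinary weight at most 3m = 2k - 1, so
their extra coordinates satisfy the relation of their pattern. As T admits only trivial solutions,
the extra weight is 0, which `IsGeneric.pair` excludes. -/
lemma IsGeneric.lt_coverage {k m : ℕ} (hk : 2 * k = 3 * m + 1) {H : Fin k → Option (Fin n) → ℤ}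
    (hH : IsGeneric H) {α β : (Fin n → Prop × Prop × Prop) → ℤ} (hα : ∀ τ, α τ ≠ 0)
    (hβ : ∀ τ, β τ ≠ 0) (hαβ : ∀ τ, α τ + β τ ≠ 0)
    (hrel : ∀ τ, ∀ z z' : Option (Fin n) → ℤ, (∀ l, z ⬝ᵥ H l = 0) → (∀ l, z' ⬝ᵥ H l = 0) →
      z ≠ 0 → z' ≠ 0 → z ≠ z' →
        ∑ i, pairWeight (z (some i)) (z' (some i)) + 1 ≤ 2 * k →
        (∀ i, τ i = (z (some i) = 0, z' (some i) = 0, z (some i) = z' (some i))) →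
        α τ * z none + β τ * z' none = 0)
    {M : ℕ} (hαM : ∀ τ, |α τ| ≤ M) (hβM : ∀ τ, |β τ| ≤ M) {T : Finset ℕ}
    (hT : ∀ a b : ℤ, a ≠ 0 → b ≠ 0 → a + b ≠ 0 → |a| ≤ M → |b| ≤ M →
      ∀ t₁ ∈ T, ∀ t₂ ∈ T, ∀ t₃ ∈ T,
        a * ((t₁ : ℤ) - t₂) + b * ((t₁ : ℤ) - t₃) = 0 → t₁ = t₂ ∧ t₁ = t₃)
    {P : Finset ((Fin n → Fin q) × ℕ)} {σ : Fin k → ℤ}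
    (hP : ∀ p ∈ P, p.2 ∈ T ∧ ∀ l, extendWord p.1 p.2 ⬝ᵥ H l = σ l)
    {S : Finset (Fin n → Fin q)} (hS : S ⊆ P.image Prod.fst) (hcard : S.card = 3) :
    n + 3 * m < coverage S := by
  obtain ⟨x₁, x₂, x₃, h12, h13, h23, rfl⟩ := Finset.card_eq_three.1 hcard
  have hmem : ∀ x ∈ ({x₁, x₂, x₃} : Finset (Fin n → Fin q)),
      ∃ t ∈ T, ∀ l, extendWord x t ⬝ᵥ H l = σ l := by
    intro x hx
    obtain ⟨p, hp, rfl⟩ := Finset.mem_image.1 (hS hx)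
    exact ⟨p.2, hP p hp⟩
  obtain ⟨t₁, ht₁, hx₁⟩ := hmem x₁ (by simp)
  obtain ⟨t₂, ht₂, hx₂⟩ := hmem x₂ (by simp)
  obtain ⟨t₃, ht₃, hx₃⟩ := hmem x₃ (by simp)
  by_contra! hle
  rw [coverage_triple x₁ x₂ x₃ t₁ t₂ t₃] at hle
  have hne : ∀ {x y : Fin n → Fin q} (t u : ℕ), x ≠ y → extendWord x t ≠ extendWord y u := by
    intro x y t u hxy h
    refine hxy (funext fun i => Fin.ext ?_)
    have := congrFun h (some i)
    simpa using this
  set z := extendWord x₁ t₁ - extendWord x₂ t₂ with hz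
  set z' := extendWord x₁ t₁ - extendWord x₃ t₃ with hz'
  have hker : ∀ l, z ⬝ᵥ H l = 0 := fun l => by rw [hz, sub_dotProduct, hx₁, hx₂, sub_self]
  have hker' : ∀ l, z' ⬝ᵥ H l = 0 := fun l => by rw [hz', sub_dotProduct, hx₁, hx₃, sub_self]
  have hz0 : z ≠ 0 := sub_ne_zero.2 (hne _ _ h12)
  have hz0' : z' ≠ 0 := sub_ne_zero.2 (hne _ _ h13)
  have hzz : z ≠ z' := fun h => hne t₂ t₃ h23 (sub_right_injective h)
  have h1 := hrel (fun i => (z (some i) = 0, z' (some i) = 0, z (some i) = z' (some i))) z z' hker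
    hker' hz0 hz0' hzz (by omega) fun _ => rfl
  obtain ⟨h2, h3⟩ := hT _ _ (hα _) (hβ _) (hαβ _) (hαM _) (hβM _) t₁ ht₁ t₂ ht₂ t₃ ht₃ h1
  rcases hH.pair z z' hker hker' (by
    rw [Fintype.sum_option]
    have h4 : pairWeight (z none) (z' none) = 0 := by simp [pairWeight, hz, hz', h2.symm, h3.symm]
    omega) with h | h | h
  · exact hz0 h
  · exact hz0' h
  · exact hzz h

/-- Pigeonhole over the syndromes, which lie in a box of side O(q) in dimension k. -/
lemma exists_extendWord_fiber {k : ℕ} (hk : 1 ≤ k) {H : Fin k → Option (Fin n) → ℤ}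
    (hH : IsGeneric H) {K : ℕ} (hK : ∀ l, ∑ o, |H l o| ≤ K) (hq : 1 ≤ q) {T : Finset ℕ}
    (hT : ∀ t ∈ T, t < q) :
    ∃ (P : Finset ((Fin n → Fin q) × ℕ)) (σ : Fin k → ℤ),
      (∀ p ∈ P, p.2 ∈ T ∧ ∀ l, extendWord p.1 p.2 ⬝ᵥ H l = σ l) ∧
        q ^ n * T.card ≤ ((2 * K + 1) * q) ^ k * (P.image Prod.fst).card := by
  set U : Finset ((Fin n → Fin q) × ℕ) := Finset.univ ×ˢ T with hU
  set V : Finset (Fin k → ℤ) :=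
    Fintype.piFinset fun _ => Finset.Icc (-(K * q : ℕ) : ℤ) (K * q : ℕ) with hV
  have hmaps : ∀ p ∈ U, (fun l => extendWord p.1 p.2 ⬝ᵥ H l) ∈ V := by
    intro p hp
    have hpT := hT _ (Finset.mem_product.1 hp).2
    rw [hV, Fintype.mem_piFinset]
    intro l
    rw [Finset.mem_Icc, ← abs_le]
    calc |extendWord p.1 p.2 ⬝ᵥ H l| ≤ ∑ o, |extendWord p.1 p.2 o * H l o| :=
          Finset.abs_sum_le_sum_abs _ _
      _ ≤ ∑ o, (q : ℤ) * |H l o| := Finset.sum_le_sum fun o _ => by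
          rw [abs_mul]
          refine mul_le_mul_of_nonneg_right ?_ (abs_nonneg _)
          rcases o with _ | i
          · rw [extendWord_none, Nat.abs_cast]
            exact_mod_cast hpT.le
          · rw [extendWord_some, Nat.abs_cast]
            exact_mod_cast (p.1 i).2.le
      _ ≤ (K * q : ℕ) := by
          rw [← Finset.mul_sum, mul_comm]
          push_cast
          exact mul_le_mul_of_nonneg_right (hK l) (by positivity)
  have hVcard : V.card ≤ ((2 * K + 1) * q) ^ k := by
    rw [hV, Fintype.card_piFinset_const, Int.card_Icc]
    refine Nat.pow_le_pow_left ?_ _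
    have : ((K * q : ℕ) + 1 - -(K * q : ℕ) : ℤ).toNat = 2 * (K * q) + 1 := by omega
    rw [this]
    nlinarith
  have hfib : ∃ σ ∈ V, U.card ≤ V.card *
      (U.filter fun p => (fun l => extendWord p.1 p.2 ⬝ᵥ H l) = σ).card := by
    by_contra! hlt
    have hVne : V.Nonempty := ⟨0, by
      rw [hV, Fintype.mem_piFinset]
      intro l
      rw [Finset.mem_Icc, Pi.zero_apply]
      omega⟩
    have h1 := Finset.card_eq_sum_card_fiberwise (s := U) (t := V)
      (f := fun p l => extendWord p.1 p.2 ⬝ᵥ H l) fun p hp => hmaps p hp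
    have h2 := Finset.sum_lt_sum_of_nonempty hVne hlt
    rw [← Finset.mul_sum, ← h1, Finset.sum_const, smul_eq_mul] at h2
    exact lt_irrefl _ h2
  obtain ⟨σ, -, hσ⟩ := hfib
  refine ⟨U.filter fun p => (fun l => extendWord p.1 p.2 ⬝ᵥ H l) = σ, σ, fun p hp => ?_, ?_⟩
  rotate_left
  · rw [Finset.card_image_of_injOn]
    · refine le_trans ?_ (hσ.trans (Nat.mul_le_mul_right _ hVcard))
      simp [hU]
    · rintro ⟨x, t⟩ hp ⟨y, u⟩ hp' (rfl : x = y)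
      have hp1 := congrFun (Finset.mem_filter.1 hp).2
      have hp2 := congrFun (Finset.mem_filter.1 hp').2
      by_contra hne
      -- Two extensions of one word would differ by a kernel vector of weight 1, so no word is
      -- counted twice.
      have h1 := hH.single (extendWord x t - extendWord x u) (fun h => hne (by
        have := congrFun h none
        simp only [Pi.sub_apply, extendWord_none, Pi.zero_apply, sub_eq_zero, Nat.cast_inj] at this
        rw [this])) fun l => by
          rw [sub_dotProduct]
          exact sub_eq_zero.2 ((hp1 l).trans (hp2 l).symm)
      rw [Finset.card_filter, Fintype.sum_option] at h1
      simp only [Pi.sub_apply, extendWord_some, sub_self, ne_eq, not_true_eq_false, if_false,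
        Finset.sum_const_zero] at h1
      split_ifs at h1 <;> omega
  · have h1 := Finset.mem_filter.1 hp
    exact ⟨(Finset.mem_product.1 h1.1).2, congrFun h1.2⟩

end extension

lemma eventually_exists_code_coverage_of_odd (n : ℕ) {m : ℕ} (hm : Odd m) {ε : ℝ} (hε : 0 < ε) :
    ∀ᶠ q : ℕ in atTop, ∃ C : Finset (Fin n → Fin q),
      (∀ S ⊆ C, S.card = 3 → n + 3 * m < coverage S) ∧
        (q : ℝ) ^ ((n : ℝ) - (3 * (m : ℝ) - 1) / 2 - ε) < C.card := by
  obtain ⟨j, rfl⟩ := hm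
  -- This is (3m + 1)/2 for m = 2j + 1, whence n + 1 - k = n - (3m - 1)/2.
  set k := 3 * j + 2 with hk
  obtain ⟨H, hH⟩ := exists_isGeneric (ι := Option (Fin n)) k
  choose α β hα hβ hαβ hrel using fun τ => hH.exists_relation τ
  obtain ⟨M, hM⟩ : ∃ M : ℕ, ∀ τ, |α τ| ≤ M ∧ |β τ| ≤ M := by
    have hle : ∀ f : (Fin n → Prop × Prop × Prop) → ℤ, ∀ τ, |f τ| ≤ ∑ τ, |f τ| := fun f τ =>
      Finset.single_le_sum (f := fun τ => |f τ|) (fun _ _ => abs_nonneg _) (Finset.mem_univ τ)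
    have h0 : ∀ f : (Fin n → Prop × Prop × Prop) → ℤ, 0 ≤ ∑ τ, |f τ| := fun f =>
      Finset.sum_nonneg fun _ _ => abs_nonneg _
    refine ⟨(∑ τ, |α τ| + ∑ τ, |β τ|).toNat, fun τ => ?_⟩
    have h1 := hle α τ
    have h2 := hle β τ
    have h3 := h0 α
    have h4 := h0 β
    constructor <;> omega
  obtain ⟨K, hK⟩ : ∃ K : ℕ, ∀ l, ∑ o, |H l o| ≤ K := by
    refine ⟨(∑ l, ∑ o, |H l o|).toNat, fun l => le_trans ?_ (Int.self_le_toNat _)⟩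
    exact Finset.single_le_sum (f := fun l => ∑ o, |H l o|)
      (fun _ _ => Finset.sum_nonneg fun _ _ => abs_nonneg _) (Finset.mem_univ l)
  have hv : Tendsto (fun q : ℕ => (q : ℝ) ^ (ε / 2)) atTop atTop :=
    (tendsto_rpow_atTop (by linarith)).comp tendsto_natCast_atTop_atTop
  filter_upwards [eventually_exists_set_without_relations M (half_pos hε), eventually_ge_atTop 1,
    hv.eventually_gt_atTop ((2 * K + 1) ^ k)] with q ⟨T, hTq, hTcard, hT⟩ hq hqK
  obtain ⟨P, σ, hP, hcard⟩ := exists_extendWord_fiber (by omega) hH hK hq hTq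
  refine ⟨P.image Prod.fst, fun S hS hS3 => hH.lt_coverage (by omega) hα hβ hαβ hrel
    (fun τ => (hM τ).1) (fun τ => (hM τ).2) hT hP hS hS3, ?_⟩
  have hq0 : (0 : ℝ) < q := by exact_mod_cast hq
  have h1 : (q : ℝ) ^ n * T.card ≤ ((2 * K + 1) * q) ^ k * ((P.image Prod.fst).card : ℝ) := by
    exact_mod_cast hcard
  have h2 : (0 : ℝ) < (2 * K + 1) ^ k * (q : ℝ) ^ k := by positivity
  rw [mul_pow] at h1
  rw [← mul_lt_mul_iff_right₀ h2]
  refine lt_of_lt_of_le ?_ h1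
  calc _ < (q : ℝ) ^ (ε / 2) * (q : ℝ) ^ k *
        (q : ℝ) ^ ((n : ℝ) - (3 * ((2 * j + 1 : ℕ) : ℝ) - 1) / 2 - ε) := by gcongr
    _ = (q : ℝ) ^ n * (q : ℝ) ^ (1 - ε / 2) := by
        rw [← Real.rpow_natCast, ← Real.rpow_natCast, ← Real.rpow_add hq0, ← Real.rpow_add hq0,
          ← Real.rpow_add hq0, hk]
        congr 1
        push_cast
        ring
    _ ≤ _ := by gcongr

/-- List-decodable codes with list size two and an odd decoding radius. -/
lemma exists_code_of_odd (n : ℕ) {ε : ℝ} (hε : 0 < ε) : ∃ q₀ : ℕ, ∀ q : ℕ, q₀ ≤ q → ∀ m < n,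
    Odd m → ∃ C : Finset (Fin n → Fin q), (∀ S ⊆ C, S.card = 3 → n + 3 * m < coverage S) ∧
      (q : ℝ) ^ ((n : ℝ) - (3 * (m : ℝ) - 1) / 2 - ε) < C.card := by
  have h : ∀ᶠ q : ℕ in atTop, ∀ m ∈ Finset.range n, Odd m → ∃ C : Finset (Fin n → Fin q),
      (∀ S ⊆ C, S.card = 3 → n + 3 * m < coverage S) ∧
        (q : ℝ) ^ ((n : ℝ) - (3 * (m : ℝ) - 1) / 2 - ε) < C.card := by
    -- Only finitely many m matter, so the threshold for q does not depend on the radius.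
    rw [Filter.eventually_all_finset]
    intro m _
    by_cases hm : Odd m
    · filter_upwards [eventually_exists_code_coverage_of_odd n hm hε] with q hq _ using hq
    · exact Eventually.of_forall fun q h => absurd h hm
  obtain ⟨q₀, h₀⟩ := eventually_atTop.1 h
  exact ⟨q₀, fun q hq m hm => h₀ q hq m (Finset.mem_range.2 hm)⟩

end ListDecoding

/-! ### Centres of balls around codewords with common small support. -/

namespace ListDecoding

section allocation

lemma exists_map_forall_le_card_fiber {α β : Type*} [Fintype β] [Nonempty β] [DecidableEq β]
    (A : Finset α) (d : β → ℕ) (h : ∑ b, d b ≤ A.card) :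
    ∃ f : α → β, ∀ b, d b ≤ (A.filter fun i => f i = b).card := by
  classical
  obtain ⟨e⟩ : Nonempty ((Σ b, Fin (d b)) ↪ A) :=
    Function.Embedding.nonempty_of_card_le (by simpa using h)
  set f : α → β := fun i =>
    if h : ∃ s, (e s : α) = i then h.choose.1 else Classical.arbitrary β with hf
  have hfe : ∀ s, f (e s) = s.1 := by
    intro s
    have hex : ∃ s', (e s' : α) = e s := ⟨s, rfl⟩
    rw [hf]
    simp only [dif_pos hex]
    rw [e.injective (Subtype.ext hex.choose_spec)]
  refine ⟨f, fun b => ?_⟩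
  have h1 := Finset.card_le_card (s := Finset.univ.image fun j : Fin (d b) => (e ⟨b, j⟩ : α))
    (t := A.filter fun i => f i = b) fun i hi => by
      obtain ⟨j, -, rfl⟩ := Finset.mem_image.1 hi
      exact Finset.mem_filter.2 ⟨(e _).2, hfe _⟩
  rwa [Finset.card_image_of_injective, Finset.card_univ, Fintype.card_fin] at h1
  intro j j' hj
  simpa using e.injective (Subtype.ext hj)

variable {n : ℕ} {F : Type*} [DecidableEq F]

lemma hammingDist_le_of_card_le {x v : Fin n → F} {J : Finset (Fin n)} {m : ℕ}
    (h : ∀ i, i ∉ J → x i = v i) (hJ : J.card ≤ m + (J.filter fun i => x i = v i).card) :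
    hammingDist x v ≤ m := by
  have h1 : (Finset.univ.filter fun i => x i ≠ v i) = J.filter fun i => ¬ x i = v i := by
    ext i
    simp only [Finset.mem_filter, Finset.mem_univ, true_and]
    exact ⟨fun hi => ⟨by_contra fun hiJ => hi (h i hiJ), hi⟩, fun hi => hi.2⟩
  have h2 := Finset.card_filter_add_card_filter_not (s := J) (fun i => x i = v i)
  unfold hammingDist
  rw [h1]
  omega

end allocation

section linear

variable {n : ℕ} {F : Type*} [Field F]

/-- The codewords of `D` whose support is contained in `J`. -/
def supportedWords (D : Submodule F (Fin n → F)) (J : Finset (Fin n)) :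
    Submodule F (Fin n → F) :=
  D ⊓ LinearMap.ker (LinearMap.funLeft F F (Subtype.val : {i // i ∉ J} → Fin n))

lemma mem_supportedWords {D : Submodule F (Fin n → F)} {J : Finset (Fin n)} {x : Fin n → F} :
    x ∈ supportedWords D J ↔ x ∈ D ∧ ∀ i, i ∉ J → x i = 0 := by
  rw [supportedWords, Submodule.mem_inf, LinearMap.mem_ker]
  refine and_congr_right fun _ => ⟨fun h i hi => congrFun h ⟨i, hi⟩, fun h => ?_⟩
  funext i
  exact h i.1 i.2

lemma card_add_finrank_le (D : Submodule F (Fin n → F)) (J : Finset (Fin n)) :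
    J.card + Module.finrank F D ≤ n + Module.finrank F (supportedWords D J) := by
  set φ := LinearMap.funLeft F F (Subtype.val : {i // i ∉ J} → Fin n)
  have h1 := Submodule.finrank_sup_add_finrank_inf_eq D (LinearMap.ker φ)
  have h2 := φ.finrank_range_add_finrank_ker
  have h3 := Submodule.finrank_le (LinearMap.range φ)
  have h4 := Submodule.finrank_le (D ⊔ LinearMap.ker φ)
  have h5 := Finset.card_add_card_compl J
  have h6 : Fintype.card {i // i ∉ J} = Jᶜ.card := by
    rw [Fintype.card_subtype]
    congr 1
    ext i
    simp
  rw [Module.finrank_fintype_fun_eq_card] at h2 h3 h4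
  rw [Fintype.card_fin] at h2 h4 h5
  change _ ≤ n + Module.finrank F ↥(D ⊓ LinearMap.ker φ)
  omega

variable [DecidableEq F]

/-- Over a small field, any `L + 1` words supported on a large set `J` lie in a small ball. -/
lemma exists_forall_hammingDist_le_of_card_le {L : ℕ} [Fintype F] (hF : Fintype.card F ≤ L)
    {S : Finset (Fin n → F)} {J : Finset (Fin n)} (hS : ∀ x ∈ S, ∀ i, i ∉ J → x i = 0) {m : ℕ}
    (hJ : L * J.card ≤ L * m + (J.card - L * L ^ S.card)) :
    ∃ v, ∀ x ∈ S, hammingDist x v ≤ m := by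
  set κ := Fintype.card F with hκ
  have hκ0 : 0 < κ := Fintype.card_pos
  -- Positions are grouped by the letters that the words of S show there. In each group the centre
  -- takes all values of F about equally often; rounding loses at most |F| per group.
  set J' : (S → F) → Finset (Fin n) := fun p => J.filter fun i => (fun x : S => x.1 i) = p with hJ'
  have hex : ∀ p : S → F, ∃ g : Fin n → F, ∀ a,
      (J' p).card / κ ≤ ((J' p).filter fun i => g i = a).card := fun p =>
    exists_map_forall_le_card_fiber (J' p) (fun _ => (J' p).card / κ) (by
      rw [Finset.sum_const, Finset.card_univ, smul_eq_mul]
      exact Nat.mul_div_le _ _)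
  choose g hg using hex
  refine ⟨fun i => if i ∈ J then g (fun x => x.1 i) i else 0, fun x hx => ?_⟩
  refine hammingDist_le_of_card_le (J := J) (fun i hi => by rw [if_neg hi, hS x hx i hi]) ?_
  have h1 : ∑ p, (J' p).card / κ ≤
      (J.filter fun i => x i = if i ∈ J then g (fun x => x.1 i) i else 0).card := by
    rw [Finset.card_eq_sum_card_fiberwise (f := fun i => fun x : S => x.1 i) (t := Finset.univ)
      fun _ _ => Finset.mem_univ _]
    refine Finset.sum_le_sum fun p _ => (hg p (p ⟨x, hx⟩)).trans (Finset.card_le_card ?_)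
    intro i hi
    simp only [hJ', Finset.mem_filter] at hi ⊢
    obtain ⟨⟨hiJ, hip⟩, hgi⟩ := hi
    refine ⟨⟨hiJ, ?_⟩, hip⟩
    rw [if_pos hiJ, hip, hgi, ← hip]
  have h2 : J.card = ∑ p, (J' p).card :=
    Finset.card_eq_sum_card_fiberwise fun _ _ => Finset.mem_univ _
  have h3 : J.card ≤ κ * ∑ p, (J' p).card / κ + κ * κ ^ S.card := by
    rw [h2, Finset.mul_sum]
    have h4 : κ * κ ^ S.card = ∑ _p : S → F, κ := by
      rw [Finset.sum_const, Finset.card_univ, Fintype.card_fun, Fintype.card_coe, smul_eq_mul,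
        mul_comm]
    rw [h4, ← Finset.sum_add_distrib]
    exact Finset.sum_le_sum fun p _ => (Nat.lt_mul_div_succ _ hκ0).le
  set X := ∑ p, (J' p).card / κ
  have h5 : κ * X ≤ L * X := Nat.mul_le_mul_right _ hF
  have h6 : κ * κ ^ S.card ≤ L * L ^ S.card := by gcongr
  refine le_trans ?_ (Nat.add_le_add_left h1 m)
  have h7 : L * J.card ≤ L * (m + X) := by rw [mul_add]; omega
  exact Nat.le_of_mul_le_mul_left h7 (by omega)

/-- The multiples of a word of small weight lie in a small ball. -/
lemma exists_multiples_of_small_weight {L m : ℕ} {z : Fin n → F} {lam : Fin (L + 1) → F}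
    (hm : 1 ≤ m) (hz : (Finset.univ.filter fun i => z i ≠ 0).card ≤ m + (m - 1) / L) :
    ∃ v, ∀ j, hammingDist (lam j • z) v ≤ m := by
  set J := Finset.univ.filter fun i => z i ≠ 0 with hJ
  -- The support is shared out evenly, and the centre follows the j-th multiple on the j-th share.
  obtain ⟨f, hf⟩ := exists_map_forall_le_card_fiber (β := Fin (L + 1)) J
    (fun _ => J.card / (L + 1)) (by
      rw [Finset.sum_const, Finset.card_univ, Fintype.card_fin, smul_eq_mul]
      exact Nat.mul_div_le _ _)
  refine ⟨fun i => lam (f i) * z i, fun j => ?_⟩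
  refine hammingDist_le_of_card_le (J := J) (fun i hi => ?_) ?_
  · have : z i = 0 := by simpa [hJ] using hi
    simp [this]
  · have h1 : (J.filter fun i => f i = j).card ≤
        (J.filter fun i => (lam j • z) i = lam (f i) * z i).card := by
      refine Finset.card_le_card (Finset.monotone_filter_right _ fun i _ hi => ?_)
      rw [hi]
      rfl
    refine le_trans ?_ (Nat.add_le_add_left ((hf j).trans h1) m)
    by_cases hcase : (m - 1) / L ≤ J.card / (L + 1)
    · omega
    · have h2 := Nat.lt_mul_div_succ J.card (Nat.succ_pos L)
      have h3 := Nat.mul_div_le (m - 1) L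
      rw [Nat.succ_eq_add_one] at h2
      set t := J.card / (L + 1)
      have h4 : L * (t + 1) ≤ L * ((m - 1) / L) := Nat.mul_le_mul_left _ (by omega)
      have h5 : (L + 1) * (t + 1) = L * (t + 1) + (t + 1) := by ring
      omega

end linear

end ListDecoding

/-! ### The dimension of linear list-decodable codes. -/

namespace ListDecoding

section linear

variable {n : ℕ} {F : Type*} [Field F] [DecidableEq F]

/-- The c + 1 positions other than k exceed the codimension, so they support a nonzero codeword; the
minimum weight forces it to use all of them. -/
lemma exists_word_vanishing_at {D : Submodule F (Fin n → F)} {c : ℕ}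
    (hmin : ∀ z ∈ D, z ≠ 0 → c < (Finset.univ.filter fun i => z i ≠ 0).card)
    (hD : n ≤ Module.finrank F D + c) {J : Finset (Fin n)} (hJ : J.card = c + 2) {k : Fin n}
    (hk : k ∈ J) :
    ∃ x ∈ D, (∀ i, i ∉ J → x i = 0) ∧ x k = 0 ∧ ∀ i ∈ J, i ≠ k → x i ≠ 0 := by
  have h1 := card_add_finrank_le D (J.erase k)
  rw [Finset.card_erase_of_mem hk, hJ] at h1
  have h2 : supportedWords D (J.erase k) ≠ ⊥ := by
    intro h
    rw [h, finrank_bot] at h1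
    omega
  obtain ⟨x, hx, hx0⟩ := Submodule.exists_mem_ne_zero_of_ne_bot h2
  obtain ⟨hxD, hxJ⟩ := mem_supportedWords.1 hx
  have h3 : (Finset.univ.filter fun i => x i ≠ 0) ⊆ J.erase k := fun i hi =>
    by_contra fun hiJ => (Finset.mem_filter.1 hi).2 (hxJ i hiJ)
  have h4 := Finset.eq_of_subset_of_card_le h3 (by
    rw [Finset.card_erase_of_mem hk, hJ]
    exact hmin x hxD hx0)
  refine ⟨x, hxD, fun i hi => hxJ i fun h => hi (Finset.mem_of_mem_erase h),
    hxJ k (Finset.notMem_erase _ _), fun i hi hik => ?_⟩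
  have : i ∈ J.erase k := Finset.mem_erase.2 ⟨hik, hi⟩
  rw [← h4] at this
  exact (Finset.mem_filter.1 this).2

/-- A linear code of large minimum distance and large dimension has many words in a small ball. -/
lemma exists_finset_in_ball_of_lt_weight {D : Submodule F (Fin n → F)} {K m : ℕ} (hm : 1 ≤ m)
    (hmin : ∀ z ∈ D, z ≠ 0 →
      m + (m - 1) / (K + 1) < (Finset.univ.filter fun i => z i ≠ 0).card)
    (hD : n ≤ Module.finrank F D + (m + (m - 1) / (K + 1)))
    (hn : m + (m - 1) / (K + 1) + 2 ≤ n) (hK : K ≤ (m - 1) / (K + 1)) :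
    ∃ S : Finset (Fin n → F), (S : Set (Fin n → F)) ⊆ D ∧ S.card = K + 2 ∧
      ∃ v, ∀ x ∈ S, hammingDist x v ≤ m := by
  have ham : (K + 1) * ((m - 1) / (K + 1)) ≤ m - 1 := Nat.mul_div_le _ _
  set a := (m - 1) / (K + 1) with ha
  have ham' : a ≤ m - 1 := Nat.div_le_self _ _
  obtain ⟨J, -, hJ⟩ := Finset.exists_subset_card_eq
    (s := (Finset.univ : Finset (Fin n))) (n := m + a + 2) (by simpa using hn)
  obtain ⟨e⟩ : Nonempty (Fin (K + 1) ⊕ Fin (K + 1) ↪ J) :=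
    Function.Embedding.nonempty_of_card_le (by
      rw [Fintype.card_sum, Fintype.card_fin, Fintype.card_coe, hJ]
      omega)
  have he : Function.Injective fun s => (e s : Fin n) := Subtype.val_injective.comp e.injective
  choose y hyD hyJ hyk hy0 using fun j => exists_word_vanishing_at hmin hD hJ (e (Sum.inl j)).2
  have hne : ∀ i j, (e (Sum.inr i) : Fin n) ≠ e (Sum.inl j) := fun i j h => by
    simpa using he h
  -- The zero word and K + 1 scaled words: the j-th vanishes at `e (Sum.inl j)`, as zero does, and
  -- agrees with the 0-th at `e (Sum.inr j)`.
  set x : Option (Fin (K + 1)) → Fin n → F := fun o => o.elim 0 fun j =>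
    (y 0 (e (Sum.inr j)) / y j (e (Sum.inr j))) • y j with hx
  have hc : ∀ j, y 0 (e (Sum.inr j)) / y j (e (Sum.inr j)) ≠ 0 := fun j =>
    div_ne_zero (hy0 _ _ (e _).2 (hne _ _)) (hy0 _ _ (e _).2 (hne _ _))
  have hxD : ∀ o, x o ∈ D := by
    rintro (_ | j)
    · exact D.zero_mem
    · exact D.smul_mem _ (hyD j)
  have hxJ : ∀ o, ∀ i, i ∉ J → x o i = 0 := by
    rintro (_ | j) i hi
    · rfl
    · simp [hx, hyJ j i hi]
  have hxk : ∀ j, x (some j) (e (Sum.inl j)) = 0 := fun j => by simp [hx, hyk j]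
  have hxk' : ∀ j i, i ∈ J → i ≠ e (Sum.inl j) → x (some j) i ≠ 0 := fun j i hi hij => by
    simp only [hx, Option.elim_some, Pi.smul_apply, smul_eq_mul]
    exact mul_ne_zero (hc j) (hy0 j i hi hij)
  have hxl : ∀ j, x (some j) (e (Sum.inr j)) = y 0 (e (Sum.inr j)) := fun j => by
    simp only [hx, Option.elim_some, Pi.smul_apply, smul_eq_mul]
    exact div_mul_cancel₀ _ (hy0 _ _ (e _).2 (hne _ _))
  have hx0l : ∀ j, x (some 0) (e (Sum.inr j)) = y 0 (e (Sum.inr j)) := fun j => by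
    simp only [hx, Option.elim_some, Pi.smul_apply, smul_eq_mul]
    rw [div_self (hy0 _ _ (e _).2 (hne _ _)), one_mul]
  have hinj : Function.Injective x := by
    have hsome : ∀ j, x (some j) ≠ x none := fun j h =>
      hxk' j _ (e (Sum.inr j)).2 (hne _ _) (congrFun h _)
    rintro (_ | i) (_ | j) hij
    · rfl
    · exact absurd hij.symm (hsome j)
    · exact absurd hij (hsome i)
    · by_contra hne'
      refine hxk' i (e (Sum.inl j)) (e _).2 (fun h => hne' ?_) ?_
      · have := he h
        simp only [Sum.inl.injEq] at this
        rw [this]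
      · rw [hij, hxk]
  set R := J.filter fun i => ∀ s, (e s : Fin n) ≠ i with hR
  set I := Finset.univ.map ⟨fun s => (e s : Fin n), he⟩ with hI
  have hRcard : R.card + 2 * (K + 1) = m + a + 2 := by
    have h1 : R = J \ I := by
      ext i
      simp [hR, hI]
    have h2 : I ⊆ J := fun i hi => by
      obtain ⟨s, -, rfl⟩ := Finset.mem_map.1 hi
      exact (e s).2
    have h3 := Finset.card_sdiff_add_card_eq_card h2
    rw [← h1, hJ, hI, Finset.card_map, Finset.card_univ, Fintype.card_sum, Fintype.card_fin] at h3
    omega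
  -- The special positions where each word agrees with the centre; one such position serves at least
  -- two words.
  set ρ : Option (Fin (K + 1)) → Finset (Fin (K + 1) ⊕ Fin (K + 1)) := fun o =>
    o.elim (Finset.univ.map ⟨Sum.inl, Sum.inl_injective⟩) fun j =>
      insert (Sum.inl j) (if j = 0 then Finset.univ.map ⟨Sum.inr, Sum.inr_injective⟩
        else {Sum.inr j}) with hρ
  have hρnone : (ρ none).card = K + 1 := by simp [hρ]
  have hρzero : (ρ (some 0)).card = K + 2 := by simp [hρ]
  have hρsucc : ∀ j : Fin K, (ρ (some j.succ)).card = 2 := by simp [hρ, Fin.succ_ne_zero]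
  -- Each word needs a + 2 agreements in J. What is missing sums to (K + 2)a + 1 - 2K, and R has m +
  -- a - 2K positions, so (K + 1)a ≤ m - 1 is just enough.
  obtain ⟨f, hf⟩ := exists_map_forall_le_card_fiber R (fun o => a + 2 - (ρ o).card) (by
    rw [Fintype.sum_option, Fin.sum_univ_succ, hρnone, hρzero]
    simp only [hρsucc, Finset.sum_const, Finset.card_univ, Fintype.card_fin, smul_eq_mul]
    have h1 : (K + 1) * a = K * a + a := by ring
    rw [Nat.add_sub_cancel]
    omega)
  set v : Fin n → F := fun i => if ∃ j, (e (Sum.inl j) : Fin n) = i then 0 else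
    if ∃ j, (e (Sum.inr j) : Fin n) = i then x (some 0) i else x (f i) i with hv
  have hvinl : ∀ j, v (e (Sum.inl j)) = 0 := fun j => by
    simp only [hv]
    rw [if_pos ⟨j, rfl⟩]
  have hvinr : ∀ j, v (e (Sum.inr j)) = y 0 (e (Sum.inr j)) := fun j => by
    simp only [hv]
    rw [if_neg (fun ⟨i, hi⟩ => hne j i hi.symm), if_pos ⟨j, rfl⟩, hx0l]
  have hvR : ∀ i ∈ R, v i = x (f i) i := fun i hi => by
    have h1 := (Finset.mem_filter.1 hi).2
    simp only [hv]
    rw [if_neg (fun ⟨j, hj⟩ => h1 _ hj), if_neg (fun ⟨j, hj⟩ => h1 _ hj)]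
  have hvρ : ∀ o, ∀ s ∈ ρ o, x o (e s) = v (e s) := by
    rintro (_ | j) s hs
    · obtain ⟨j, -, rfl⟩ := Finset.mem_map.1 hs
      exact (hvinl j).symm
    · rcases Finset.mem_insert.1 hs with rfl | hs
      · rw [hxk]
        exact (hvinl j).symm
      · split_ifs at hs with hj
        · obtain ⟨i, -, rfl⟩ := Finset.mem_map.1 hs
          subst hj
          exact (hx0l i).trans (hvinr i).symm
        · obtain rfl := Finset.mem_singleton.1 hs
          rw [hxl, hvinr]
  refine ⟨Finset.univ.map ⟨x, hinj⟩, ?_, by simp, v, ?_⟩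
  · intro z hz
    obtain ⟨o, -, rfl⟩ := Finset.mem_map.1 (Finset.mem_coe.1 hz)
    exact hxD o
  · intro z hz
    obtain ⟨o, -, rfl⟩ := Finset.mem_map.1 hz
    refine hammingDist_le_of_card_le (J := J) (fun i hi => ?_) ?_
    · have hi' : ∀ s, (e s : Fin n) ≠ i := fun s h => hi (h ▸ (e s).2)
      simp only [hv, Function.Embedding.coeFn_mk]
      rw [if_neg (fun ⟨j, hj⟩ => hi' _ hj), if_neg (fun ⟨j, hj⟩ => hi' _ hj), hxJ o i hi,
        hxJ _ i hi]
    · have hdisj : Disjoint (R.filter fun i => f i = o)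
          ((ρ o).map ⟨fun s => (e s : Fin n), he⟩) := by
        rw [Finset.disjoint_left]
        intro i hi hi'
        obtain ⟨s, -, rfl⟩ := Finset.mem_map.1 hi'
        exact (Finset.mem_filter.1 (Finset.mem_filter.1 hi).1).2 s rfl
      have hsub : (R.filter fun i => f i = o) ∪ (ρ o).map ⟨fun s => (e s : Fin n), he⟩ ⊆
          J.filter fun i => x o i = v i := by
        intro i hi
        rcases Finset.mem_union.1 hi with hi | hi
        · obtain ⟨hiR, rfl⟩ := Finset.mem_filter.1 hi
          exact Finset.mem_filter.2 ⟨(Finset.mem_filter.1 hiR).1, (hvR i hiR).symm⟩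
        · obtain ⟨s, hs, rfl⟩ := Finset.mem_map.1 hi
          exact Finset.mem_filter.2 ⟨(e s).2, hvρ o s hs⟩
      have h1 := Finset.card_le_card hsub
      rw [Finset.card_union_of_disjoint hdisj, Finset.card_map] at h1
      have h2 := hf o
      simp only [Function.Embedding.coeFn_mk]
      omega

/-- Three regimes: over a field of at most L elements J supports enough words for the even split;
over a larger one a light word has L + 1 distinct multiples; without light words the code is almost
MDS. -/
lemma exists_finset_in_ball_of_finrank [Fintype F] {D : Submodule F (Fin n → F)} {L m : ℕ}
    (hL : 2 ≤ L) (hm : 1 ≤ m) (hD : n ≤ Module.finrank F D + (m + (m - 1) / L))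
    (hn : m + (m - 1) / L + L ≤ n) (ha : L * (L + L ^ (L + 1)) ≤ (m - 1) / L) :
    ∃ S : Finset (Fin n → F), (S : Set (Fin n → F)) ⊆ D ∧ S.card = L + 1 ∧
      ∃ v, ∀ x ∈ S, hammingDist x v ≤ m := by
  rcases le_or_gt (Fintype.card F) L with hF | hF
  · obtain ⟨J, -, hJ⟩ := Finset.exists_subset_card_eq
      (s := (Finset.univ : Finset (Fin n))) (n := m + (m - 1) / L + L) (by simpa using hn)
    have h1 := card_add_finrank_le D J
    have h2 : L + 1 ≤ (supportedWords D J : Set (Fin n → F)).toFinite.toFinset.card := by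
      rw [← Set.ncard_eq_toFinset_card]
      have h3 : (supportedWords D J : Set (Fin n → F)).ncard =
          Fintype.card F ^ Module.finrank F (supportedWords D J) := by
        rw [← Nat.card_eq_fintype_card, ← Module.natCard_eq_pow_finrank]
        rfl
      rw [h3]
      calc L + 1 ≤ 2 ^ L := Nat.lt_two_pow_self
        _ ≤ Fintype.card F ^ L := Nat.pow_le_pow_left Fintype.one_lt_card _
        _ ≤ _ := Nat.pow_le_pow_right Fintype.card_pos (by omega)
    obtain ⟨S, hS, hcard⟩ := Finset.exists_subset_card_eq h2
    have hmem : ∀ x ∈ S, x ∈ supportedWords D J := fun x hx => by simpa using hS hx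
    refine ⟨S, fun x hx => (mem_supportedWords.1 (hmem x hx)).1, hcard,
      exists_forall_hammingDist_le_of_card_le hF
        (fun x hx => (mem_supportedWords.1 (hmem x hx)).2) ?_⟩
    rw [hJ, hcard]
    have h4 := Nat.lt_mul_div_succ (m - 1) (by omega : 0 < L)
    have h5 := Nat.mul_div_le (m - 1) L
    set a := (m - 1) / L
    have h6 : L * (m + a + L) = L * m + L * a + L * L := by ring
    have h7 : L * (L + L ^ (L + 1)) = L * L + L * L ^ (L + 1) := by ring
    omega
  · by_cases hex : ∃ z ∈ D, z ≠ 0 ∧ (Finset.univ.filter fun i => z i ≠ 0).card ≤ m + (m - 1) / L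
    · obtain ⟨z, hzD, hz0, hz⟩ := hex
      obtain ⟨lam⟩ : Nonempty (Fin (L + 1) ↪ F) :=
        Function.Embedding.nonempty_of_card_le (by rwa [Fintype.card_fin])
      obtain ⟨v, hv⟩ := exists_multiples_of_small_weight (lam := lam) hm hz
      refine ⟨Finset.univ.map ⟨fun j => lam j • z, fun i j hij =>
        lam.injective (smul_left_injective F hz0 hij)⟩, ?_, by simp, v, ?_⟩
      · intro x hx
        obtain ⟨j, -, rfl⟩ := Finset.mem_map.1 (Finset.mem_coe.1 hx)
        exact D.smul_mem _ hzD
      · intro x hx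
        obtain ⟨j, -, rfl⟩ := Finset.mem_map.1 hx
        exact hv j
    · push Not at hex
      obtain ⟨K, rfl⟩ : ∃ K, L = K + 1 := ⟨L - 1, by omega⟩
      refine exists_finset_in_ball_of_lt_weight hm hex hD (by omega) (le_trans ?_ ha)
      calc K ≤ (K + 1) * 1 := by omega
        _ ≤ _ := Nat.mul_le_mul_left _ (by omega)

/-- The dimension of a linear list-decodable code of large length. -/
lemma exists_finrank_add_ceil_le {L : ℕ} (hL : 2 ≤ L) {r : ℝ} (hr0 : 0 ≤ r)
    (hr : r < (L : ℝ) / (L + 1)) : ∃ n₀ : ℕ, ∀ n : ℕ, n₀ ≤ n → ∀ m : ℕ, r * n = m →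
      ∀ (F : Type) [Field F] [Fintype F] [DecidableEq F] (D : Submodule F (Fin n → F)),
        IsListDecodable r L (D : Set (Fin n → F)) →
          Module.finrank F D + ⌈((L : ℝ) + 1) / L * (r * n)⌉₊ ≤ n := by
  have hL0 : (0 : ℝ) < L := by positivity
  rw [lt_div_iff₀ (by positivity)] at hr
  set A := L * (L + L ^ (L + 1)) with hA
  -- The first bound makes m large when r > 0; the second leaves room for m + ⌊(m - 1)/L⌋ + L
  -- positions, using r < L/(L + 1).
  obtain ⟨n₁, hn₁⟩ := exists_nat_gt ((L * A + 1 : ℕ) / r)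
  obtain ⟨n₂, hn₂⟩ := exists_nat_gt (L * L / (L - r * (L + 1)))
  refine ⟨max n₁ n₂, fun n hn m hrm F _ _ _ D hDL => ?_⟩
  have hnn₁ : (n₁ : ℝ) ≤ n := by exact_mod_cast (le_max_left _ _).trans hn
  have hnn₂ : (n₂ : ℝ) ≤ n := by exact_mod_cast (le_max_right _ _).trans hn
  rw [hrm]
  have hfin : Module.finrank F D ≤ n := by
    simpa using Submodule.finrank_le D
  rcases Nat.eq_zero_or_pos m with rfl | hm
  · simpa using hfin
  have hr1 : 0 < r := by
    rcases hr0.eq_or_lt with rfl | h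
    · rw [zero_mul] at hrm
      have : (0 : ℝ) < m := by exact_mod_cast hm
      linarith
    · exact h
  have hmA : L * A + 1 ≤ m := by
    have h1 : ((L * A + 1 : ℕ) : ℝ) < n₁ * r := by rwa [div_lt_iff₀ hr1] at hn₁
    have h2 : (n₁ : ℝ) * r ≤ m := by rw [← hrm, mul_comm]; gcongr
    exact_mod_cast (h1.trans_le h2).le
  have ha : A ≤ (m - 1) / L := by
    rw [Nat.le_div_iff_mul_le (by omega), mul_comm]
    omega
  have hLa := Nat.mul_div_le (m - 1) L
  have hLa' := Nat.lt_mul_div_succ (m - 1) (by omega : 0 < L)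
  have hspace : m + (m - 1) / L + L ≤ n := by
    rw [div_lt_iff₀ (by linarith)] at hn₂
    have h1 : (L : ℝ) * L ≤ n * (L - r * (L + 1)) :=
      hn₂.le.trans (mul_le_mul_of_nonneg_right hnn₂ (by linarith))
    have h2 : (L : ℝ) * L + m * (L + 1) ≤ n * L := by rw [← hrm]; linarith
    have h3 : L * L + m * (L + 1) ≤ n * L := by exact_mod_cast h2
    refine Nat.le_of_mul_le_mul_left (?_ : L * _ ≤ L * n) (by omega)
    set a := (m - 1) / L
    have h4 : L * (m + a + L) = L * m + L * a + L * L := by ring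
    have h5 : m * (L + 1) = L * m + m := by ring
    have h6 : n * L = L * n := by ring
    omega
  by_contra! hlt
  have hceil : ⌈((L : ℝ) + 1) / L * m⌉₊ ≤ m + (m - 1) / L + 1 := by
    rw [Nat.ceil_le, div_mul_eq_mul_div, div_le_iff₀ hL0]
    set a := (m - 1) / L
    have h1 : (L + 1) * m ≤ (m + a + 1) * L := by
      have h2 : (m + a + 1) * L = L * m + L * (a + 1) := by ring
      have h3 : (L + 1) * m = L * m + m := by ring
      omega
    exact_mod_cast h1
  obtain ⟨S, hSD, hS, v, hv⟩ := exists_finset_in_ball_of_finrank hL hm (D := D) (by omega) hspace ha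
  obtain ⟨x, hx, hlt'⟩ := exists_mem_lt_hammingDist hrm hDL S hSD (by omega) v
  exact absurd (hv x hx) (not_le.2 hlt')

end linear

end ListDecoding

/-! ### Comparison with linear codes and assembly. -/

namespace ListDecoding

/-- As L does not divide m, the ceiling exceeds (L + 1)m/L by at least 1/L, and q^(1/L) outweighs
the constant 1/μ. -/
lemma ncard_lt_of_finrank_add_ceil_le {n L m q : ℕ} (hL : 1 ≤ L) (hdvd : ¬ L ∣ m) {μ N : ℝ}
    (hq : 1 ≤ q) (hμq : 1 < μ * (q : ℝ) ^ ((1 : ℝ) / L))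
    (hN : μ * (q : ℝ) ^ ((n : ℝ) - m * (L + 1) / L) ≤ N) {F : Type*} [Field F] [Fintype F]
    (hF : Fintype.card F = q) {D : Submodule F (Fin n → F)}
    (hD : Module.finrank F D + ⌈((L : ℝ) + 1) / L * m⌉₊ ≤ n) :
    ((D : Set (Fin n → F)).ncard : ℝ) < N := by
  have hL0 : (0 : ℝ) < L := by exact_mod_cast hL
  have hq0 : (0 : ℝ) < q := by exact_mod_cast hq
  have h1 : (D : Set (Fin n → F)).ncard = q ^ Module.finrank F D := by
    rw [← hF, ← Nat.card_eq_fintype_card, ← Module.natCard_eq_pow_finrank]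
    rfl
  set c := ⌈((L : ℝ) + 1) / L * m⌉₊ with hc
  have h2 : (L + 1) * m ≤ c * L := by
    have := Nat.le_ceil (((L : ℝ) + 1) / L * m)
    rw [← hc, div_mul_eq_mul_div, div_le_iff₀ hL0] at this
    exact_mod_cast this
  have h3 : (L + 1) * m ≠ c * L := fun h =>
    hdvd ((Nat.dvd_add_right (Dvd.intro m rfl : L ∣ L * m)).1
      ⟨c, by rw [mul_comm L c, ← h]; ring⟩)
  have h4 : (L + 1) * m + 1 ≤ c * L := lt_of_le_of_ne h2 h3
  have h5 : (Module.finrank F D : ℝ) + 1 / L ≤ (n : ℝ) - m * (L + 1) / L := by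
    have h6 : ((L : ℝ) + 1) * m + 1 ≤ c * L := by exact_mod_cast h4
    have h7 : (Module.finrank F D : ℝ) + c ≤ n := by exact_mod_cast hD
    have h8 : (m * ((L : ℝ) + 1) + 1) / L ≤ c := by
      rw [div_le_iff₀ hL0]
      linarith
    rw [add_div] at h8
    linarith
  refine lt_of_lt_of_le ?_ hN
  rw [h1, Nat.cast_pow, ← Real.rpow_natCast]
  have hμ : 0 < μ := pos_of_mul_pos_left (one_pos.trans hμq) (by positivity)
  calc (q : ℝ) ^ (Module.finrank F D : ℝ)
      < μ * (q : ℝ) ^ ((1 : ℝ) / L) * (q : ℝ) ^ (Module.finrank F D : ℝ) :=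
        lt_mul_of_one_lt_left (by positivity) hμq
    _ = μ * (q : ℝ) ^ ((Module.finrank F D : ℝ) + 1 / L) := by
        rw [Real.rpow_add hq0]
        ring
    _ ≤ _ := by
        gcongr
        exact_mod_cast hq

end ListDecoding

theorem proposition4p6 :
    -- sparse `n`-uniform `n`-partite hypergraphs yield list-decodable codes of the same size
    (∀ n L q m : ℕ, 1 ≤ n → 1 ≤ L → ∀ r : ℝ, r * n = m →
      ∀ H : Hypergraph (Fin n × Fin q),
        ListDecoding.IsUniform H n → ListDecoding.IsPartite H (ListDecoding.part n q) →
        ListDecoding.IsSparse H (n + (L + 1) * m) (L + 1) →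
          ListDecoding.IsListDecodable r L (ListDecoding.codeOf H) ∧
          (ListDecoding.codeOf H).ncard = H.edgeSet.ncard) ∧
    -- first lower bound
    (∀ n L : ℕ, 1 ≤ n → 1 ≤ L → ∃ μ₁ : ℝ, 0 < μ₁ ∧
      ∀ q : ℕ, 2 ≤ q → ∀ r : ℝ, 0 ≤ r → r < (L : ℝ) / (L + 1) → ∀ m : ℕ, r * n = m →
        ∃ C : Set (Fin n → Fin q), ListDecoding.IsListDecodable r L C ∧
          μ₁ * (q : ℝ) ^ ((n : ℝ) - r * n * (L + 1) / L) ≤ (C.ncard : ℝ)) ∧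
    -- second lower bound, with a logarithmic factor
    (∀ n L : ℕ, 1 ≤ n → 2 ≤ L → ∃ μ₂ : ℝ, 0 < μ₂ ∧
      ∀ q : ℕ, 2 ≤ q → ∀ r : ℝ, 0 ≤ r → r < (L : ℝ) / (L + 1) → ∀ m : ℕ, r * n = m →
        Nat.gcd L m = 1 →
        ∃ C : Set (Fin n → Fin q), ListDecoding.IsListDecodable r L C ∧
          μ₂ * (q : ℝ) ^ ((n : ℝ) - r * n * (L + 1) / L) * Real.log q ^ ((1 : ℝ) / L)
            ≤ (C.ncard : ℝ)) ∧
    -- third lower bound, for list size two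
    (∀ n : ℕ, 1 ≤ n → ∀ ε : ℝ, 0 < ε → ∃ q₀ : ℕ,
      ∀ q : ℕ, q₀ ≤ q → ∀ r : ℝ, 0 ≤ r → r < 2 / 3 → ∀ m : ℕ, r * n = m → Odd m →
        ∃ C : Set (Fin n → Fin q), ListDecoding.IsListDecodable r 2 C ∧
          (q : ℝ) ^ ((n : ℝ) - (3 * (r * n) - 1) / 2 - ε) < (C.ncard : ℝ)) ∧
    -- separation of linear and nonlinear codes
    (∀ L : ℕ, 2 ≤ L → ∃ (μ : ℕ → ℝ) (q₀ : ℕ → ℕ), (∀ n, 0 < μ n) ∧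
      ∀ r : ℝ, 0 ≤ r → r < (L : ℝ) / (L + 1) → ∃ n₀ : ℕ, ∀ n : ℕ, n₀ ≤ n →
        ∀ m : ℕ, r * n = m →
          (∀ (F : Type) [Field F] [Fintype F] [DecidableEq F] (D : Submodule F (Fin n → F)),
            ListDecoding.IsListDecodable r L (D : Set (Fin n → F)) →
              Module.finrank F D + ⌈((L : ℝ) + 1) / L * (r * n)⌉₊ ≤ n) ∧
          (¬ L ∣ m → ∀ q : ℕ, q₀ n ≤ q →
            ∃ C : Set (Fin n → Fin q), ListDecoding.IsListDecodable r L C ∧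
              μ n * (q : ℝ) ^ ((n : ℝ) - r * n * (L + 1) / L) ≤ (C.ncard : ℝ) ∧
              ∀ (F : Type) [Field F] [Fintype F] [DecidableEq F],
                Fintype.card F = q → ∀ D : Submodule F (Fin n → F),
                  ListDecoding.IsListDecodable r L (D : Set (Fin n → F)) →
                    (D : Set (Fin n → F)).ncard < C.ncard)) := by
  refine ⟨fun n L q m _ _ r hr H _ hP hS =>
      ⟨ListDecoding.isListDecodable_codeOf hr hS, ListDecoding.ncard_codeOf hP⟩, ?_, ?_, ?_, ?_⟩
  · intro n L _ hL
    obtain ⟨μ, hμ, h⟩ := ListDecoding.exists_code_coverage n L hL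
    refine ⟨μ, hμ, fun q hq r _ _ m hr => ?_⟩
    obtain ⟨C, hC, hcard⟩ := h q m (by omega)
    refine ⟨C, ListDecoding.isListDecodable_of_coverage hr fun S hS =>
      hC S (by exact_mod_cast hS), ?_⟩
    rwa [hr, Set.ncard_coe_finset]
  · intro n L _ hL
    obtain ⟨μ, hμ, h⟩ := ListDecoding.exists_code_coverage_log n L hL
    refine ⟨μ, hμ, fun q hq r _ _ m hr hgcd => ?_⟩
    obtain ⟨C, hC, hcard⟩ := h q m hq hgcd
    refine ⟨C, ListDecoding.isListDecodable_of_coverage hr fun S hS =>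
      hC S (by exact_mod_cast hS), ?_⟩
    rwa [hr, Set.ncard_coe_finset]
  · intro n hn ε hε
    obtain ⟨q₀, h⟩ := ListDecoding.exists_code_of_odd n hε
    refine ⟨q₀, fun q hq r _ hr23 m hr hodd => ?_⟩
    have hn0 : (0 : ℝ) < n := by exact_mod_cast hn
    have hmn : m < n := by
      have : (m : ℝ) < n := by
        rw [← hr]
        nlinarith
      exact_mod_cast this
    obtain ⟨C, hC, hcard⟩ := h q hq m hmn hodd
    refine ⟨C, ListDecoding.isListDecodable_of_coverage hr fun S hS =>
      hC S (by exact_mod_cast hS), ?_⟩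
    rwa [hr, Set.ncard_coe_finset]
  · intro L hL
    choose μ hμ hcode using fun n => ListDecoding.exists_code_coverage n L (by omega)
    -- The threshold depends only on μ n and L, hence not on the radius.
    have hq₀ : ∀ n, ∃ q₀ : ℕ, ∀ q : ℕ, q₀ ≤ q →
        1 ≤ q ∧ 1 < μ n * (q : ℝ) ^ ((1 : ℝ) / L) := by
      intro n
      have hlim : Filter.Tendsto (fun q : ℕ => μ n * (q : ℝ) ^ ((1 : ℝ) / L)) Filter.atTop
          Filter.atTop :=
        ((tendsto_rpow_atTop (by positivity)).comp tendsto_natCast_atTop_atTop).const_mul_atTop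
          (hμ n)
      exact Filter.eventually_atTop.1
        ((Filter.eventually_ge_atTop 1).and (hlim.eventually_gt_atTop 1))
    choose q₀ hq₀ using hq₀
    refine ⟨μ, q₀, hμ, fun r hr0 hr => ?_⟩
    obtain ⟨n₀, hn₀⟩ := ListDecoding.exists_finrank_add_ceil_le hL hr0 hr
    refine ⟨n₀, fun n hn m hrm => ⟨hn₀ n hn m hrm, fun hdvd q hq => ?_⟩⟩
    obtain ⟨hq1, hq2⟩ := hq₀ n q hq
    obtain ⟨C, hC, hcard⟩ := hcode n q m hq1
    refine ⟨C, ListDecoding.isListDecodable_of_coverage hrm fun S hS =>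
      hC S (by exact_mod_cast hS), ?_, ?_⟩
    · rwa [hrm, Set.ncard_coe_finset]
    · intro F _ _ _ hF D hD
      have h1 := hn₀ n hn m hrm F D hD
      rw [hrm] at h1
      have h2 := ListDecoding.ncard_lt_of_finrank_add_ceil_le (by omega) hdvd hq1 hq2 hcard hF h1
      rw [Set.ncard_coe_finset]
      exact_mod_cast h2
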